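/- Let $\pi\colon Y\to M$ be a surjective submersion of smooth (finite-dimensional, Hausdorff, second countable) manifolds, let $Y^{[p]}$ be its $p$-fold fibre product over $M$, with $\pi_1,\pi_2\colon Y^{[2]}\to Y$ given by $\pi_1(y_1,y_2)=y_2$ and $\pi_2(y_1,y_2)=y_1$. For a function or differential form $\alpha$ on $Y$ put $\delta(\alpha)=\pi_1^*\alpha-\pi_2^*\alpha$ on $Y^{[2]}$, and for $g\colon Y^{[2]}\to\mathbb{Z}$ put $\delta(g)(y_1,y_2,y_3)=g(y_2,y_3)-g(y_1,y_3)+g(y_1,y_2)$. For $i=1,\dots,n$ let $L_i\to M$ be a Hermitian line bundle with a Hermitian connection $\nabla_i$ of curvature $F_{\nabla_i}\in\Omega^2(M,i\mathbb{R})$, and let $g_i\colon Y^{[2]}\to\mathbb{Z}$ be smooth (that is, locally constant) with $\delta(g_i)=0$. The cup product bundle gerbe $(L_i^{g_i},Y,\pi)$ is the Hermitian line bundle over $Y^{[2]}$ whose fibre at $(y_1,y_2)$ is $(L_i)_{\pi(y_1)}^{\otimes g_i(y_1,y_2)}$ (negative powers being powers of the dual), with the multiplication given by the canonical maps $L^{\otimes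 a}\otimes L^{\otimes b}\to L^{\otimes(a+b)}$; it has the bundle gerbe connection $\nabla_i^{g_i}$ induced by $\nabla_i$, with curvature $F_{\nabla_i^{g_i}}$. The general cup product bundle gerbe of the $(L_i^{g_i},Y,\pi)$ is their reduced product $\left(\bigotimes_{i=1}^n L_i^{g_i},Y,\pi\right)$; the product connection on it is the tensor product of the $\nabla_i^{g_i}$. A curving of a bundle gerbe connection $\nabla$ is a form $f\in\Omega^2(Y,i\mathbb{R})$ with $\delta(f)=F_\nabla$, and its three-curvature is the unique $\omega\in\Omega^3(M,i\mathbb{R})$ with $\pi^*\omega=df$. The real DD-class is the image in de Rham cohomology of the Dixmier–Douady class in $H^3(M,\mathbb{Z})$. Then: 1. There exist smooth functions $\varphi_i\colon Y\to\mathbb{R}$ such that $\delta(\varphi_i)=g_i$ for $i=1,\dots,n$. For any such functions $\varphi_1,\dots,\varphi_n$ the following hold. 2. The two-form $$f=\sum_{i=1}^n\varphi_i\,\pi^*F_{\nabla_i}\in\Omega^2(Y,i\mathbb{R})$$ satisfies $\delta(f)=\sum_{i=1}^n F_{\nabla_i^{g_i}}$ and is a curving for the product connection. 3. There are well-defined smooth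 maps $q_i\colon M\to U(1)$ with $q_i(\pi(y))=\exp(2\pi i\,\varphi_i(y))$ for all $y\in Y$, and the three-curvature of $f$ is $$\omega=\sum_{i=1}^n\frac{q_i^{-1}dq_i}{2\pi i}\wedge F_{\nabla_i}.$$ 4. The real DD-class of the general cup product bundle gerbe of the $(L_i^{g_i},Y,\pi)$ is represented by $$-\frac{1}{4\pi^2}\sum_{i=1}^n q_i^{-1}dq_i\wedge F_{\nabla_i}.$$ -/

import Mathlib

open Set Function
open scoped Manifold ContDiff Topology

noncomputable section

/-- A surjective submersion `π : Y → M` of smooth manifolds (without boundary). -/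
structure SurjSubmersion (EY : Type*) [NormedAddCommGroup EY] [NormedSpace ℝ EY]
    (Y : Type*) [TopologicalSpace Y] [ChartedSpace EY Y]
    (EM : Type*) [NormedAddCommGroup EM] [NormedSpace ℝ EM]
    (M : Type*) [TopologicalSpace M] [ChartedSpace EM M] where
  toFun : Y → M
  isSubmersion : Manifold.IsSubmersion 𝓘(ℝ, EY) 𝓘(ℝ, EM) ∞ toFun
  surjective : Function.Surjective toFun

section FibrePowers

variable {EY : Type*} [NormedAddCommGroup EY] [NormedSpace ℝ EY]
  {Y : Type*} [TopologicalSpace Y] [ChartedSpace EY Y]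
  {EM : Type*} [NormedAddCommGroup EM] [NormedSpace ℝ EM]
  {M : Type*} [TopologicalSpace M] [ChartedSpace EM M]

namespace SurjSubmersion

instance : CoeFun (SurjSubmersion EY Y EM M) (fun _ => Y → M) := ⟨SurjSubmersion.toFun⟩

variable (π : SurjSubmersion EY Y EM M)

lemma contMDiff : ContMDiff 𝓘(ℝ, EY) 𝓘(ℝ, EM) ∞ π := π.isSubmersion.contMDiff

/-- The model space of the fibres of the submersion. -/
abbrev Compl := π.isSubmersion.complement

lemma isSubmersionAt (y : Y) :
    Manifold.IsSubmersionAtOfComplement π.Compl 𝓘(ℝ, EY) 𝓘(ℝ, EM) ∞ π y :=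
  π.isSubmersion.isSubmersionOfComplement_complement y

/-- The adapted chart of `Y` around `y`. -/
def φ (y : Y) : OpenPartialHomeomorph Y EY := (π.isSubmersionAt y).domChart

/-- The adapted chart of `M` around `π y`. -/
def ψ (y : Y) : OpenPartialHomeomorph M EM := (π.isSubmersionAt y).codChart

/-- The splitting of the model space of `Y` in the adapted charts. -/
def split (y : Y) : EY ≃L[ℝ] EM × π.Compl := (π.isSubmersionAt y).equiv

lemma mem_φ (y : Y) : y ∈ (π.φ y).source := (π.isSubmersionAt y).mem_domChart_source

lemma maps_φ (y : Y) {z : Y} (hz : z ∈ (π.φ y).source) : π z ∈ (π.ψ y).source :=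
  (π.isSubmersionAt y).mapsto_domChart_source_codChart_source hz

lemma φ_smooth (y : Y) : ContMDiffOn 𝓘(ℝ, EY) 𝓘(ℝ, EY) ∞ (π.φ y) (π.φ y).source :=
  contMDiffOn_of_mem_maximalAtlas (π.isSubmersionAt y).domChart_mem_maximalAtlas

lemma φ_symm_smooth (y : Y) : ContMDiffOn 𝓘(ℝ, EY) 𝓘(ℝ, EY) ∞ (π.φ y).symm (π.φ y).target :=
  contMDiffOn_symm_of_mem_maximalAtlas (π.isSubmersionAt y).domChart_mem_maximalAtlas

lemma ψ_smooth (y : Y) : ContMDiffOn 𝓘(ℝ, EM) 𝓘(ℝ, EM) ∞ (π.ψ y) (π.ψ y).source :=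
  contMDiffOn_of_mem_maximalAtlas (π.isSubmersionAt y).codChart_mem_maximalAtlas

lemma ψ_symm_smooth (y : Y) : ContMDiffOn 𝓘(ℝ, EM) 𝓘(ℝ, EM) ∞ (π.ψ y).symm (π.ψ y).target :=
  contMDiffOn_symm_of_mem_maximalAtlas (π.isSubmersionAt y).codChart_mem_maximalAtlas

lemma ψ_π (y : Y) {z : Y} (hz : z ∈ (π.φ y).source) :
    π.ψ y (π z) = (π.split y (π.φ y z)).1 := by
  have h := (π.isSubmersionAt y).writtenInCharts
  have hz' : π.φ y z ∈ ((π.φ y).extend 𝓘(ℝ, EY)).target := by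
    simpa using (π.φ y).map_source hz
  have := h hz'
  simp only [comp_apply, OpenPartialHomeomorph.extend_coe, OpenPartialHomeomorph.extend_coe_symm,
    modelWithCornersSelf_coe, modelWithCornersSelf_coe_symm, id_eq] at this
  change π.ψ y (π ((π.φ y).symm (π.φ y z))) = _ at this
  rw [(π.φ y).left_inv hz] at this
  exact this

end SurjSubmersion

/-- The `(p+1)`-fold fibre product `Y^{[p+1]}` of `Y` over `M`. -/
def FibrePow (π : SurjSubmersion EY Y EM M) (p : ℕ) : Type _ :=
  {z : Fin (p + 1) → Y // ∀ i, π (z i) = π (z 0)}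

namespace FibrePow

variable {π : SurjSubmersion EY Y EM M} {p : ℕ}

instance : TopologicalSpace (FibrePow π p) :=
  inferInstanceAs (TopologicalSpace {z : Fin (p + 1) → Y // ∀ i, π (z i) = π (z 0)})

/-- The `i`-th entry `Y^{[p+1]} → Y`. -/
def entry (i : Fin (p + 1)) (z : FibrePow π p) : Y := z.1 i

/-- The projection `π^{[p+1]} : Y^{[p+1]} → M`. -/
def base (z : FibrePow π p) : M := π (z.1 0)

@[ext] lemma ext' {z w : FibrePow π p} (h : ∀ i, entry i z = entry i w) : z = w :=
  Subtype.ext (funext h)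

lemma π_entry (i : Fin (p + 1)) (z : FibrePow π p) : π (entry i z) = base z := z.2 i

lemma continuous_entry (i : Fin (p + 1)) : Continuous (entry i : FibrePow π p → Y) :=
  (continuous_apply i).comp continuous_subtype_val

lemma continuous_base : Continuous (base : FibrePow π p → M) :=
  π.contMDiff.continuous.comp (continuous_entry 0)

/-- The model space of `Y^{[p+1]}`. -/
abbrev Model (π : SurjSubmersion EY Y EM M) (p : ℕ) : Type _ := EM × (Fin (p + 1) → π.Compl)

section chart

variable (y : FibrePow π p)

/-- Coordinates of the `i`-th entry, given coordinates `u` on `Y^{[p+1]}`. -/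
def coord (i : Fin (p + 1)) (u : Model π p) : EY :=
  (π.split (y.1 i)).symm (π.ψ (y.1 i) ((π.ψ (y.1 0)).symm u.1), u.2 i)

/-- Domain of the chart around `y`. -/
def chartSource : Set (FibrePow π p) := {z | ∀ i, z.1 i ∈ (π.φ (y.1 i)).source}

/-- Target of the chart around `y`. -/
def chartTarget : Set (Model π p) :=
  {u | u.1 ∈ (π.ψ (y.1 0)).target ∧ ∀ i, (π.ψ (y.1 0)).symm u.1 ∈ (π.ψ (y.1 i)).source ∧
    coord y i u ∈ (π.φ (y.1 i)).target}

/-- Inverse of the chart, entry by entry. -/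
def chartInv (u : Model π p) (i : Fin (p + 1)) : Y := (π.φ (y.1 i)).symm (coord y i u)

lemma π_chartInv {u : Model π p} (hu : u ∈ chartTarget y) (i : Fin (p + 1)) :
    π (chartInv y u i) = (π.ψ (y.1 0)).symm u.1 := by
  have hmem : chartInv y u i ∈ (π.φ (y.1 i)).source := (π.φ (y.1 i)).map_target (hu.2 i).2
  have h := π.ψ_π _ hmem
  apply (π.ψ (y.1 i)).injOn (π.maps_φ _ hmem) (hu.2 i).1
  rw [h, chartInv, (π.φ (y.1 i)).right_inv (hu.2 i).2, coord]
  simp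

/-- The chart of `Y^{[p+1]}` around `y`: the base point in an adapted chart of `M`, and the
vertical coordinates of each entry in the adapted charts of `Y`. -/
def chartFun (z : FibrePow π p) : Model π p :=
  (π.ψ (y.1 0) (base z), fun i => (π.split (y.1 i) (π.φ (y.1 i) (z.1 i))).2)

lemma coord_chartFun {z : FibrePow π p} (hz : z ∈ chartSource y) (i : Fin (p + 1)) :
    coord y i (chartFun y z) = π.φ (y.1 i) (z.1 i) := by
  have h0 : base z ∈ (π.ψ (y.1 0)).source := π.maps_φ _ (hz 0)
  simp only [coord, chartFun]
  rw [(π.ψ (y.1 0)).left_inv h0, ContinuousLinearEquiv.symm_apply_eq]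
  ext1
  · simp only
    rw [← π.ψ_π _ (hz i), z.2 i]; rfl
  · rfl

open Classical in
/-- The inverse chart as a map to `Y^{[p+1]}` (arbitrary outside of the target). -/
def chartInv' (u : Model π p) : FibrePow π p :=
  if h : u ∈ chartTarget y then
    ⟨chartInv y u, fun i => by rw [π_chartInv y h i, π_chartInv y h 0]⟩ else y

lemma chartInv'_val {u : Model π p} (h : u ∈ chartTarget y) : (chartInv' y u).1 = chartInv y u := by
  simp [chartInv', h]

lemma isOpen_chartSource : IsOpen (chartSource y) := by
  have : chartSource y = ⋂ i, (fun z : FibrePow π p => z.1 i) ⁻¹' (π.φ (y.1 i)).source := by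
    ext z; simp [chartSource]
  rw [this]
  exact isOpen_iInter_of_finite fun i => (π.φ (y.1 i)).open_source.preimage (continuous_entry i)

lemma contMDiffOn_coord (i : Fin (p + 1)) {s : Set (Model π p)}
    (hs : ∀ u ∈ s, u.1 ∈ (π.ψ (y.1 0)).target ∧ (π.ψ (y.1 0)).symm u.1 ∈ (π.ψ (y.1 i)).source) :
    ContMDiffOn 𝓘(ℝ, Model π p) 𝓘(ℝ, EY) ∞ (coord y i) s := by
  have h1 : ContMDiffOn 𝓘(ℝ, Model π p) 𝓘(ℝ, EM) ∞ (fun u : Model π p => u.1) s :=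
    contDiff_fst.contMDiff.contMDiffOn
  have h2 := (π.ψ_symm_smooth (y.1 0)).comp h1 (fun u hu => (hs u hu).1)
  have h3 := (π.ψ_smooth (y.1 i)).comp h2 (fun u hu => (hs u hu).2)
  have h4 : ContMDiffOn 𝓘(ℝ, Model π p) 𝓘(ℝ, π.Compl) ∞ (fun u : Model π p => u.2 i) s := by
    apply ContMDiff.contMDiffOn
    apply ContDiff.contMDiff
    fun_prop
  have h5 : ContMDiffOn 𝓘(ℝ, Model π p) 𝓘(ℝ, EM × π.Compl) ∞
      (fun u : Model π p => (π.ψ (y.1 i) ((π.ψ (y.1 0)).symm u.1), u.2 i)) s :=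
    h3.prodMk_space h4
  exact (π.split (y.1 i)).symm.contDiff.contMDiff.comp_contMDiffOn h5

lemma isOpen_chartTarget : IsOpen (chartTarget y) := by
  have hA : IsOpen {u : Model π p | u.1 ∈ (π.ψ (y.1 0)).target} :=
    (π.ψ (y.1 0)).open_target.preimage continuous_fst
  have hB : ∀ i, IsOpen {u : Model π p | u.1 ∈ (π.ψ (y.1 0)).target ∧
      (π.ψ (y.1 0)).symm u.1 ∈ (π.ψ (y.1 i)).source} := fun i =>
    (((π.ψ (y.1 0)).continuousOn_symm.comp continuous_fst.continuousOn
      (fun _ hu => hu)).isOpen_inter_preimage hA (π.ψ (y.1 i)).open_source)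
  have hC : ∀ i, IsOpen ({u : Model π p | u.1 ∈ (π.ψ (y.1 0)).target ∧
      (π.ψ (y.1 0)).symm u.1 ∈ (π.ψ (y.1 i)).source} ∩ coord y i ⁻¹' (π.φ (y.1 i)).target) :=
    fun i => (contMDiffOn_coord y i (fun _ hu => hu)).continuousOn.isOpen_inter_preimage (hB i)
      (π.φ (y.1 i)).open_target
  have : chartTarget y = ⋂ i, ({u : Model π p | u.1 ∈ (π.ψ (y.1 0)).target ∧
      (π.ψ (y.1 0)).symm u.1 ∈ (π.ψ (y.1 i)).source} ∩ coord y i ⁻¹' (π.φ (y.1 i)).target) := by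
    ext u
    simp only [chartTarget, mem_ofPred_eq, mem_iInter, mem_inter_iff, mem_preimage]
    exact ⟨fun h i => ⟨⟨h.1, (h.2 i).1⟩, (h.2 i).2⟩,
      fun h => ⟨(h 0).1.1, fun i => ⟨(h i).1.2, (h i).2⟩⟩⟩
  rw [this]
  exact isOpen_iInter_of_finite hC

lemma contMDiffOn_chartInv (i : Fin (p + 1)) :
    ContMDiffOn 𝓘(ℝ, Model π p) 𝓘(ℝ, EY) ∞ (fun u => chartInv y u i) (chartTarget y) :=
  (π.φ_symm_smooth (y.1 i)).comp
    (contMDiffOn_coord y i (fun _ hu => ⟨hu.1, (hu.2 i).1⟩)) (fun _ hu => (hu.2 i).2)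

/-- The chart of `Y^{[p+1]}` around `y`. -/
def chart : OpenPartialHomeomorph (FibrePow π p) (Model π p) where
  toFun := chartFun y
  invFun := chartInv' y
  source := chartSource y
  target := chartTarget y
  map_source' z hz := by
    have h0 : base z ∈ (π.ψ (y.1 0)).source := π.maps_φ _ (hz 0)
    refine ⟨(π.ψ (y.1 0)).map_source h0, fun i => ⟨?_, ?_⟩⟩
    · simp only [chartFun]
      rw [(π.ψ (y.1 0)).left_inv h0, ← π_entry i z]
      exact π.maps_φ _ (hz i)
    · rw [coord_chartFun y hz i]
      exact (π.φ (y.1 i)).map_source (hz i)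
  map_target' u hu i := by
    rw [chartInv'_val y hu]
    exact (π.φ (y.1 i)).map_target (hu.2 i).2
  left_inv' z hz := by
    have hu : chartFun y z ∈ chartTarget y := by
      have h0 : base z ∈ (π.ψ (y.1 0)).source := π.maps_φ _ (hz 0)
      refine ⟨(π.ψ (y.1 0)).map_source h0, fun i => ⟨?_, ?_⟩⟩
      · simp only [chartFun]
        rw [(π.ψ (y.1 0)).left_inv h0, ← π_entry i z]
        exact π.maps_φ _ (hz i)
      · rw [coord_chartFun y hz i]
        exact (π.φ (y.1 i)).map_source (hz i)
    apply Subtype.ext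
    rw [chartInv'_val y hu]
    funext i
    rw [chartInv, coord_chartFun y hz i, (π.φ (y.1 i)).left_inv (hz i)]
  right_inv' u hu := by
    have hv := chartInv'_val y hu
    ext1
    · simp only [chartFun, base]
      rw [hv, π_chartInv y hu 0, (π.ψ (y.1 0)).right_inv hu.1]
    · funext i
      simp only [chartFun]
      rw [hv, chartInv, (π.φ (y.1 i)).right_inv (hu.2 i).2, coord]
      simp
  open_source := isOpen_chartSource y
  open_target := isOpen_chartTarget y
  continuousOn_toFun := by
    apply ContinuousOn.prodMk
    · exact (π.ψ (y.1 0)).continuousOn.comp continuous_base.continuousOn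
        (fun z hz => π.maps_φ _ (hz 0))
    · refine continuousOn_pi.2 fun i => ?_
      have h1 : ContinuousOn (fun z : FibrePow π p => π.φ (y.1 i) (z.1 i)) (chartSource y) :=
        (π.φ (y.1 i)).continuousOn.comp (continuous_entry i).continuousOn (fun z hz => hz i)
      exact continuous_snd.comp_continuousOn
        ((π.split (y.1 i)).continuous.comp_continuousOn h1)
  continuousOn_invFun := by
    rw [continuousOn_iff_continuous_domRestrict]
    refine Continuous.subtype_mk (f := fun u : chartTarget y => (chartInv' y u.1).1) ?_ _
    refine continuous_pi fun i => ?_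
    have h := (contMDiffOn_chartInv y i).continuousOn
    rw [continuousOn_iff_continuous_domRestrict] at h
    convert h using 1
    funext u
    simp [chartInv'_val y u.2]

end chart

instance : ChartedSpace (Model π p) (FibrePow π p) where
  atlas := range chart
  chartAt := chart
  mem_chart_source y i := π.mem_φ (y.1 i)
  chart_mem_atlas y := mem_range_self y

/-- The smooth structure on `Y^{[p+1]}`. -/
instance : IsManifold 𝓘(ℝ, Model π p) ∞ (FibrePow π p) := by
  apply isManifold_of_contDiffOn
  rintro _ _ ⟨y, rfl⟩ ⟨y', rfl⟩
  simp only [modelWithCornersSelf_coe, modelWithCornersSelf_coe_symm, Function.comp_id,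
    Function.id_comp, preimage_id, range_id, inter_univ]
  rw [← contMDiffOn_iff_contDiffOn]
  have hval : ∀ u ∈ ((chart y).symm.trans (chart y')).source, ∀ i,
      u ∈ chartTarget y ∧ chartInv y u i ∈ (π.φ (y'.1 i)).source := by
    intro u hu i
    rw [OpenPartialHomeomorph.trans_source] at hu
    have h1 : u ∈ chartTarget y := hu.1
    have h2 : chartInv' y u ∈ chartSource y' := hu.2
    refine ⟨h1, ?_⟩
    have := h2 i
    rwa [chartInv'_val y h1] at this
  have hinv : ∀ i, ContMDiffOn 𝓘(ℝ, Model π p) 𝓘(ℝ, EY) ∞ (fun u => chartInv y u i)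
      ((chart y).symm.trans (chart y')).source := fun i =>
    (contMDiffOn_chartInv y i).mono (fun u hu => (hval u hu 0).1)
  have hG : ContMDiffOn 𝓘(ℝ, Model π p) 𝓘(ℝ, Model π p) ∞ (fun u =>
      ((π.ψ (y'.1 0) (π (chartInv y u 0)),
        fun i => (π.split (y'.1 i) (π.φ (y'.1 i) (chartInv y u i))).2) : Model π p))
      ((chart y).symm.trans (chart y')).source := by
    apply ContMDiffOn.prodMk_space
    · exact (π.ψ_smooth _).comp (π.contMDiff.comp_contMDiffOn (hinv 0))
        (fun u hu => π.maps_φ _ (hval u hu 0).2)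
    · rw [contMDiffOn_pi_space]
      intro i
      have := (π.φ_smooth _).comp (hinv i) (fun u hu => (hval u hu i).2)
      exact (contDiff_snd.comp (π.split (y'.1 i)).contDiff).contMDiff.comp_contMDiffOn this
  refine hG.congr fun u hu => ?_
  have hv := chartInv'_val y (hval u hu 0).1
  change chartFun y' (chartInv' y u) = _
  simp only [chartFun, base, hv]

lemma contMDiff_entry (i : Fin (p + 1)) :
    ContMDiff 𝓘(ℝ, Model π p) 𝓘(ℝ, EY) ∞ (entry i : FibrePow π p → Y) := by
  intro y
  have h1 : ContMDiffOn 𝓘(ℝ, Model π p) 𝓘(ℝ, EY) ∞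
      ((fun u => chartInv y u i) ∘ chart y) (chart y).source :=
    (contMDiffOn_chartInv y i).comp
      (contMDiffOn_of_mem_maximalAtlas (IsManifold.chart_mem_maximalAtlas (x := y)))
      (fun z hz => (chart y).map_source hz)
  have h2 : ContMDiffOn 𝓘(ℝ, Model π p) 𝓘(ℝ, EY) ∞
      (entry i : FibrePow π p → Y) (chart y).source := by
    refine h1.congr fun z hz => ?_
    have hu := (chart y).map_source hz
    have := congrArg (entry i) ((chart y).left_inv hz)
    rw [← this]
    exact congrFun (chartInv'_val y hu) i
  exact h2.contMDiffAt ((chart y).open_source.mem_nhds (mem_chart_source _ y))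

lemma contMDiff_base : ContMDiff 𝓘(ℝ, Model π p) 𝓘(ℝ, EM) ∞ (base : FibrePow π p → M) :=
  π.contMDiff.comp (contMDiff_entry 0)

/-- A map into `Y^{[p+1]}` is smooth as soon as all its entries are. -/
lemma contMDiff_of_entry {E : Type*} [NormedAddCommGroup E] [NormedSpace ℝ E]
    {X : Type*} [TopologicalSpace X] [ChartedSpace E X] {f : X → FibrePow π p}
    (hf : ∀ i, ContMDiff 𝓘(ℝ, E) 𝓘(ℝ, EY) ∞ (fun x => entry i (f x))) :
    ContMDiff 𝓘(ℝ, E) 𝓘(ℝ, Model π p) ∞ f := by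
  have hc : Continuous f := by
    refine Continuous.subtype_mk (f := fun x => (f x).1) ?_ _
    exact continuous_pi fun i => (hf i).continuous
  intro x
  set y := f x with hy
  have hopen : IsOpen (f ⁻¹' (chart y).source) := (chart y).open_source.preimage hc
  have hx : x ∈ f ⁻¹' (chart y).source := mem_chart_source (Model π p) (f x)
  have hG : ContMDiffOn 𝓘(ℝ, E) 𝓘(ℝ, Model π p) ∞ (fun x => chart y (f x))
      (f ⁻¹' (chart y).source) := by
    apply ContMDiffOn.prodMk_space
    · exact (π.ψ_smooth _).comp ((π.contMDiff.comp (hf 0)).contMDiffOn)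
        (fun u hu => π.maps_φ _ (hu 0))
    · rw [contMDiffOn_pi_space]
      intro i
      have := (π.φ_smooth _).comp (hf i).contMDiffOn
        (fun u (hu : u ∈ f ⁻¹' (chart y).source) => hu i)
      exact (contDiff_snd.comp (π.split (y.1 i)).contDiff).contMDiff.comp_contMDiffOn this
  have h2 : ContMDiffOn 𝓘(ℝ, E) 𝓘(ℝ, Model π p) ∞ f (f ⁻¹' (chart y).source) := by
    refine ((contMDiffOn_symm_of_mem_maximalAtlas
      (IsManifold.chart_mem_maximalAtlas (x := y))).comp hG
      (fun z hz => (chart y).map_source hz)).congr fun z hz => ?_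
    exact ((chart y).left_inv hz).symm
  exact h2.contMDiffAt (hopen.mem_nhds hx)

/-- The face map `Y^{[p+2]} → Y^{[p+1]}` which omits the `i`-th entry (counted from `0`). -/
def face (i : Fin (p + 2)) (z : FibrePow π (p + 1)) : FibrePow π p :=
  ⟨fun j => z.1 (i.succAbove j), fun j => by rw [z.2, z.2 (i.succAbove 0)]⟩

lemma contMDiff_face (i : Fin (p + 2)) :
    ContMDiff 𝓘(ℝ, Model π (p + 1)) 𝓘(ℝ, Model π p) ∞ (face i : FibrePow π (p + 1) → _) :=
  contMDiff_of_entry fun j => contMDiff_entry (i.succAbove j)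

lemma base_face (i : Fin (p + 2)) (z : FibrePow π (p + 1)) : base (face i z) = base z :=
  z.2 _

end FibrePow

end FibrePowers

section Forms

/-- Differential `k`-forms with values in `V` on the manifold `X` modelled on `E`, as families of
alternating maps on the tangent spaces; smoothness is the separate predicate `SmoothForm`. -/
abbrev Form (E : Type*) [NormedAddCommGroup E] [NormedSpace ℝ E]
    (X : Type*) [TopologicalSpace X] [ChartedSpace E X]
    (k : ℕ) (V : Type*) [NormedAddCommGroup V] [NormedSpace ℝ V] : Type _ :=
  ∀ x : X, TangentSpace 𝓘(ℝ, E) x [⋀^Fin k]→L[ℝ] V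

variable {E : Type*} [NormedAddCommGroup E] [NormedSpace ℝ E]
  {X : Type*} [TopologicalSpace X] [ChartedSpace E X]
  {E' : Type*} [NormedAddCommGroup E'] [NormedSpace ℝ E']
  {X' : Type*} [TopologicalSpace X'] [ChartedSpace E' X']
  {V : Type*} [NormedAddCommGroup V] [NormedSpace ℝ V] {k : ℕ}

namespace Form

/-- The pullback `f^* α`. -/
def pullback (f : X → X') (α : Form E' X' k V) : Form E X k V := fun x =>
  (α (f x)).compContinuousLinearMap (mfderiv 𝓘(ℝ, E) 𝓘(ℝ, E') f x)

/-- The form `α` in the preferred chart around `x₀`. -/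
def inChart (α : Form E X k V) (x₀ : X) : E → E [⋀^Fin k]→L[ℝ] V := fun u =>
  (α ((extChartAt 𝓘(ℝ, E) x₀).symm u)).compContinuousLinearMap
    (mfderiv 𝓘(ℝ, E) 𝓘(ℝ, E) (extChartAt 𝓘(ℝ, E) x₀).symm u)

/-- Smoothness of `α` at every point of the (open) set `U`. -/
def SmoothOn (α : Form E X k V) (U : Set X) : Prop :=
  ∀ x ∈ U, ContDiffAt ℝ ∞ (α.inChart x) (extChartAt 𝓘(ℝ, E) x x)

/-- Smoothness of a form. -/
def Smooth (α : Form E X k V) : Prop := α.SmoothOn univ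

/-- The exterior derivative, computed in the preferred chart around each point. -/
def d (α : Form E X k V) : Form E X (k + 1) V := fun x =>
  (extDeriv (α.inChart x) (extChartAt 𝓘(ℝ, E) x x)).compContinuousLinearMap
    (mfderiv 𝓘(ℝ, E) 𝓘(ℝ, E) (extChartAt 𝓘(ℝ, E) x) x)

/-- The differential of a function, as a one-form. -/
def dFun (f : X → V) : Form E X 1 V := fun x =>
  ContinuousAlternatingMap.ofSubsingleton ℝ E V 0 (mfderiv 𝓘(ℝ, E) 𝓘(ℝ, V) f x)

/-- The logarithmic derivative `t⁻¹ dt` of a complex valued function. -/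
def dLog (t : X → ℂ) : Form E X 1 ℂ := fun x => (t x)⁻¹ • dFun (E := E) t x

/-- The wedge product of a one-form and a `k`-form on a vector space:
`(a ∧ b)(v₀, …, vₖ) = ∑ i, (-1)^i a(vᵢ) b(v₀, …, vᵢ₋₁, vᵢ₊₁, …, vₖ)`. -/
def wedgeAlt (a : E [⋀^Fin 1]→L[ℝ] ℂ) (b : E [⋀^Fin k]→L[ℝ] ℂ) : E [⋀^Fin (k + 1)]→L[ℝ] ℂ :=
  ContinuousAlternatingMap.alternatizeUncurryFin
    (((ContinuousLinearMap.lsmul ℝ ℂ).flip b).comp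
      ((ContinuousAlternatingMap.ofSubsingleton ℝ E ℂ (0 : Fin 1)).symm a))

/-- The wedge product of a one-form and a `k`-form. -/
def wedge (a : Form E X 1 ℂ) (b : Form E X k ℂ) : Form E X (k + 1) ℂ := fun x =>
  wedgeAlt (E := E) (a x) (b x)

/-- The form takes purely imaginary values on `U`. -/
def ImaginaryOn (α : Form E X k ℂ) (U : Set X) : Prop := ∀ x ∈ U, ∀ v, (α x v).re = 0

/-- A real form regarded as a complex valued form. -/
def toComplex (α : Form E X k ℝ) : Form E X k ℂ := fun x =>
  Complex.ofRealCLM.compContinuousAlternatingMap (α x)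

lemma eventually_symm (x : X) {s : Set X} (hs : s ∈ 𝓝 x) :
    ∀ᶠ u in 𝓝 (extChartAt 𝓘(ℝ, E) x x), (extChartAt 𝓘(ℝ, E) x).symm u ∈ s := by
  have h := continuousAt_extChartAt_symm (I := 𝓘(ℝ, E)) x
  have h' : s ∈ 𝓝 ((extChartAt 𝓘(ℝ, E) x).symm (extChartAt 𝓘(ℝ, E) x x)) := by
    rwa [extChartAt_to_inv]
  exact h h'

lemma eventually_target (x : X) :
    ∀ᶠ u in 𝓝 (extChartAt 𝓘(ℝ, E) x x), u ∈ (extChartAt 𝓘(ℝ, E) x).target :=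
  extChartAt_target_mem_nhds x

lemma inChart_congr {α η : Form E X k V} {x : X} {s : Set X} (hs : s ∈ 𝓝 x)
    (h : ∀ z ∈ s, α z = η z) :
    α.inChart x =ᶠ[𝓝 (extChartAt 𝓘(ℝ, E) x x)] η.inChart x := by
  filter_upwards [eventually_symm (E := E) x hs] with u hu
  simp only [inChart, h _ hu]

lemma SmoothOn.zero {U : Set X} : SmoothOn (0 : Form E X k V) U := by
  intro x _
  have : inChart (0 : Form E X k V) x = fun _ => 0 := by
    funext u; ext v; rfl
  rw [this]; exact contDiffAt_const

lemma SmoothOn.add {α η : Form E X k V} {U : Set X} (hα : α.SmoothOn U) (hη : η.SmoothOn U) :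
    SmoothOn (α + η) U := fun x hx => (hα x hx).add (hη x hx)

lemma SmoothOn.sum {ι : Type*} {s : Finset ι} {α : ι → Form E X k V} {U : Set X}
    (hα : ∀ i ∈ s, (α i).SmoothOn U) : SmoothOn (∑ i ∈ s, α i) U := by
  classical
  induction s using Finset.induction_on with
  | empty => exact SmoothOn.zero
  | insert a s ha ih =>
    rw [Finset.sum_insert ha]
    exact (hα a (by simp)).add (ih fun i hi => hα i (by simp [hi]))

lemma SmoothOn.mono {α : Form E X k V} {U W : Set X} (hα : α.SmoothOn U) (h : W ⊆ U) :
    α.SmoothOn W := fun x hx => hα x (h hx)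

lemma SmoothOn.zsmul {α : Form E X k V} {U : Set X} (hα : α.SmoothOn U) {h : X → ℤ}
    (hh : IsLocallyConstant h) : SmoothOn (fun x => (h x : ℝ) • α x) U := by
  intro x hx
  have hs : h ⁻¹' {h x} ∈ 𝓝 x := (hh.isOpen_fiber (h x)).mem_nhds rfl
  have h1 := inChart_congr (E := E) (α := fun x => (h x : ℝ) • α x) (η := fun z => (h x : ℝ) • α z)
    hs (fun z hz => by
      have hz' : h z = h x := hz
      simp only [hz'])
  refine ContDiffAt.congr_of_eventuallyEq ?_ h1
  exact (hα x hx).const_smul (h x : ℝ)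

lemma comp_ofSubsingleton (A : E →L[ℝ] V) (B : E' →L[ℝ] E) :
    (ContinuousAlternatingMap.ofSubsingleton ℝ E V (0 : Fin 1) A).compContinuousLinearMap B =
      ContinuousAlternatingMap.ofSubsingleton ℝ E' V (0 : Fin 1) (A.comp B) := by
  ext v; rfl

/-- Smoothness of one-forms is preserved by pullback along smooth maps. -/
lemma SmoothOn.pullback [IsManifold 𝓘(ℝ, E) ∞ X] [IsManifold 𝓘(ℝ, E') ∞ X']
    {α : Form E' X' 1 V} {U : Set X'} (hα : α.SmoothOn U) {f : X → X'}
    (hf : ContMDiff 𝓘(ℝ, E) 𝓘(ℝ, E') ∞ f) : SmoothOn (α.pullback (E := E) f) (f ⁻¹' U) := by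
  intro x hx
  set u₀ := extChartAt 𝓘(ℝ, E) x x with hu₀
  set F : E → E' := extChartAt 𝓘(ℝ, E') (f x) ∘ f ∘ (extChartAt 𝓘(ℝ, E) x).symm with hF
  have hFu₀ : F u₀ = extChartAt 𝓘(ℝ, E') (f x) (f x) := by simp [hF, hu₀]
  have hFs : ContDiffAt ℝ ∞ F u₀ := by
    have := (contMDiffAt_iff.1 (hf x)).2
    rwa [modelWithCornersSelf_coe, range_id, contDiffWithinAt_univ] at this
  have hcont := (hf.continuous.continuousAt (x := x)).preimage_mem_nhds
    (extChartAt_source_mem_nhds (I := 𝓘(ℝ, E')) (f x))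
  have key : (α.pullback (E := E) f).inChart x =ᶠ[𝓝 u₀]
      fun u => (α.inChart (f x) (F u)).compContinuousLinearMap (fderiv ℝ F u) := by
    have hev1 := eventually_symm (E := E) x hcont
    have hev2 := eventually_target (E := E) x
    have hFev : ∀ᶠ u in 𝓝 u₀, ContDiffAt ℝ 1 F u :=
      (hFs.of_le (by exact_mod_cast le_top)).eventually (by simp)
    filter_upwards [hev1, hev1.eventually_nhds, hev2, hFev] with u h1 h1' h2 h3
    have hsymm : MDifferentiableAt 𝓘(ℝ, E) 𝓘(ℝ, E) (extChartAt 𝓘(ℝ, E) x).symm u :=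
      ((contMDiffOn_extChartAt_symm (n := ∞) x).contMDiffAt
        ((isOpen_extChartAt_target x).mem_nhds h2)).mdifferentiableAt (by simp)
    have hfu : MDifferentiableAt 𝓘(ℝ, E) 𝓘(ℝ, E') f ((extChartAt 𝓘(ℝ, E) x).symm u) :=
      (hf _).mdifferentiableAt (by simp)
    have hFt : F u ∈ (extChartAt 𝓘(ℝ, E') (f x)).target := PartialEquiv.map_source _ h1
    have hsymm' : MDifferentiableAt 𝓘(ℝ, E') 𝓘(ℝ, E') (extChartAt 𝓘(ℝ, E') (f x)).symm (F u) :=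
      ((contMDiffOn_extChartAt_symm (n := ∞) (f x)).contMDiffAt
        ((isOpen_extChartAt_target (f x)).mem_nhds hFt)).mdifferentiableAt (by simp)
    have hFd : MDifferentiableAt 𝓘(ℝ, E) 𝓘(ℝ, E') F u :=
      (h3.differentiableAt (by simp)).mdifferentiableAt
    have hval : (extChartAt 𝓘(ℝ, E') (f x)).symm (F u) = f ((extChartAt 𝓘(ℝ, E) x).symm u) :=
      PartialEquiv.left_inv _ h1
    have hcomp : (extChartAt 𝓘(ℝ, E') (f x)).symm ∘ F =ᶠ[𝓝 u]
        f ∘ (extChartAt 𝓘(ℝ, E) x).symm := by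
      filter_upwards [h1'] with w hw
      exact PartialEquiv.left_inv _ hw
    have hd := hcomp.mfderiv_eq (I := 𝓘(ℝ, E)) (I' := 𝓘(ℝ, E'))
    rw [mfderiv_comp u hsymm' hFd, mfderiv_comp u hfu hsymm, mfderiv_eq_fderiv] at hd
    ext v
    simp only [Form.pullback, inChart, ContinuousAlternatingMap.compContinuousLinearMap_apply]
    rw [hval]
    refine congrArg (α (f ((extChartAt 𝓘(ℝ, E) x).symm u))) (funext fun i => ?_)
    exact (DFunLike.congr_fun hd (v i)).symm
  refine ContDiffAt.congr_of_eventuallyEq ?_ key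
  have hA : ContDiffAt ℝ ∞ (fun u => (ContinuousAlternatingMap.ofSubsingletonLIE
      (𝕜 := ℝ) (E := E') (F := V) (0 : Fin 1)).symm (α.inChart (f x) (F u))) u₀ := by
    refine (LinearIsometryEquiv.contDiff _).contDiffAt.comp u₀ ?_
    have h0 : ContDiffAt ℝ ∞ (α.inChart (f x)) (F u₀) := by
      rw [hFu₀]
      exact hα (f x) hx
    exact h0.comp u₀ hFs
  have hB : ContDiffAt ℝ ∞ (fderiv ℝ F) u₀ := hFs.fderiv_right (by simp)
  have hC := (LinearIsometryEquiv.contDiff (n := ∞) (ContinuousAlternatingMap.ofSubsingletonLIE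
      (𝕜 := ℝ) (E := E) (F := V) (0 : Fin 1))).contDiffAt.comp u₀ (hA.clm_comp hB)
  refine hC.congr_of_eventuallyEq (Filter.Eventually.of_forall fun u => ?_)
  ext v
  refine congrArg (α.inChart (f x) (F u)) (funext fun i => ?_)
  rw [Subsingleton.elim i 0]

lemma pullback_add (f : X → X') (α η : Form E' X' k V) :
    pullback (E := E) f (α + η) = pullback f α + pullback f η := rfl

/-- Pullback is functorial. -/
lemma pullback_comp {E'' : Type*} [NormedAddCommGroup E''] [NormedSpace ℝ E'']
    {X'' : Type*} [TopologicalSpace X''] [ChartedSpace E'' X'']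
    {f : X → X'} {g : X' → X''} (α : Form E'' X'' k V) {x : X}
    (hg : MDifferentiableAt 𝓘(ℝ, E') 𝓘(ℝ, E'') g (f x))
    (hf : MDifferentiableAt 𝓘(ℝ, E) 𝓘(ℝ, E') f x) :
    pullback (E := E) f (pullback (E := E') g α) x = pullback (g ∘ f) α x := by
  simp only [pullback]
  rw [mfderiv_comp x hg hf]
  rfl

lemma dLog_comp {f : X → X'} {t : X' → ℂ} {x : X}
    (ht : MDifferentiableAt 𝓘(ℝ, E') 𝓘(ℝ, ℂ) t (f x))
    (hf : MDifferentiableAt 𝓘(ℝ, E) 𝓘(ℝ, E') f x) :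
    dLog (E := E) (fun z => t (f z)) x = pullback f (dLog (E := E') t) x := by
  have := mfderiv_comp x ht hf
  change mfderiv _ _ (fun z => t (f z)) x = _ at this
  simp only [dLog, dFun, pullback]
  rw [this]
  rfl

lemma dLog_congr {s t : X → ℂ} {x : X} (h : s =ᶠ[𝓝 x] t) :
    dLog (E := E) s x = dLog t x := by
  simp only [dLog, dFun]
  rw [h.mfderiv_eq, h.eq_of_nhds]

lemma dLog_const (c : ℂ) (x : X) : dLog (E := E) (fun _ : X => c) x = 0 := by
  simp only [dLog, dFun, mfderiv_const]
  ext v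
  exact mul_zero c⁻¹

lemma dLog_mul {s t : X → ℂ} {x : X} (hs : MDifferentiableAt 𝓘(ℝ, E) 𝓘(ℝ, ℂ) s x)
    (ht : MDifferentiableAt 𝓘(ℝ, E) 𝓘(ℝ, ℂ) t x) (hs0 : s x ≠ 0) (ht0 : t x ≠ 0) :
    dLog (E := E) (fun z => s z * t z) x = dLog s x + dLog t x := by
  have h := (hs.hasMFDerivAt.mul ht.hasMFDerivAt).mfderiv
  have h' : mfderiv 𝓘(ℝ, E) 𝓘(ℝ, ℂ) (fun z => s z * t z) x = _ := h
  ext v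
  have e : mfderiv 𝓘(ℝ, E) 𝓘(ℝ, ℂ) (fun z => s z * t z) x (v 0) =
      (s x * (show ℂ from mfderiv 𝓘(ℝ, E) 𝓘(ℝ, ℂ) t x (v 0)) +
      t x * (show ℂ from mfderiv 𝓘(ℝ, E) 𝓘(ℝ, ℂ) s x (v 0)) : ℂ) := by rw [h']; rfl
  change (s x * t x)⁻¹ * (show ℂ from mfderiv 𝓘(ℝ, E) 𝓘(ℝ, ℂ) (fun z => s z * t z) x (v 0)) =
    (s x)⁻¹ * (show ℂ from mfderiv 𝓘(ℝ, E) 𝓘(ℝ, ℂ) s x (v 0)) +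
    (t x)⁻¹ * (show ℂ from mfderiv 𝓘(ℝ, E) 𝓘(ℝ, ℂ) t x (v 0))
  rw [e]
  field_simp
  ring

lemma mdiff_zpow {t : X → ℂ} {x : X} (ht : MDifferentiableAt 𝓘(ℝ, E) 𝓘(ℝ, ℂ) t x)
    (h0 : t x ≠ 0) (n : ℤ) : MDifferentiableAt 𝓘(ℝ, E) 𝓘(ℝ, ℂ) (fun z => t z ^ n) x := by
  have hp : DifferentiableAt ℝ (fun z : ℂ => z ^ n) (t x) :=
    (differentiableAt_zpow.2 (Or.inl h0)).restrictScalars ℝ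
  exact hp.mdifferentiableAt.comp x ht

lemma dLog_zpow_const {t : X → ℂ} {x : X} (ht : MDifferentiableAt 𝓘(ℝ, E) 𝓘(ℝ, ℂ) t x)
    (h0 : t x ≠ 0) (n : ℤ) :
    dLog (E := E) (fun z => t z ^ n) x = (n : ℝ) • dLog t x := by
  have hne : ∀ᶠ z in 𝓝 x, t z ≠ 0 := ht.continuousAt.eventually_ne h0
  have step : ∀ m : ℤ, dLog (E := E) (fun z => t z ^ (m + 1)) x =
      dLog (fun z => t z ^ m) x + dLog t x := by
    intro m
    rw [← dLog_mul (mdiff_zpow ht h0 m) ht (zpow_ne_zero m h0) h0]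
    refine dLog_congr ?_
    filter_upwards [hne] with z hz
    rw [zpow_add_one₀ hz]
  induction n using Int.induction_on with
  | zero =>
    simp only [zpow_zero, Int.cast_zero, zero_smul]
    exact dLog_const 1 x
  | succ m ih => rw [step, ih]; push_cast; rw [add_smul, one_smul]
  | pred m ih =>
    have := step (-(m : ℤ) - 1)
    rw [sub_add_cancel, ih] at this
    rw [eq_sub_of_add_eq this.symm]
    push_cast
    rw [sub_smul, one_smul]

lemma dLog_zpow {t : X → ℂ} {h : X → ℤ} (hh : IsLocallyConstant h) {x : X}
    (ht : MDifferentiableAt 𝓘(ℝ, E) 𝓘(ℝ, ℂ) t x) (h0 : t x ≠ 0) :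
    dLog (E := E) (fun z => t z ^ h z) x = (h x : ℝ) • dLog t x := by
  rw [← dLog_zpow_const ht h0]
  refine dLog_congr ?_
  filter_upwards [(hh.isOpen_fiber (h x)).mem_nhds rfl] with z hz
  have hz' : h z = h x := hz
  rw [hz']

lemma mdiff_prod {n : ℕ} {t : Fin n → X → ℂ} {x : X}
    (ht : ∀ i, MDifferentiableAt 𝓘(ℝ, E) 𝓘(ℝ, ℂ) (t i) x) :
    MDifferentiableAt 𝓘(ℝ, E) 𝓘(ℝ, ℂ) (fun z => ∏ i, t i z) x := by
  induction n with
  | zero => simpa using mdifferentiableAt_const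
  | succ m ih =>
    simp only [Fin.prod_univ_succ]
    exact (ht 0).mul (ih fun i => ht i.succ)

lemma dLog_prod {n : ℕ} {t : Fin n → X → ℂ} {x : X}
    (ht : ∀ i, MDifferentiableAt 𝓘(ℝ, E) 𝓘(ℝ, ℂ) (t i) x) (h0 : ∀ i, t i x ≠ 0) :
    dLog (E := E) (fun z => ∏ i, t i z) x = ∑ i, dLog (t i) x := by
  induction n with
  | zero =>
    simp only [Finset.univ_eq_empty, Finset.prod_empty, Finset.sum_empty]
    exact dLog_const 1 x
  | succ m ih =>
    simp only [Fin.prod_univ_succ, Fin.sum_univ_succ]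
    rw [dLog_mul (ht 0) (mdiff_prod fun i => ht i.succ) (h0 0)
      (Finset.prod_ne_zero_iff.2 fun i _ => h0 i.succ), ih (fun i => ht i.succ) fun i => h0 i.succ]

end Form

end Forms

section Lines

open scoped TensorProduct

universe v

variable (V : Type v) [AddCommGroup V] [Module ℂ V]

/-- The tensor power `V^n` of a complex line for `n : ℤ`: the `n`-fold tensor product of `V` for
`n ≥ 0` and the `(-n)`-fold tensor product of the dual of `V` for `n < 0`. -/
def LinePow : ℤ → Type v
  | .ofNat k => ⨂[ℂ] (_ : Fin k), V
  | .negSucc k => ⨂[ℂ] (_ : Fin (k + 1)), Module.Dual ℂ V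

instance : ∀ n, AddCommGroup (LinePow V n)
  | .ofNat k => inferInstanceAs (AddCommGroup (⨂[ℂ] (_ : Fin k), V))
  | .negSucc k => inferInstanceAs (AddCommGroup (⨂[ℂ] (_ : Fin (k + 1)), Module.Dual ℂ V))

instance : ∀ n, Module ℂ (LinePow V n)
  | .ofNat k => inferInstanceAs (Module ℂ (⨂[ℂ] (_ : Fin k), V))
  | .negSucc k => inferInstanceAs (Module ℂ (⨂[ℂ] (_ : Fin (k + 1)), Module.Dual ℂ V))

variable {V}

open Classical in
/-- For a nonzero vector `v` of a line, the dual vector `v*` with `v*(v) = 1`. -/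
def dualVec (v : V) : Module.Dual ℂ V :=
  if h : ∃ f : Module.Dual ℂ V, f v = 1 then h.choose else 0

/-- The power `vⁿ ∈ Vⁿ` of a nonzero vector `v`: it is `v ⊗ ⋯ ⊗ v` for `n ≥ 0` and
`v* ⊗ ⋯ ⊗ v*` for `n < 0`. -/
def vpow (v : V) : ∀ n : ℤ, LinePow V n
  | .ofNat k => PiTensorProduct.tprod ℂ (fun _ : Fin k => v)
  | .negSucc k => PiTensorProduct.tprod ℂ (fun _ : Fin (k + 1) => dualVec v)

lemma dualVec_self (hV : Module.finrank ℂ V = 1) {v : V} (hv : v ≠ 0) : dualVec v v = 1 := by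
  have h : ∃ f : Module.Dual ℂ V, f v = 1 := by
    refine ⟨(FiniteDimensional.basisSingleton Unit hV v hv).coord (), ?_⟩
    have := (FiniteDimensional.basisSingleton Unit hV v hv).repr_self ()
    rw [FiniteDimensional.basisSingleton_apply] at this
    simp [this]
  rw [dualVec, dif_pos h]
  exact h.choose_spec

lemma dualVec_ne_zero (hV : Module.finrank ℂ V = 1) {v : V} (hv : v ≠ 0) : dualVec v ≠ 0 := by
  intro h
  have := dualVec_self hV hv
  simp [h] at this

lemma dualVec_smul (hV : Module.finrank ℂ V = 1) {v : V} (hv : v ≠ 0) {c : ℂ} (hc : c ≠ 0) :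
    dualVec (c • v) = c⁻¹ • dualVec v := by
  have h1 := dualVec_self hV (smul_ne_zero hc hv)
  have h2 := dualVec_self hV hv
  rw [map_smul, smul_eq_mul] at h1
  ext w
  obtain ⟨k, rfl⟩ := exists_smul_eq_of_finrank_eq_one hV hv w
  rw [LinearMap.smul_apply, map_smul, map_smul, h2]
  simp only [smul_eq_mul, mul_one]
  field_simp
  linear_combination k * h1

lemma vpow_smul (hV : Module.finrank ℂ V = 1) {v : V} (hv : v ≠ 0) {c : ℂ} (hc : c ≠ 0) :
    ∀ n : ℤ, vpow (c • v) n = c ^ n • vpow v n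
  | .ofNat k => by
    have := (PiTensorProduct.tprod ℂ (s := fun _ : Fin k => V)).map_smul_univ
      (fun _ => c) (fun _ => v)
    simp only [Finset.prod_const, Finset.card_univ, Fintype.card_fin] at this
    exact this
  | .negSucc k => by
    have := (PiTensorProduct.tprod ℂ (s := fun _ : Fin (k + 1) => Module.Dual ℂ V)).map_smul_univ
      (fun _ => c⁻¹) (fun _ => dualVec v)
    simp only [Finset.prod_const, Finset.card_univ, Fintype.card_fin] at this
    rw [zpow_negSucc, ← inv_pow]
    simp only [vpow]
    rw [dualVec_smul hV hv hc]
    exact this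

section tensor

variable {ι : Type} [Fintype ι] {W : ι → Type v} [∀ i, AddCommGroup (W i)] [∀ i, Module ℂ (W i)]

lemma finrank_tensor (h : ∀ i, Module.finrank ℂ (W i) = 1) :
    Module.finrank ℂ (⨂[ℂ] i, W i) = 1 := by
  have hb : ∀ i, Nonempty (Module.Basis Unit ℂ (W i)) := fun i =>
    (_root_.finrank_eq_one_iff Unit).1 (h i)
  classical
  rw [Module.finrank_eq_card_basis (Basis.piTensorProduct fun i => (hb i).some)]
  simp

lemma tprod_ne_zero (h : ∀ i, Module.finrank ℂ (W i) = 1) {w : ∀ i, W i} (hw : ∀ i, w i ≠ 0) :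
    PiTensorProduct.tprod ℂ w ≠ 0 := by
  have := (Basis.piTensorProduct fun i => FiniteDimensional.basisSingleton Unit (h i) (w i) (hw i)).ne_zero
    (fun _ => ())
  rw [Basis.piTensorProduct_apply] at this
  simpa using this

lemma tprod_eq_smul {w w' : ∀ i, W i} {c : ι → ℂ} (h : ∀ i, w' i = c i • w i) :
    PiTensorProduct.tprod ℂ w' = (∏ i, c i) • PiTensorProduct.tprod ℂ w := by
  rw [← MultilinearMap.map_smul_univ]
  exact congrArg _ (funext h)

end tensor

lemma map₂_assoc {ι : Type} {A B C D AB BC : ι → Type v} [∀ i, AddCommGroup (A i)] [∀ i, Module ℂ (A i)]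
    [∀ i, AddCommGroup (B i)] [∀ i, Module ℂ (B i)] [∀ i, AddCommGroup (C i)]
    [∀ i, Module ℂ (C i)] [∀ i, AddCommGroup (D i)] [∀ i, Module ℂ (D i)]
    [∀ i, AddCommGroup (AB i)] [∀ i, Module ℂ (AB i)] [∀ i, AddCommGroup (BC i)]
    [∀ i, Module ℂ (BC i)] (m₁ : ∀ i, A i →ₗ[ℂ] B i →ₗ[ℂ] AB i)
    (m₂ : ∀ i, AB i →ₗ[ℂ] C i →ₗ[ℂ] D i) (m₃ : ∀ i, B i →ₗ[ℂ] C i →ₗ[ℂ] BC i)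
    (m₄ : ∀ i, A i →ₗ[ℂ] BC i →ₗ[ℂ] D i)
    (h : ∀ i p q r, m₂ i (m₁ i p q) r = m₄ i p (m₃ i q r))
    (p : ⨂[ℂ] i, A i) (q : ⨂[ℂ] i, B i) (r : ⨂[ℂ] i, C i) :
    PiTensorProduct.map₂ m₂ (PiTensorProduct.map₂ m₁ p q) r =
      PiTensorProduct.map₂ m₄ p (PiTensorProduct.map₂ m₃ q r) := by
  induction p using PiTensorProduct.induction_on with
  | add p p' ihp ihp' => simp only [map_add, LinearMap.add_apply, ihp, ihp']
  | smul_tprod k p =>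
    induction q using PiTensorProduct.induction_on with
    | add q q' ihq ihq' => simp only [map_add, LinearMap.add_apply, ihq, ihq']
    | smul_tprod l q =>
      induction r using PiTensorProduct.induction_on with
      | add r r' ihr ihr' => simp only [map_add, ihr, ihr']
      | smul_tprod t r =>
        simp only [map_smul, LinearMap.smul_apply, PiTensorProduct.map₂_tprod_tprod, h]

lemma finrank_linePow (hV : Module.finrank ℂ V = 1) : ∀ n, Module.finrank ℂ (LinePow V n) = 1
  | .ofNat k => finrank_tensor (ι := Fin k) (W := fun _ => V) fun _ => hV
  | .negSucc k => finrank_tensor (ι := Fin (k + 1)) (W := fun _ => Module.Dual ℂ V) fun _ => by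
      rw [Subspace.dual_finrank_eq, hV]

lemma vpow_ne_zero (hV : Module.finrank ℂ V = 1) {v : V} (hv : v ≠ 0) : ∀ n, vpow v n ≠ 0
  | .ofNat k => tprod_ne_zero (ι := Fin k) (W := fun _ => V) (fun _ => hV) fun _ => hv
  | .negSucc k => tprod_ne_zero (ι := Fin (k + 1)) (W := fun _ => Module.Dual ℂ V)
      (fun _ => by rw [Subspace.dual_finrank_eq, hV]) fun _ => dualVec_ne_zero hV hv

/-- A chosen nonzero vector of a line. -/
def someVec (hV : Module.finrank ℂ V = 1) : V := (finrank_eq_one_iff'.1 hV).choose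

lemma someVec_ne_zero (hV : Module.finrank ℂ V = 1) : someVec hV ≠ 0 :=
  (finrank_eq_one_iff'.1 hV).choose_spec.1

/-- The coordinate on a line `L` with respect to a nonzero vector. -/
def lineCoord (hV : Module.finrank ℂ V = 1) {v : V} (hv : v ≠ 0) : V →ₗ[ℂ] ℂ :=
  (FiniteDimensional.basisSingleton Unit hV v hv).coord ()

lemma lineCoord_smul (hV : Module.finrank ℂ V = 1) {v : V} (hv : v ≠ 0) (c : ℂ) :
    lineCoord hV hv (c • v) = c := by
  have := (FiniteDimensional.basisSingleton Unit hV v hv).repr_self ()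
  rw [FiniteDimensional.basisSingleton_apply] at this
  simp [lineCoord, this]

lemma lineCoord_self_smul (hV : Module.finrank ℂ V = 1) {v : V} (hv : v ≠ 0) (w : V) :
    lineCoord hV hv w • v = w := by
  obtain ⟨c, rfl⟩ := exists_smul_eq_of_finrank_eq_one hV hv w
  rw [lineCoord_smul]

/-- The canonical pairing `Vᵃ ⊗ Vᵇ → Vᶜ` where `c = a + b` (tensoring, and contracting `V` with its
dual): the bilinear map with `vᵃ ⊗ vᵇ ↦ vᶜ` for one, equivalently every, nonzero `v`; see
`zmul_vpow`. -/
def zmul (hV : Module.finrank ℂ V = 1) (a b c : ℤ) : LinePow V a →ₗ[ℂ] LinePow V b →ₗ[ℂ] LinePow V c :=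
  LinearMap.mk₂ ℂ (fun p q =>
    (lineCoord (finrank_linePow hV a) (vpow_ne_zero hV (someVec_ne_zero hV) a) p *
      lineCoord (finrank_linePow hV b) (vpow_ne_zero hV (someVec_ne_zero hV) b) q) •
      vpow (someVec hV) c)
    (fun p p' q => by rw [map_add, add_mul, add_smul])
    (fun k p q => by rw [map_smul, smul_eq_mul, mul_assoc, mul_smul])
    (fun p q q' => by rw [map_add, mul_add, add_smul])
    (fun k p q => by rw [map_smul, smul_eq_mul, mul_left_comm, mul_smul])

lemma zmul_vpow (hV : Module.finrank ℂ V = 1) {a b c : ℤ} (h : c = a + b) {v : V} (hv : v ≠ 0) :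
    zmul hV a b c (vpow v a) (vpow v b) = vpow v c := by
  obtain ⟨k, rfl⟩ := exists_smul_eq_of_finrank_eq_one hV (someVec_ne_zero hV) v
  have hk : k ≠ 0 := by rintro rfl; simp at hv
  rw [vpow_smul hV (someVec_ne_zero hV) hk, vpow_smul hV (someVec_ne_zero hV) hk,
    vpow_smul hV (someVec_ne_zero hV) hk]
  simp only [zmul, LinearMap.mk₂_apply, lineCoord_smul]
  rw [h, zpow_add₀ hk]

lemma zmul_assoc (hV : Module.finrank ℂ V = 1) {a b c ab bc abc : ℤ} (h1 : ab = a + b)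
    (h2 : bc = b + c) (h3 : abc = a + b + c) (p : LinePow V a) (q : LinePow V b) (r : LinePow V c) :
    zmul hV ab c abc (zmul hV a b ab p q) r = zmul hV a bc abc p (zmul hV b c bc q r) := by
  have hv := someVec_ne_zero hV
  obtain ⟨x, rfl⟩ := exists_smul_eq_of_finrank_eq_one (finrank_linePow hV a) (vpow_ne_zero hV hv a) p
  obtain ⟨y, rfl⟩ := exists_smul_eq_of_finrank_eq_one (finrank_linePow hV b) (vpow_ne_zero hV hv b) q
  obtain ⟨z, rfl⟩ := exists_smul_eq_of_finrank_eq_one (finrank_linePow hV c) (vpow_ne_zero hV hv c) r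
  simp only [map_smul, LinearMap.smul_apply]
  rw [zmul_vpow hV h1 hv, zmul_vpow hV h2 hv, zmul_vpow hV (by omega) hv,
    zmul_vpow hV (by omega) hv]

end Lines

section LineBundles

open scoped TensorProduct

universe v

/-- A smooth Hermitian line bundle on `X`: a family of complex lines together with an atlas of local
unitary frames over open sets covering `X`, such that any two frames differ by a smooth function
with values in the unit circle. The Hermitian metric is the one for which the frames have length
one; a local section is smooth when its coordinates in the frames are. -/
structure HermLineBundle (E : Type*) [NormedAddCommGroup E] [NormedSpace ℝ E]
    (X : Type*) [TopologicalSpace X] [ChartedSpace E X] where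
  fiber : X → Type v
  [addCommGroup : ∀ x, AddCommGroup (fiber x)]
  [module : ∀ x, Module ℂ (fiber x)]
  finrank_fiber : ∀ x, Module.finrank ℂ (fiber x) = 1
  /-- the index set of the frames, with their domains -/
  Idx : Type v
  dom : Idx → Set X
  isOpen_dom : ∀ a, IsOpen (dom a)
  exists_mem_dom : ∀ x, ∃ a, x ∈ dom a
  frame : Idx → ∀ x, fiber x
  frame_ne_zero : ∀ a, ∀ x ∈ dom a, frame a x ≠ 0
  /-- the transition functions (meaningful on the overlap of the domains) -/
  trans : Idx → Idx → X → ℂ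
  trans_smooth : ∀ a b, ContMDiffOn 𝓘(ℝ, E) 𝓘(ℝ, ℂ) ∞ (trans a b) (dom a ∩ dom b)
  norm_trans : ∀ a b, ∀ x ∈ dom a ∩ dom b, ‖trans a b x‖ = 1
  frame_eq : ∀ a b, ∀ x ∈ dom a ∩ dom b, frame b x = trans a b x • frame a x

namespace HermLineBundle

variable {E : Type*} [NormedAddCommGroup E] [NormedSpace ℝ E]
  {X : Type*} [TopologicalSpace X] [ChartedSpace E X]
  {E' : Type*} [NormedAddCommGroup E'] [NormedSpace ℝ E']
  {X' : Type*} [TopologicalSpace X'] [ChartedSpace E' X']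

instance (L : HermLineBundle.{v} E X) (x : X) : AddCommGroup (L.fiber x) := L.addCommGroup x

instance (L : HermLineBundle.{v} E X) (x : X) : Module ℂ (L.fiber x) := L.module x

lemma trans_ne_zero (L : HermLineBundle.{v} E X) {a b : L.Idx} {x : X}
    (hx : x ∈ L.dom a ∩ L.dom b) : L.trans a b x ≠ 0 := by
  intro h
  have := L.norm_trans a b x hx
  simp [h] at this

lemma isOpen_inter (L : HermLineBundle.{v} E X) (a b : L.Idx) : IsOpen (L.dom a ∩ L.dom b) :=
  (L.isOpen_dom a).inter (L.isOpen_dom b)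

lemma mdiff_trans (L : HermLineBundle.{v} E X) {a b : L.Idx} {x : X}
    (hx : x ∈ L.dom a ∩ L.dom b) : MDifferentiableAt 𝓘(ℝ, E) 𝓘(ℝ, ℂ) (L.trans a b) x :=
  ((L.trans_smooth a b).contMDiffAt ((L.isOpen_inter a b).mem_nhds hx)).mdifferentiableAt (by simp)

/-- The pullback `f^{-1}(L)` along a smooth map. -/
def pullback (L : HermLineBundle.{v} E' X') (f : X → X')
    (hf : ContMDiff 𝓘(ℝ, E) 𝓘(ℝ, E') ∞ f) : HermLineBundle.{v} E X where
  fiber x := L.fiber (f x)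
  finrank_fiber x := L.finrank_fiber (f x)
  Idx := L.Idx
  dom a := f ⁻¹' L.dom a
  isOpen_dom a := (L.isOpen_dom a).preimage hf.continuous
  exists_mem_dom x := L.exists_mem_dom (f x)
  frame a x := L.frame a (f x)
  frame_ne_zero a x hx := L.frame_ne_zero a (f x) hx
  trans a b x := L.trans a b (f x)
  trans_smooth a b := (L.trans_smooth a b).comp hf.contMDiffOn (fun _ hx => hx)
  norm_trans a b x hx := L.norm_trans a b (f x) hx
  frame_eq a b x hx := L.frame_eq a b (f x) hx

lemma contMDiffOn_zpow {t : X → ℂ} {h : X → ℤ} (hh : IsLocallyConstant h) {U : Set X}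
    (hU : IsOpen U) (ht : ContMDiffOn 𝓘(ℝ, E) 𝓘(ℝ, ℂ) ∞ t U) (h0 : ∀ x ∈ U, t x ≠ 0) :
    ContMDiffOn 𝓘(ℝ, E) 𝓘(ℝ, ℂ) ∞ (fun x => t x ^ h x) U := by
  intro x hx
  apply ContMDiffAt.contMDiffWithinAt
  have htx := ht.contMDiffAt (hU.mem_nhds hx)
  have hs : h ⁻¹' {h x} ∈ 𝓝 x := (hh.isOpen_fiber (h x)).mem_nhds rfl
  have h1 : ContMDiffAt 𝓘(ℝ, E) 𝓘(ℝ, ℂ) ∞ (fun z => t z ^ h x) x := by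
    have hp : ContDiffAt ℝ ∞ (fun z : ℂ => z ^ h x) (t x) := by
      rcases h x with k | k
      · simpa using (contDiff_id.pow k).contDiffAt
      · simp only [zpow_negSucc]
        exact ((contDiff_id.pow (k + 1)).contDiffAt).inv (pow_ne_zero _ (h0 x hx))
    exact hp.contMDiffAt.comp x htx
  refine h1.congr_of_eventuallyEq ?_
  filter_upwards [hs] with z hz
  have hz' : h z = h x := hz
  rw [hz']

lemma contMDiffOn_prod {n : ℕ} {t : Fin n → X → ℂ} {U : Set X}
    (ht : ∀ i, ContMDiffOn 𝓘(ℝ, E) 𝓘(ℝ, ℂ) ∞ (t i) U) :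
    ContMDiffOn 𝓘(ℝ, E) 𝓘(ℝ, ℂ) ∞ (fun x => ∏ i, t i x) U := by
  have h : ContDiff ℝ ∞ (fun p : Fin n → ℂ => ∏ i, p i) := contDiff_prod fun i _ => by fun_prop
  exact h.contMDiff.comp_contMDiffOn (contMDiffOn_pi_space.2 ht)

/-- The line bundle `K^h` with fibre `(K_x)^{h(x)}` at `x`. -/
def zpow (K : HermLineBundle.{v} E X) (h : X → ℤ) (hh : IsLocallyConstant h) :
    HermLineBundle.{v} E X where
  fiber x := LinePow (K.fiber x) (h x)
  finrank_fiber x := finrank_linePow (K.finrank_fiber x) (h x)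
  Idx := K.Idx
  dom := K.dom
  isOpen_dom := K.isOpen_dom
  exists_mem_dom := K.exists_mem_dom
  frame a x := vpow (K.frame a x) (h x)
  frame_ne_zero a x hx := vpow_ne_zero (K.finrank_fiber x) (K.frame_ne_zero a x hx) _
  trans a b x := K.trans a b x ^ h x
  trans_smooth a b := contMDiffOn_zpow hh (K.isOpen_inter a b) (K.trans_smooth a b)
    (fun _ hx => K.trans_ne_zero hx)
  norm_trans a b x hx := by rw [norm_zpow, K.norm_trans a b x hx, one_zpow]
  frame_eq a b x hx := by
    rw [K.frame_eq a b x hx, vpow_smul (K.finrank_fiber x) (K.frame_ne_zero a x hx.1)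
      (K.trans_ne_zero hx)]

/-- The tensor product of finitely many Hermitian line bundles. -/
def tensor {n : ℕ} (K : Fin n → HermLineBundle.{v} E X) : HermLineBundle.{v} E X where
  fiber x := ⨂[ℂ] i, (K i).fiber x
  finrank_fiber x := finrank_tensor fun i => (K i).finrank_fiber x
  Idx := ∀ i, (K i).Idx
  dom a := ⋂ i, (K i).dom (a i)
  isOpen_dom a := isOpen_iInter_of_finite fun i => (K i).isOpen_dom (a i)
  exists_mem_dom x := ⟨fun i => ((K i).exists_mem_dom x).choose,
    mem_iInter.2 fun i => ((K i).exists_mem_dom x).choose_spec⟩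
  frame a x := PiTensorProduct.tprod ℂ fun i => (K i).frame (a i) x
  frame_ne_zero a x hx := tprod_ne_zero (fun i => (K i).finrank_fiber x) fun i =>
    (K i).frame_ne_zero (a i) x (mem_iInter.1 hx i)
  trans a b x := ∏ i, (K i).trans (a i) (b i) x
  trans_smooth a b := contMDiffOn_prod fun i => ((K i).trans_smooth (a i) (b i)).mono
    fun _ hx => ⟨mem_iInter.1 hx.1 i, mem_iInter.1 hx.2 i⟩
  norm_trans a b x hx := by
    rw [norm_prod]
    exact Finset.prod_eq_one fun i _ =>
      (K i).norm_trans _ _ x ⟨mem_iInter.1 hx.1 i, mem_iInter.1 hx.2 i⟩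
  frame_eq a b x hx := by
    rw [← MultilinearMap.map_smul_univ]
    congr 1
    funext i
    exact (K i).frame_eq _ _ x ⟨mem_iInter.1 hx.1 i, mem_iInter.1 hx.2 i⟩

/-- A Hermitian connection `∇` on `L`, given by its connection forms: `∇ s_a = A_a ⊗ s_a` for the
unitary frames `s_a`. The forms `A_a` are smooth and imaginary, and the Leibniz rule
for `s_b = t s_a` reads `A_b = A_a + t⁻¹ dt`. -/
structure Connection (L : HermLineBundle.{v} E X) where
  form : L.Idx → Form E X 1 ℂ
  smooth : ∀ a, (form a).SmoothOn (L.dom a)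
  imaginary : ∀ a, (form a).ImaginaryOn (L.dom a)
  compat : ∀ a b, ∀ x ∈ L.dom a ∩ L.dom b,
    form b x = form a x + Form.dLog (L.trans a b) x

/-- A frame around `x`. -/
def idxAt (L : HermLineBundle.{v} E X) (x : X) : L.Idx := (L.exists_mem_dom x).choose

namespace Connection

/-- The curvature two-form `F_∇`, which is `dA_a` on the domain of the frame `s_a`. -/
def curvature {L : HermLineBundle.{v} E X} (nabla : L.Connection) : Form E X 2 ℂ := fun x =>
  (nabla.form (L.idxAt x)).d x

variable [IsManifold 𝓘(ℝ, E) ∞ X] [IsManifold 𝓘(ℝ, E') ∞ X']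

/-- The pullback connection. -/
def pullback {L : HermLineBundle.{v} E' X'} (nabla : L.Connection) (f : X → X')
    (hf : ContMDiff 𝓘(ℝ, E) 𝓘(ℝ, E') ∞ f) : (L.pullback f hf).Connection where
  form a := Form.pullback f (nabla.form a)
  smooth a := (nabla.smooth a).pullback hf
  imaginary a x hx v := nabla.imaginary a (f x) hx _
  compat a b x hx := by
    have h := nabla.compat a b (f x) hx
    have h2 := Form.dLog_comp (L.mdiff_trans (a := a) (b := b) (x := f x) hx)
      ((hf x).mdifferentiableAt (by simp))
    change Form.pullback f (nabla.form b) x = Form.pullback f (nabla.form a) x +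
      Form.dLog (fun z => L.trans a b (f z)) x
    rw [h2]
    simp only [Form.pullback]
    rw [h]
    rfl

/-- The induced connection on `K^h`, with connection forms `h A_a`. -/
def zpow {K : HermLineBundle.{v} E X} (nabla : K.Connection) (h : X → ℤ)
    (hh : IsLocallyConstant h) : (K.zpow h hh).Connection where
  form a := fun x => (h x : ℝ) • nabla.form a x
  smooth a := (nabla.smooth a).zsmul hh
  imaginary a x hx v := by
    have := nabla.imaginary a x hx v
    simp only [ContinuousAlternatingMap.smul_apply, Complex.real_smul, Complex.re_ofReal_mul]
    rw [this, mul_zero]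
  compat a b x hx := by
    change (h x : ℝ) • nabla.form b x = (h x : ℝ) • nabla.form a x +
      Form.dLog (fun z => K.trans a b z ^ h z) x
    rw [Form.dLog_zpow hh (K.mdiff_trans hx) (K.trans_ne_zero hx), nabla.compat a b x hx, smul_add]

/-- The tensor product connection, with connection forms `∑ i, A_i`. -/
def tensor {n : ℕ} {K : Fin n → HermLineBundle.{v} E X} (nabla : ∀ i, (K i).Connection) :
    (HermLineBundle.tensor K).Connection where
  form a := ∑ i, (nabla i).form (a i)
  smooth a := Form.SmoothOn.sum fun i _ => ((nabla i).smooth (a i)).mono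
    fun _ hx => mem_iInter.1 hx i
  imaginary a x hx v := by
    rw [Finset.sum_apply, ContinuousAlternatingMap.sum_apply, Complex.re_sum]
    exact Finset.sum_eq_zero fun i _ => (nabla i).imaginary (a i) x (mem_iInter.1 hx i) v
  compat a b x hx := by
    have hx' : ∀ i, x ∈ (K i).dom (a i) ∩ (K i).dom (b i) := fun i =>
      ⟨mem_iInter.1 hx.1 i, mem_iInter.1 hx.2 i⟩
    change (∑ i, (nabla i).form (b i)) x = (∑ i, (nabla i).form (a i)) x +
      Form.dLog (fun z => ∏ i, (K i).trans (a i) (b i) z) x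
    rw [Form.dLog_prod (fun i => (K i).mdiff_trans (hx' i)) (fun i => (K i).trans_ne_zero (hx' i)),
      Finset.sum_apply, Finset.sum_apply, ← Finset.sum_add_distrib]
    exact Finset.sum_congr rfl fun i _ => (nabla i).compat _ _ x (hx' i)

end Connection

end HermLineBundle

end LineBundles

section BundleGerbes

open scoped TensorProduct

universe v u

variable {EY : Type*} [NormedAddCommGroup EY] [NormedSpace ℝ EY]
  {Y : Type*} [TopologicalSpace Y] [ChartedSpace EY Y]
  {EM : Type*} [NormedAddCommGroup EM] [NormedSpace ℝ EM]
  {M : Type u} [TopologicalSpace M] [ChartedSpace EM M]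

namespace FibrePow

variable {π : SurjSubmersion EY Y EM M}

/-- The point `(y₁, y₂)` of `Y^{[2]}`. -/
def pair {y₁ y₂ : Y} (h : π y₁ = π y₂) : FibrePow π 1 :=
  ⟨![y₁, y₂], fun i => by fin_cases i; exacts [rfl, h.symm]⟩

/-- The point `(y₁, y₂, y₃)` of `Y^{[3]}`. -/
def triple {y₁ y₂ y₃ : Y} (h : π y₁ = π y₂) (h' : π y₂ = π y₃) : FibrePow π 2 :=
  ⟨![y₁, y₂, y₃], fun i => by fin_cases i; exacts [rfl, h.symm, (h.trans h').symm]⟩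

lemma face_two_triple {y₁ y₂ y₃ : Y} (h : π y₁ = π y₂) (h' : π y₂ = π y₃) :
    face 2 (triple h h') = pair h := by
  apply ext'; intro i; fin_cases i <;> rfl

lemma face_zero_triple {y₁ y₂ y₃ : Y} (h : π y₁ = π y₂) (h' : π y₂ = π y₃) :
    face 0 (triple h h') = pair h' := by
  apply ext'; intro i; fin_cases i <;> rfl

lemma face_one_triple {y₁ y₂ y₃ : Y} (h : π y₁ = π y₂) (h' : π y₂ = π y₃) :
    face 1 (triple h h') = pair (h.trans h') := by
  apply ext'; intro i; fin_cases i <;> rfl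

/-- `δ(g) = ∑ i, (-1)^i g ∘ π_{i+1} : Y^{[p+2]} → A` for `g : Y^{[p+1]} → A`, where `π_{i+1}`
omits the `i`-th entry, counted from zero. -/
def delta {A : Type*} [AddCommGroup A] {p : ℕ} (g : FibrePow π p → A) : FibrePow π (p + 1) → A :=
  fun z => ∑ i : Fin (p + 2), (-1 : ℤ) ^ (i : ℕ) • g (face i z)

/-- `δ(f)(y₁, y₂) = f(y₂) - f(y₁)` for a function `f` on `Y`. -/
def deltaFun {A : Type*} [AddCommGroup A] (f : Y → A) : FibrePow π 1 → A :=
  fun z => f (entry 1 z) - f (entry 0 z)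

/-- `δ(α) = π₁^* α - π₂^* α` for a form `α` on `Y`, with `π₁(y₁, y₂) = y₂` and
`π₂(y₁, y₂) = y₁`. -/
def deltaForm {k : ℕ} (α : Form EY Y k ℂ) : Form (Model π 1) (FibrePow π 1) k ℂ :=
  Form.pullback (entry 1) α - Form.pullback (entry 0) α

lemma cocycle_face {g : FibrePow π 1 → ℤ} (hg : delta g = 0) (z : FibrePow π 2) :
    g (face 1 z) = g (face 2 z) + g (face 0 z) := by
  have := congrFun hg z
  have h3 : (∑ i : Fin 3, (-1 : ℤ) ^ (i : ℕ) • g (face i z)) = 0 := this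
  rw [Fin.sum_univ_three] at h3
  simp at h3
  omega

lemma cocycle_pair {g : FibrePow π 1 → ℤ} (hg : delta g = 0) {y₁ y₂ y₃ : Y}
    (h : π y₁ = π y₂) (h' : π y₂ = π y₃) :
    g (pair (h.trans h')) = g (pair h) + g (pair h') := by
  have := cocycle_face hg (triple h h')
  rwa [face_one_triple, face_two_triple, face_zero_triple] at this

end FibrePow

open FibrePow

/-- A bundle gerbe `(P, Y)` over `M`: a Hermitian line bundle `P → Y^{[2]}` with a smooth, unitary
and associative multiplication `P_{(y₁, y₂)} ⊗ P_{(y₂, y₃)} → P_{(y₁, y₃)}`. -/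
structure BundleGerbe (π : SurjSubmersion EY Y EM M) where
  P : HermLineBundle.{v} (Model π 1) (FibrePow π 1)
  mul : ∀ {y₁ y₂ y₃ : Y} (h : π y₁ = π y₂) (h' : π y₂ = π y₃),
    P.fiber (pair h) →ₗ[ℂ] P.fiber (pair h') →ₗ[ℂ] P.fiber (pair (h.trans h'))
  /-- the multiplication in unitary frames: `s_a · s_b = κ s_c`, where `κ` is smooth of modulus one
  on the open subset of `Y^{[3]}` where the three frames are defined -/
  mulCoeff : P.Idx → P.Idx → P.Idx → FibrePow π 2 → ℂ
  mulCoeff_smooth : ∀ a b c, ContMDiffOn 𝓘(ℝ, Model π 2) 𝓘(ℝ, ℂ) ∞ (mulCoeff a b c)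
    (face 2 ⁻¹' P.dom a ∩ face 0 ⁻¹' P.dom b ∩ face 1 ⁻¹' P.dom c)
  norm_mulCoeff : ∀ a b c,
    ∀ z ∈ face 2 ⁻¹' P.dom a ∩ face 0 ⁻¹' P.dom b ∩ face 1 ⁻¹' P.dom c, ‖mulCoeff a b c z‖ = 1
  mul_frame : ∀ a b c {y₁ y₂ y₃ : Y} (h : π y₁ = π y₂) (h' : π y₂ = π y₃),
    pair h ∈ P.dom a → pair h' ∈ P.dom b → pair (h.trans h') ∈ P.dom c →
    mul h h' (P.frame a (pair h)) (P.frame b (pair h')) =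
      mulCoeff a b c (triple h h') • P.frame c (pair (h.trans h'))
  mul_assoc : ∀ {y₁ y₂ y₃ y₄ : Y} (h : π y₁ = π y₂) (h' : π y₂ = π y₃) (h'' : π y₃ = π y₄)
    (p : P.fiber (pair h)) (q : P.fiber (pair h')) (r : P.fiber (pair h'')),
    mul (h.trans h') h'' (mul h h' p q) r = mul h (h'.trans h'') p (mul h' h'' q r)

namespace BundleGerbe

variable {π : SurjSubmersion EY Y EM M}

/-- The subset of `Y^{[3]}` on which three frames of `P` are pulled back. -/
def mulDom (G : BundleGerbe.{v} π) (a b c : G.P.Idx) : Set (FibrePow π 2) :=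
  face 2 ⁻¹' G.P.dom a ∩ face 0 ⁻¹' G.P.dom b ∩ face 1 ⁻¹' G.P.dom c

lemma isOpen_mulDom (G : BundleGerbe.{v} π) (a b c : G.P.Idx) : IsOpen (G.mulDom a b c) :=
  (((G.P.isOpen_dom a).preimage (contMDiff_face 2).continuous).inter
    ((G.P.isOpen_dom b).preimage (contMDiff_face 0).continuous)).inter
    ((G.P.isOpen_dom c).preimage (contMDiff_face 1).continuous)

lemma mdiff_mulCoeff (G : BundleGerbe.{v} π) {a b c : G.P.Idx} {z : FibrePow π 2}
    (hz : z ∈ G.mulDom a b c) :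
    MDifferentiableAt 𝓘(ℝ, Model π 2) 𝓘(ℝ, ℂ) (G.mulCoeff a b c) z :=
  ((G.mulCoeff_smooth a b c).contMDiffAt ((G.isOpen_mulDom a b c).mem_nhds hz)).mdifferentiableAt
    (by simp)

lemma mulCoeff_ne_zero (G : BundleGerbe.{v} π) {a b c : G.P.Idx} {z : FibrePow π 2}
    (hz : z ∈ G.mulDom a b c) : G.mulCoeff a b c z ≠ 0 := by
  intro h
  have := G.norm_mulCoeff a b c z hz
  simp [h] at this

/-- A bundle gerbe connection: a Hermitian connection on `P` for which the multiplication
`π₃^{-1}(P) ⊗ π₁^{-1}(P) → π₂^{-1}(P)` is parallel. In unitary frames with `s_a · s_b = κ s_c` this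
says `π₃^* A_a + π₁^* A_b = π₂^* A_c + κ⁻¹ dκ`. -/
structure Connection (G : BundleGerbe.{v} π) where
  nabla : G.P.Connection
  parallel : ∀ a b c, ∀ z ∈ G.mulDom a b c,
    Form.pullback (E := Model π 2) (face 2) (nabla.form a) z +
      Form.pullback (E := Model π 2) (face 0) (nabla.form b) z =
    Form.pullback (E := Model π 2) (face 1) (nabla.form c) z + Form.dLog (G.mulCoeff a b c) z

/-- The canonical pairing `L_mᵃ ⊗ L_{m'}ᵇ → L_mᶜ` for `m = m'` and `c = a + b`. -/
def zmulAt (L : HermLineBundle.{v} EM M) {m : M} (a b c : ℤ) : ∀ {m' : M}, m = m' →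
    (LinePow (L.fiber m) a →ₗ[ℂ] LinePow (L.fiber m') b →ₗ[ℂ] LinePow (L.fiber m) c)
  | _, rfl => zmul (L.finrank_fiber m) a b c

lemma zmulAt_frame (L : HermLineBundle.{v} EM M) {m m' : M} (e : m = m') {a b c : ℤ}
    (hc : c = a + b) {i j k : L.Idx} (hi : m ∈ L.dom i) (hj : m' ∈ L.dom j) (hk : m ∈ L.dom k) :
    zmulAt L a b c e (vpow (L.frame i m) a) (vpow (L.frame j m') b) =
      (L.trans k i m ^ a * L.trans k j m ^ b) • vpow (L.frame k m) c := by
  subst e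
  have hv := L.frame_ne_zero k m hk
  rw [L.frame_eq k i m ⟨hk, hi⟩, L.frame_eq k j m ⟨hk, hj⟩,
    vpow_smul (L.finrank_fiber m) hv (L.trans_ne_zero ⟨hk, hi⟩),
    vpow_smul (L.finrank_fiber m) hv (L.trans_ne_zero ⟨hk, hj⟩)]
  simp only [zmulAt, map_smul, LinearMap.smul_apply]
  rw [zmul_vpow (L.finrank_fiber m) hc hv, smul_smul, mul_comm]

lemma zmulAt_assoc (L : HermLineBundle.{v} EM M) {m m' m'' : M} (e : m = m') (e' : m' = m'')
    {a b c ab bc abc : ℤ} (h1 : ab = a + b) (h2 : bc = b + c) (h3 : abc = a + b + c)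
    (p : LinePow (L.fiber m) a) (q : LinePow (L.fiber m') b) (r : LinePow (L.fiber m'') c) :
    zmulAt L ab c abc (e.trans e') (zmulAt L a b ab e p q) r =
      zmulAt L a bc abc e p (zmulAt L b c bc e' q r) := by
  subst e; subst e'
  exact zmul_assoc (L.finrank_fiber m) h1 h2 h3 p q r

lemma isLocallyConstant_face {g : FibrePow π 1 → ℤ} (hg : IsLocallyConstant g) (i : Fin 3) :
    IsLocallyConstant fun z : FibrePow π 2 => g (face i z) :=
  hg.comp_continuous (contMDiff_face i).continuous

/-- The cup product bundle gerbe `(L^g, Y)` of `L → M` and a locally constant `g : Y^{[2]} → ℤ` with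
`δ(g) = 0`: the fibre at `(y₁, y₂)` is `L_m^{g(y₁, y₂)}` with `m = π(y₁) = π(y₂)`, and the
multiplication is the canonical pairing of tensor powers. -/
def cupProduct (π : SurjSubmersion EY Y EM M) (L : HermLineBundle.{v} EM M)
    (g : FibrePow π 1 → ℤ) (hg : IsLocallyConstant g) (hδ : delta g = 0) :
    BundleGerbe.{v} π where
  P := (L.pullback base contMDiff_base).zpow g hg
  mul h h' := zmulAt L (g (pair h)) (g (pair h')) (g (pair (h.trans h'))) h
  mulCoeff a b c z := L.trans c a (base z) ^ g (face 2 z) * L.trans c b (base z) ^ g (face 0 z)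
  mulCoeff_smooth a b c := by
    have hb : Continuous (base : FibrePow π 2 → M) := contMDiff_base.continuous
    have h1 : ∀ (a : L.Idx) (i : Fin 3), ContMDiffOn 𝓘(ℝ, Model π 2) 𝓘(ℝ, ℂ) ∞
        (fun z : FibrePow π 2 => L.trans c a (base z) ^ g (face i z))
        (base ⁻¹' (L.dom c ∩ L.dom a)) := fun a i =>
      HermLineBundle.contMDiffOn_zpow (isLocallyConstant_face hg i)
        ((L.isOpen_inter c a).preimage hb)
        ((L.trans_smooth c a).comp contMDiff_base.contMDiffOn (fun _ hx => hx))
        (fun _ hx => L.trans_ne_zero hx)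
    have hsub : ∀ z ∈ face 2 ⁻¹' (base ⁻¹' L.dom a : Set (FibrePow π 1)) ∩
        face 0 ⁻¹' (base ⁻¹' L.dom b : Set (FibrePow π 1)) ∩
        face 1 ⁻¹' (base ⁻¹' L.dom c : Set (FibrePow π 1)),
        base z ∈ L.dom c ∩ L.dom a ∧ base z ∈ L.dom c ∩ L.dom b := by
      rintro z ⟨⟨ha, hb⟩, hc⟩
      simp only [mem_preimage, base_face] at ha hb hc
      exact ⟨⟨hc, ha⟩, ⟨hc, hb⟩⟩
    have hm : ContDiff ℝ ∞ (fun p : ℂ × ℂ => p.1 * p.2) := by fun_prop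
    exact hm.contMDiff.comp_contMDiffOn (((h1 a 2).mono fun z hz => (hsub z hz).1).prodMk_space
      ((h1 b 0).mono fun z hz => (hsub z hz).2))
  norm_mulCoeff a b c := by
    rintro z ⟨⟨ha, hb⟩, hc⟩
    change base (face 2 z) ∈ L.dom a at ha
    change base (face 0 z) ∈ L.dom b at hb
    change base (face 1 z) ∈ L.dom c at hc
    rw [base_face] at ha hb hc
    rw [norm_mul, norm_zpow, norm_zpow, L.norm_trans c a _ ⟨hc, ha⟩, L.norm_trans c b _ ⟨hc, hb⟩]
    simp
  mul_frame a b c {y₁ y₂ y₃} h h' ha hb hc := by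
    have := zmulAt_frame L h (cocycle_pair hδ h h') ha hb hc
    rw [face_two_triple, face_zero_triple]
    exact this
  mul_assoc h h' h'' p q r :=
    zmulAt_assoc L h h' (cocycle_pair hδ h h') (cocycle_pair hδ h' h'')
      (by rw [cocycle_pair hδ (h.trans h') h'', cocycle_pair hδ h h']) p q r

/-- The cup product connection `∇^g` on `(L^g, Y)`. -/
def cupConnection (π : SurjSubmersion EY Y EM M) {L : HermLineBundle.{v} EM M}
    [IsManifold 𝓘(ℝ, EM) ∞ M] (nabla : L.Connection)
    (g : FibrePow π 1 → ℤ) (hg : IsLocallyConstant g) (hδ : delta g = 0) :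
    (cupProduct π L g hg hδ).Connection where
  nabla := (nabla.pullback base contMDiff_base).zpow g hg
  parallel a b c z hz := by
    obtain ⟨⟨ha, hb⟩, hc⟩ := hz
    change base (face 2 z) ∈ L.dom a at ha
    change base (face 0 z) ∈ L.dom b at hb
    change base (face 1 z) ∈ L.dom c at hc
    rw [base_face] at ha hb hc
    change L.Idx at a b c
    have hpb : ∀ (i : Fin 3) (k : L.Idx),
        Form.pullback (E := Model π 2) (face i)
          (((nabla.pullback base contMDiff_base).zpow g hg).form k) z =
        (g (face i z) : ℝ) • Form.pullback (E := Model π 2) base (nabla.form k) z := by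
      intro i k
      have h1 := Form.pullback_comp (E := Model π 2) (E' := Model π 1) (E'' := EM) (nabla.form k)
        (f := (face i : FibrePow π 2 → FibrePow π 1)) (g := base) (x := z)
        ((contMDiff_base (face i z)).mdifferentiableAt (by simp))
        ((contMDiff_face i z).mdifferentiableAt (by simp))
      have h2 : (base ∘ face i : FibrePow π 2 → M) = base := funext fun z => base_face i z
      rw [h2] at h1
      rw [← h1]
      rfl
    have hd : ∀ (i : Fin 3) (k : L.Idx), base z ∈ L.dom c ∩ L.dom k →
        MDifferentiableAt 𝓘(ℝ, Model π 2) 𝓘(ℝ, ℂ)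
          (fun z : FibrePow π 2 => L.trans c k (base z) ^ g (face i z)) z ∧
        Form.dLog (E := Model π 2) (fun z : FibrePow π 2 => L.trans c k (base z) ^ g (face i z)) z =
        (g (face i z) : ℝ) • Form.pullback (E := Model π 2) base (Form.dLog (E := EM) (L.trans c k)) z := by
      intro i k hk
      have hbz := (contMDiff_base (π := π) (p := 2) z).mdifferentiableAt (by simp)
      have ht : MDifferentiableAt 𝓘(ℝ, Model π 2) 𝓘(ℝ, ℂ)
          (fun z : FibrePow π 2 => L.trans c k (base z)) z := (L.mdiff_trans hk).comp z hbz
      constructor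
      · refine (Form.mdiff_zpow ht (L.trans_ne_zero hk) (g (face i z))).congr_of_eventuallyEq ?_
        filter_upwards [((isLocallyConstant_face hg i).isOpen_fiber (g (face i z))).mem_nhds rfl]
          with w hw
        have hw' : g (face i w) = g (face i z) := hw
        rw [hw']
      · rw [Form.dLog_zpow (isLocallyConstant_face hg i) ht (L.trans_ne_zero hk),
          Form.dLog_comp (L.mdiff_trans hk) hbz]
    have hcompat : ∀ k : L.Idx, base z ∈ L.dom c ∩ L.dom k →
        Form.pullback (E := Model π 2) base (nabla.form k) z =
        Form.pullback (E := Model π 2) base (nabla.form c) z +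
        Form.pullback (E := Model π 2) base (Form.dLog (E := EM) (L.trans c k)) z := by
      intro k hk
      simp only [Form.pullback]
      rw [nabla.compat c k _ hk]
      rfl
    have key : ∀ a b : L.Idx, base z ∈ L.dom c ∩ L.dom a → base z ∈ L.dom c ∩ L.dom b →
        Form.pullback (E := Model π 2) (face 2)
          (((nabla.pullback base contMDiff_base).zpow g hg).form a) z +
        Form.pullback (E := Model π 2) (face 0)
          (((nabla.pullback base contMDiff_base).zpow g hg).form b) z =
        Form.pullback (E := Model π 2) (face 1)
          (((nabla.pullback base contMDiff_base).zpow g hg).form c) z +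
        Form.dLog (E := Model π 2) (fun z : FibrePow π 2 =>
          L.trans c a (base z) ^ g (face 2 z) * L.trans c b (base z) ^ g (face 0 z)) z := by
      intro a b ha hb
      rw [Form.dLog_mul (hd 2 a ha).1 (hd 0 b hb).1
        (zpow_ne_zero _ (L.trans_ne_zero ha)) (zpow_ne_zero _ (L.trans_ne_zero hb)),
        (hd 2 a ha).2, (hd 0 b hb).2, hpb, hpb, hpb 1 c, hcompat a ha, hcompat b hb,
        cocycle_face hδ z]
      push_cast
      rw [add_smul, smul_add, smul_add]
      abel
    exact key a b ⟨hc, ha⟩ ⟨hc, hb⟩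

/-- The reduced product `⊗_R (P_i, Y)` of bundle gerbes over the same `Y → M`: the tensor product of
the line bundles `P_i → Y^{[2]}` with the factorwise multiplication. -/
def reducedProduct {n : ℕ} (G : Fin n → BundleGerbe.{v} π) : BundleGerbe.{v} π where
  P := HermLineBundle.tensor fun i => (G i).P
  mul h h' := PiTensorProduct.map₂ fun i => (G i).mul h h'
  mulCoeff a b c z := ∏ i, (G i).mulCoeff (a i) (b i) (c i) z
  mulCoeff_smooth a b c := HermLineBundle.contMDiffOn_prod fun i =>
    ((G i).mulCoeff_smooth (a i) (b i) (c i)).mono fun _ hz =>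
      ⟨⟨mem_iInter.1 hz.1.1 i, mem_iInter.1 hz.1.2 i⟩, mem_iInter.1 hz.2 i⟩
  norm_mulCoeff a b c z hz := by
    rw [norm_prod]
    exact Finset.prod_eq_one fun i _ => (G i).norm_mulCoeff _ _ _ z
      ⟨⟨mem_iInter.1 hz.1.1 i, mem_iInter.1 hz.1.2 i⟩, mem_iInter.1 hz.2 i⟩
  mul_frame a b c {y₁ y₂ y₃} h h' ha hb hc := by
    exact (PiTensorProduct.map₂_tprod_tprod (fun i => (G i).mul h h') _ _).trans
      (tprod_eq_smul fun i => (G i).mul_frame (a i) (b i) (c i) h h' (mem_iInter.1 ha i)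
        (mem_iInter.1 hb i) (mem_iInter.1 hc i))
  mul_assoc h h' h'' p q r :=
    map₂_assoc (fun i => (G i).mul h h') (fun i => (G i).mul (h.trans h') h'')
      (fun i => (G i).mul h' h'') (fun i => (G i).mul h (h'.trans h''))
      (fun i => (G i).mul_assoc h h' h'') p q r

/-- The product connection on a reduced product. -/
def productConnection {n : ℕ} {G : Fin n → BundleGerbe.{v} π} (nabla : ∀ i, (G i).Connection) :
    (reducedProduct G).Connection where
  nabla := HermLineBundle.Connection.tensor fun i => (nabla i).nabla
  parallel a b c z hz := by
    have hz' : ∀ i, z ∈ (G i).mulDom (a i) (b i) (c i) := fun i =>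
      ⟨⟨mem_iInter.1 hz.1.1 i, mem_iInter.1 hz.1.2 i⟩, mem_iInter.1 hz.2 i⟩
    have hs : ∀ (j : Fin 3) (e : ∀ i, (G i).P.Idx),
        Form.pullback (E := Model π 2) (face j) (∑ i, (nabla i).nabla.form (e i)) z =
        ∑ i, Form.pullback (E := Model π 2) (face j) ((nabla i).nabla.form (e i)) z := by
      intro j e
      ext v
      simp only [Form.pullback, Finset.sum_apply, ContinuousAlternatingMap.sum_apply,
        ContinuousAlternatingMap.compContinuousLinearMap_apply]
    have key : ∀ a b c : ∀ i, (G i).P.Idx, (∀ i, z ∈ (G i).mulDom (a i) (b i) (c i)) →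
        Form.pullback (E := Model π 2) (face 2) (∑ i, (nabla i).nabla.form (a i)) z +
          Form.pullback (E := Model π 2) (face 0) (∑ i, (nabla i).nabla.form (b i)) z =
        Form.pullback (E := Model π 2) (face 1) (∑ i, (nabla i).nabla.form (c i)) z +
          Form.dLog (E := Model π 2) (fun z => ∏ i, (G i).mulCoeff (a i) (b i) (c i) z) z := by
      intro a b c hz'
      rw [hs, hs, hs, Form.dLog_prod (fun i => (G i).mdiff_mulCoeff (hz' i))
        (fun i => (G i).mulCoeff_ne_zero (hz' i)), ← Finset.sum_add_distrib,
        ← Finset.sum_add_distrib]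
      exact Finset.sum_congr rfl fun i _ => (nabla i).parallel _ _ _ z (hz' i)
    exact key a b c hz'

/-- A curving for a bundle gerbe connection: an imaginary two-form `f` on `Y` with
`δ(f) = F_∇`. -/
structure IsCurving {G : BundleGerbe.{v} π} (nabla : G.Connection) (f : Form EY Y 2 ℂ) : Prop where
  smooth : f.Smooth
  imaginary : f.ImaginaryOn univ
  deltaForm_eq : deltaForm f = nabla.nabla.curvature

/-- `w` is the three-curvature of connective data `(∇, f)` over `π : Y → M`, that is, the three-form
on `M` with `df = π^* w`. -/
structure IsThreeCurvature (π : SurjSubmersion EY Y EM M) (f : Form EY Y 2 ℂ)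
    (w : Form EM M 3 ℂ) : Prop where
  smooth : w.Smooth
  d_eq : f.d = Form.pullback π w

/-- The choices which compute the Dixmier-Douady class of a bundle gerbe in Čech cohomology: an open
cover `U_a` of `M`, smooth sections `s_a : U_a → Y`, smooth unit length sections `σ_{ab}` of the
pullback of `P` along `(s_a, s_b) : U_a ∩ U_b → Y^{[2]}`, and smooth logarithms `h_{abc}` of the
`U(1)`-valued cocycle `σ_{ab} σ_{bc} = exp(2π i h_{abc}) σ_{ac}`. The Dixmier-Douady class in
`H³(M, ℤ)` is the class of the integral Čech cocycle
`n_{abcd} = h_{bcd} - h_{acd} + h_{abd} - h_{abc}`. -/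
structure CechData (G : BundleGerbe.{v} π) where
  ι : Type u
  U : ι → Set M
  isOpen_U : ∀ a, IsOpen (U a)
  exists_mem_U : ∀ x, ∃ a, x ∈ U a
  s : ι → M → Y
  s_smooth : ∀ a, ContMDiffOn 𝓘(ℝ, EM) 𝓘(ℝ, EY) ∞ (s a) (U a)
  s_section : ∀ a, ∀ x ∈ U a, π (s a x) = x
  σ : ∀ a b x (ha : x ∈ U a) (hb : x ∈ U b),
    G.P.fiber (pair ((s_section a x ha).trans (s_section b x hb).symm))
  σ_smooth : ∀ a b (k : G.P.Idx), ∃ t : M → ℂ,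
    ContMDiffOn 𝓘(ℝ, EM) 𝓘(ℝ, ℂ) ∞ t {x | ∃ (ha : x ∈ U a) (hb : x ∈ U b),
      pair ((s_section a x ha).trans (s_section b x hb).symm) ∈ G.P.dom k} ∧
    ∀ x (ha : x ∈ U a) (hb : x ∈ U b),
      pair ((s_section a x ha).trans (s_section b x hb).symm) ∈ G.P.dom k →
      ‖t x‖ = 1 ∧ σ a b x ha hb = t x • G.P.frame k _
  h : ι → ι → ι → M → ℝ
  h_smooth : ∀ a b c, ContMDiffOn 𝓘(ℝ, EM) 𝓘(ℝ, ℝ) ∞ (h a b c) (U a ∩ U b ∩ U c)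
  mul_σ : ∀ a b c x (ha : x ∈ U a) (hb : x ∈ U b) (hc : x ∈ U c),
    G.mul _ _ (σ a b x ha hb) (σ b c x hb hc) =
      Complex.exp (2 * Real.pi * Complex.I * h a b c x) • σ a c x ha hc
  n : ι → ι → ι → ι → M → ℤ
  n_eq : ∀ a b c e, ∀ x ∈ U a ∩ U b ∩ U c ∩ U e,
    (n a b c e x : ℝ) = h b c e x - h a c e x + h a b e x - h a b c x

end BundleGerbe

/-- The closed three-form `η` and the integral Čech cocycle `n` of the open cover `U` have the same
class in real cohomology, that is, they are cohomologous in the Čech-de Rham complex of `U`. -/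
def CechDeRham {ι : Type u} (U : ι → Set M) (n : ι → ι → ι → ι → M → ℤ)
    (η : Form EM M 3 ℝ) : Prop :=
  ∃ (B : ι → Form EM M 2 ℝ) (A : ι → ι → Form EM M 1 ℝ) (h : ι → ι → ι → M → ℝ),
    (∀ a, (B a).SmoothOn (U a)) ∧
    (∀ a b, (A a b).SmoothOn (U a ∩ U b)) ∧
    (∀ a b c, ContMDiffOn 𝓘(ℝ, EM) 𝓘(ℝ, ℝ) ∞ (h a b c) (U a ∩ U b ∩ U c)) ∧
    (∀ a, ∀ x ∈ U a, η x = (B a).d x) ∧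
    (∀ a b, ∀ x ∈ U a ∩ U b, B b x - B a x = (A a b).d x) ∧
    (∀ a b c, ∀ x ∈ U a ∩ U b ∩ U c,
      A b c x - A a c x + A a b x = Form.dFun (E := EM) (h a b c) x) ∧
    (∀ a b c e, ∀ x ∈ U a ∩ U b ∩ U c ∩ U e,
      h b c e x - h a c e x + h a b e x - h a b c x = (n a b c e x : ℝ))

/-- The real Dixmier-Douady class of `G` is represented by the closed three-form `η`: the class of
`η` in de Rham cohomology is the image of the Čech class of the Dixmier-Douady cocycle. The cocycle
exists, and the condition is imposed for all choices which enter into its construction. -/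
structure BundleGerbe.RealDDRepresentedBy {π : SurjSubmersion EY Y EM M} (G : BundleGerbe.{v} π)
    (η : Form EM M 3 ℝ) : Prop where
  smooth : η.Smooth
  closed : η.d = 0
  exists_cechData : Nonempty G.CechData
  cechDeRham : ∀ D : G.CechData, CechDeRham D.U D.n η

end BundleGerbes

end

/-! Over an open set of `M` with a section `s` of `π`, the cocycle condition at `(s(π y₁), y₁, y₂)`
says that `y ↦ g(s(π y), y)` has coboundary `g`. Averaging these local solutions with a partition of
unity pulled back from `M` keeps the coboundary, because the weights are constant along the fibres
of `π`. This gives the functions `φ_i` (`FibrePow.exists_deltaFun_eq`).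

The two pullbacks of `π^* F_i` to `Y^{[2]}` agree, so `δ(φ_i π^* F_i) = g_i F_i`, which is the
curvature of the `i`-th cup product connection; summing over `i` makes `f` a curving. Since `F_i` is
closed, the Leibniz rule leaves `df = ∑ dφ_i ∧ π^* F_i`. Along a fibre `φ_i` changes by integers, so
`exp(2π i φ_i)` descends to `q_i`, and `q_i⁻¹ dq_i` pulls back to `2π i dφ_i`; hence `df = π^* ω`.
Pullback along `π` is injective because `π` has local sections (`pullback_injective`), so `ω` is
unique, and it inherits closedness and imaginary values from `df`.

The last claim rests on a fact about any bundle gerbe with connection and curving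
(`BundleGerbe.CechData.cechDeRham`). Given Čech data `(s_a, σ_{ab}, h_{abc})`, the forms `s_a^* f`,
the connection forms of `(s_a, s_b)^* ∇` with respect to `σ_{ab}`, and the functions `2π i h_{abc}`
make a zigzag in the Čech-de Rham complex from `ω` to `2π i` times the integral cocycle. Dividing by
`2π i`, the class is that of `ω / 2π i`, and `(2π i)⁻² = -1/(4π²)`. It remains to produce one set of
Čech data: on a cover where the transition functions of all `L_i` have logarithms `l_{ab}`, the cup
product formula `h_{abc} = ∑ g_i(s_b, s_c) l_{ab}` does it (`nonempty_cechData_cupProduct`).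

The exterior derivative is defined at each point in that point's own preferred chart, so the
calculus of forms hinges on its naturality, `Form.d_pullback`. -/

noncomputable section

set_option linter.unusedSectionVars false

universe v u

/-! ### Smooth families of alternating maps -/

section Alternating

variable {E : Type*} [NormedAddCommGroup E] [NormedSpace ℝ E]
  {E' : Type*} [NormedAddCommGroup E'] [NormedSpace ℝ E']
  {V : Type*} [NormedAddCommGroup V] [NormedSpace ℝ V] {k : ℕ}

/-- Alternatization of continuous multilinear maps, as a continuous linear map. -/
def alternatizationCLM (E V : Type*) [NormedAddCommGroup E] [NormedSpace ℝ E]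
    [NormedAddCommGroup V] [NormedSpace ℝ V] (k : ℕ) :
    ContinuousMultilinearMap ℝ (fun _ : Fin k => E) V →L[ℝ] E [⋀^Fin k]→L[ℝ] V :=
  LinearMap.mkContinuous
    { toFun := ContinuousMultilinearMap.alternatization
      map_add' := map_add _
      map_smul' := fun c f => by
        ext v
        simp [ContinuousMultilinearMap.alternatization_apply_apply, Finset.smul_sum,
          smul_comm c] }
    -- There are `k!` permutations, and each contributes at most `‖f‖ * ∏ i, ‖m i‖`.
    (k.factorial : ℝ) fun f => by
      refine ContinuousAlternatingMap.opNorm_le_bound _ (by positivity) fun m => ?_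
      simp only [LinearMap.coe_mk, AddHom.coe_mk,
        ContinuousMultilinearMap.alternatization_apply_apply]
      refine (norm_sum_le _ _).trans ?_
      have h : ∀ σ ∈ (Finset.univ : Finset (Equiv.Perm (Fin k))),
          ‖Equiv.Perm.sign σ • f (m ∘ σ)‖ ≤ ‖f‖ * ∏ i, ‖m i‖ := by
        intro σ _
        have h1 : ‖Equiv.Perm.sign σ • f (m ∘ σ)‖ = ‖f (m ∘ σ)‖ := by
          rcases Int.units_eq_one_or (Equiv.Perm.sign σ) with h | h <;> simp [h]
        rw [h1]
        refine (f.le_opNorm _).trans (le_of_eq ?_)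
        congr 1
        exact Equiv.prod_comp σ fun i => ‖m i‖
      refine (Finset.sum_le_sum h).trans (le_of_eq ?_)
      simp [Finset.card_univ, Fintype.card_perm, mul_assoc]

/-- The sign of each permutation cancels the sign produced by permuting the arguments, so all `k!`
terms equal `f v`. Thus alternatization divided by `k!` is a continuous linear retraction onto
alternating maps, and smoothness of a family may be checked on the underlying multilinear maps. -/
lemma alternatizationCLM_coe (f : E [⋀^Fin k]→L[ℝ] V) :
    alternatizationCLM E V k f.toContinuousMultilinearMap = (k.factorial : ℝ) • f := by
  ext v
  change ContinuousMultilinearMap.alternatization f.toContinuousMultilinearMap v = _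
  rw [ContinuousMultilinearMap.alternatization_apply_apply]
  have h : ∀ σ : Equiv.Perm (Fin k),
      Equiv.Perm.sign σ • f.toContinuousMultilinearMap (v ∘ σ) = f v := by
    intro σ
    change Equiv.Perm.sign σ • f.toAlternatingMap (v ∘ σ) = f v
    rw [AlternatingMap.map_perm, smul_smul, Int.units_mul_self, one_smul]
    rfl
  rw [Finset.sum_congr rfl fun σ _ => h σ]
  simp [Finset.card_univ, Fintype.card_perm, ← Nat.cast_smul_eq_nsmul ℝ]

/-- Composing a smooth family of alternating maps with a smooth family of linear maps gives a
smooth family. -/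
lemma ContDiffAt.compContinuousLinearMap_alternating {G : Type*} [NormedAddCommGroup G]
    [NormedSpace ℝ G] {n : WithTop ℕ∞} {a : G → E' [⋀^Fin k]→L[ℝ] V} {b : G → E →L[ℝ] E'} {u : G}
    (ha : ContDiffAt ℝ n a u) (hb : ContDiffAt ℝ n b u) :
    ContDiffAt ℝ n (fun w => (a w).compContinuousLinearMap (b w)) u := by
  -- Precomposition with `(b, …, b)` is multilinear in the `k` copies of `b`, hence depends smoothly
  -- on `b`. Evaluating it at `a` and applying the retraction `(k!)⁻¹ • alternatizationCLM` gives
  -- the claim.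
  have h1 : ContDiffAt ℝ n (fun w => ContinuousMultilinearMap.compContinuousLinearMapContinuousMultilinear
      ℝ (fun _ : Fin k => E) (fun _ : Fin k => E') V (fun _ => b w)) u :=
    (ContinuousMultilinearMap.contDiff _).contDiffAt.comp u (contDiffAt_pi.2 fun _ => hb)
  have h2 : ContDiffAt ℝ n (fun w => (a w).toContinuousMultilinearMap) u :=
    (ContinuousAlternatingMap.toContinuousMultilinearMapLI (𝕜 := ℝ) (E := E') (F := V)
      (ι := Fin k)).contDiff.contDiffAt.comp u ha
  have h3 := (((alternatizationCLM E V k).contDiff.contDiffAt.comp u (h1.clm_apply h2)).const_smul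
    ((k.factorial : ℝ)⁻¹))
  refine h3.congr_of_eventuallyEq (Filter.Eventually.of_forall fun w => ?_)
  have e : ContinuousMultilinearMap.compContinuousLinearMapContinuousMultilinear
      ℝ (fun _ : Fin k => E) (fun _ : Fin k => E') V (fun _ => b w)
      (a w).toContinuousMultilinearMap =
      ((a w).compContinuousLinearMap (b w)).toContinuousMultilinearMap := rfl
  simp only [Function.comp_apply]
  rw [e, alternatizationCLM_coe, smul_smul, inv_mul_cancel₀ (by positivity), one_smul]

end Alternating

/-! ### Pullback and exterior derivative in charts -/

namespace Form

variable {E : Type*} [NormedAddCommGroup E] [NormedSpace ℝ E]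
  {X : Type*} [TopologicalSpace X] [ChartedSpace E X]
  {E' : Type*} [NormedAddCommGroup E'] [NormedSpace ℝ E']
  {X' : Type*} [TopologicalSpace X'] [ChartedSpace E' X']
  {V : Type*} [NormedAddCommGroup V] [NormedSpace ℝ V]
  {W : Type*} [NormedAddCommGroup W] [NormedSpace ℝ W] {k : ℕ}

/-- Smoothness of a form at a point. -/
def SmoothAt (α : Form E X k V) (x : X) : Prop :=
  ContDiffAt ℝ ∞ (α.inChart x) (extChartAt 𝓘(ℝ, E) x x)

lemma SmoothAt.congr {α β : Form E X k V} {x : X} (h : α.SmoothAt x) (hβ : ∀ᶠ z in 𝓝 x, β z = α z) :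
    β.SmoothAt x :=
  ContDiffAt.congr_of_eventuallyEq h (inChart_congr hβ fun _ hz => hz)

lemma d_congr {α β : Form E X k V} {x : X} (h : ∀ᶠ z in 𝓝 x, α z = β z) : α.d x = β.d x := by
  simp only [d]
  rw [(inChart_congr (E := E) h fun _ hz => hz).extDeriv_eq]

lemma SmoothAt.differentiableAt {α : Form E X k V} {x : X} (h : α.SmoothAt x) :
    DifferentiableAt ℝ (α.inChart x) (extChartAt 𝓘(ℝ, E) x x) :=
  ContDiffAt.differentiableAt h (by simp)

section charts

variable [IsManifold 𝓘(ℝ, E) ∞ X] [IsManifold 𝓘(ℝ, E') ∞ X']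

/-- Over `ℝ`, two derivatives suffice for symmetry of the second derivative, on which both `d ∘ d =
0` and the naturality of `d` depend. -/
lemma two_le_minSmoothness : minSmoothness ℝ 2 ≤ (∞ : WithTop ℕ∞) := by
  rw [minSmoothness_of_isRCLikeNormedField]
  exact WithTop.coe_le_coe.2 (le_top : (2 : ℕ∞) ≤ ⊤)

lemma contDiffAt_writtenInExtChartAt {f : X → X'} {x : X}
    (hf : ContMDiffAt 𝓘(ℝ, E) 𝓘(ℝ, E') ∞ f x) :
    ContDiffAt ℝ ∞ (extChartAt 𝓘(ℝ, E') (f x) ∘ f ∘ (extChartAt 𝓘(ℝ, E) x).symm)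
      (extChartAt 𝓘(ℝ, E) x x) := by
  have := (contMDiffAt_iff.1 hf).2
  rwa [modelWithCornersSelf_coe, range_id, contDiffWithinAt_univ] at this

/-- Smoothness of order `∞` at one point provides a neighbourhood for each finite order but not a
common one; order one is enough here. -/
lemma eventually_mdifferentiableAt {f : X → X'} {x : X}
    (hf : ContMDiffAt 𝓘(ℝ, E) 𝓘(ℝ, E') ∞ f x) :
    ∀ᶠ z in 𝓝 x, MDifferentiableAt 𝓘(ℝ, E) 𝓘(ℝ, E') f z := by
  have h1 : ContMDiffAt 𝓘(ℝ, E) 𝓘(ℝ, E') 1 f x := hf.of_le (by exact_mod_cast le_top)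
  have : IsManifold 𝓘(ℝ, E) 1 X := IsManifold.of_le (n := ∞) (by exact_mod_cast le_top)
  have : IsManifold 𝓘(ℝ, E') 1 X' := IsManifold.of_le (n := ∞) (by exact_mod_cast le_top)
  filter_upwards [(contMDiffAt_iff_contMDiffAt_nhds (by simp)).1 h1] with z hz
  exact hz.mdifferentiableAt (by simp)

/-- The coordinate expression of a pullback. -/
lemma inChart_pullback (α : Form E' X' k V) {f : X → X'} {x : X}
    (hf : ContMDiffAt 𝓘(ℝ, E) 𝓘(ℝ, E') ∞ f x) :
    (α.pullback (E := E) f).inChart x =ᶠ[𝓝 (extChartAt 𝓘(ℝ, E) x x)]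
      fun u => (α.inChart (f x)
        ((extChartAt 𝓘(ℝ, E') (f x) ∘ f ∘ (extChartAt 𝓘(ℝ, E) x).symm) u)).compContinuousLinearMap
        (fderiv ℝ (extChartAt 𝓘(ℝ, E') (f x) ∘ f ∘ (extChartAt 𝓘(ℝ, E) x).symm) u) := by
  set u₀ := extChartAt 𝓘(ℝ, E) x x with hu₀
  set F : E → E' := extChartAt 𝓘(ℝ, E') (f x) ∘ f ∘ (extChartAt 𝓘(ℝ, E) x).symm with hF
  have hFs : ContDiffAt ℝ ∞ F u₀ := contDiffAt_writtenInExtChartAt hf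
  have hcont := hf.continuousAt.preimage_mem_nhds
    (extChartAt_source_mem_nhds (I := 𝓘(ℝ, E')) (f x))
  have hev1 := eventually_symm (E := E) x hcont
  have hFev : ∀ᶠ u in 𝓝 u₀, ContDiffAt ℝ 1 F u :=
    (hFs.of_le (by exact_mod_cast le_top)).eventually (by simp)
  filter_upwards [hev1, hev1.eventually_nhds, eventually_target (E := E) x, hFev,
    eventually_symm (E := E) x (eventually_mdifferentiableAt hf)] with u h1 h1' h2 h3 hfu
  have hsymm : MDifferentiableAt 𝓘(ℝ, E) 𝓘(ℝ, E) (extChartAt 𝓘(ℝ, E) x).symm u :=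
    ((contMDiffOn_extChartAt_symm (n := ∞) x).contMDiffAt
      ((isOpen_extChartAt_target x).mem_nhds h2)).mdifferentiableAt (by simp)
  have hFt : F u ∈ (extChartAt 𝓘(ℝ, E') (f x)).target := PartialEquiv.map_source _ h1
  have hsymm' : MDifferentiableAt 𝓘(ℝ, E') 𝓘(ℝ, E') (extChartAt 𝓘(ℝ, E') (f x)).symm (F u) :=
    ((contMDiffOn_extChartAt_symm (n := ∞) (f x)).contMDiffAt
      ((isOpen_extChartAt_target (f x)).mem_nhds hFt)).mdifferentiableAt (by simp)
  have hFd : MDifferentiableAt 𝓘(ℝ, E) 𝓘(ℝ, E') F u :=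
    (h3.differentiableAt (by simp)).mdifferentiableAt
  have hval : (extChartAt 𝓘(ℝ, E') (f x)).symm (F u) = f ((extChartAt 𝓘(ℝ, E) x).symm u) :=
    PartialEquiv.left_inv _ h1
  have hcomp : (extChartAt 𝓘(ℝ, E') (f x)).symm ∘ F =ᶠ[𝓝 u]
      f ∘ (extChartAt 𝓘(ℝ, E) x).symm := by
    filter_upwards [h1'] with w hw
    exact PartialEquiv.left_inv _ hw
  -- The chain rule on the two sides of `hcomp` matches the tangent vectors fed to `α` by the
  -- coordinate expression with those fed to it by the pullback.
  have hd := hcomp.mfderiv_eq (I := 𝓘(ℝ, E)) (I' := 𝓘(ℝ, E'))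
  rw [mfderiv_comp u hsymm' hFd, mfderiv_comp u hfu hsymm, mfderiv_eq_fderiv] at hd
  ext v
  simp only [Form.pullback, inChart, ContinuousAlternatingMap.compContinuousLinearMap_apply]
  rw [hval]
  refine congrArg (α (f ((extChartAt 𝓘(ℝ, E) x).symm u))) (funext fun i => ?_)
  exact (DFunLike.congr_fun hd (v i)).symm

lemma SmoothAt.pullback {α : Form E' X' k V} {f : X → X'} {x : X} (hα : α.SmoothAt (f x))
    (hf : ContMDiffAt 𝓘(ℝ, E) 𝓘(ℝ, E') ∞ f x) : (α.pullback (E := E) f).SmoothAt x := by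
  have hF := contDiffAt_writtenInExtChartAt hf
  refine ContDiffAt.congr_of_eventuallyEq ?_ (inChart_pullback α hf)
  have hF' := hF.fderiv_right (m := ∞) (by simp)
  refine ContDiffAt.compContinuousLinearMap_alternating ?_ hF'
  refine ContDiffAt.comp (g := α.inChart (f x)) _ ?_ hF
  simpa [SmoothAt] using hα

/-- The exterior derivative commutes with pullback. -/
lemma d_pullback {α : Form E' X' k V} {f : X → X'} {x : X} (hα : α.SmoothAt (f x))
    (hf : ContMDiffAt 𝓘(ℝ, E) 𝓘(ℝ, E') ∞ f x) :
    (α.pullback (E := E) f).d x = Form.pullback f α.d x := by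
  have hF := contDiffAt_writtenInExtChartAt hf
  set F : E → E' := extChartAt 𝓘(ℝ, E') (f x) ∘ f ∘ (extChartAt 𝓘(ℝ, E) x).symm with hFdef
  have hFx : F (extChartAt 𝓘(ℝ, E) x x) = extChartAt 𝓘(ℝ, E') (f x) (f x) := by simp [hFdef]
  have hfx : MDifferentiableAt 𝓘(ℝ, E) 𝓘(ℝ, E') f x := hf.mdifferentiableAt (by simp)
  simp only [d]
  rw [(inChart_pullback α hf).extDeriv_eq, extDeriv_pullback (r := ∞) (by
    rw [hFx]; exact hα.differentiableAt) hF two_le_minSmoothness, hFx]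
  have hc : mfderiv 𝓘(ℝ, E) 𝓘(ℝ, E') F (extChartAt 𝓘(ℝ, E) x x) =
      fderiv ℝ F (extChartAt 𝓘(ℝ, E) x x) := mfderiv_eq_fderiv
  have hs : MDifferentiableAt 𝓘(ℝ, E) 𝓘(ℝ, E') F (extChartAt 𝓘(ℝ, E) x x) :=
    (hF.differentiableAt (by simp)).mdifferentiableAt
  have he : MDifferentiableAt 𝓘(ℝ, E) 𝓘(ℝ, E) (extChartAt 𝓘(ℝ, E) x) x :=
    (contMDiffAt_extChartAt (n := ∞)).mdifferentiableAt (by simp)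
  have he' : MDifferentiableAt 𝓘(ℝ, E') 𝓘(ℝ, E') (extChartAt 𝓘(ℝ, E') (f x)) (f x) :=
    (contMDiffAt_extChartAt (n := ∞)).mdifferentiableAt (by simp)
  -- After the Euclidean naturality of `extDeriv`, the tangent maps of the two charts remain;
  -- differentiating this identity exchanges them for that of `f`.
  have hev : F ∘ extChartAt 𝓘(ℝ, E) x =ᶠ[𝓝 x] extChartAt 𝓘(ℝ, E') (f x) ∘ f := by
    filter_upwards [extChartAt_source_mem_nhds (I := 𝓘(ℝ, E)) x] with z hz
    simp only [hFdef, comp_apply]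
    rw [(extChartAt 𝓘(ℝ, E) x).left_inv hz]
  have hd := hev.mfderiv_eq (I := 𝓘(ℝ, E)) (I' := 𝓘(ℝ, E'))
  rw [mfderiv_comp x hs he, mfderiv_comp x he' hfx, hc] at hd
  ext v
  simp only [Form.pullback, ContinuousAlternatingMap.compContinuousLinearMap_apply]
  refine congrArg (extDeriv (α.inChart (f x)) (extChartAt 𝓘(ℝ, E') (f x) (f x)))
    (funext fun i => ?_)
  exact DFunLike.congr_fun hd (v i)

end charts

/-- On a vector space, forms coincide with their coordinate expressions. -/
lemma inChart_self (α : Form E E k V) (u : E) : α.inChart u = α := by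
  funext w
  ext v
  simp only [inChart]
  have : ((extChartAt 𝓘(ℝ, E) u).symm : E → E) = id := by
    funext z; simp [chartAt_self_eq]
  rw [this, mfderiv_id]
  rfl

lemma d_self (α : Form E E k V) (u : E) : α.d u = extDeriv (fun w => (α w : E [⋀^Fin k]→L[ℝ] V)) u := by
  have h : ((extChartAt 𝓘(ℝ, E) u) : E → E) = id := by
    funext z; simp [chartAt_self_eq]
  simp only [d]
  rw [inChart_self, h, mfderiv_id]
  rfl

section charts

variable [IsManifold 𝓘(ℝ, E) ∞ X] [IsManifold 𝓘(ℝ, E') ∞ X']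

/-- The exterior derivative in a chart around `x` is computed in that chart at all nearby points. -/
lemma inChart_d {α : Form E X k V} {U : Set X} (hα : α.SmoothOn U) {x : X} (hU : U ∈ 𝓝 x) :
    α.d.inChart x =ᶠ[𝓝 (extChartAt 𝓘(ℝ, E) x x)] extDeriv (α.inChart x) := by
  filter_upwards [eventually_target (E := E) x, eventually_symm (E := E) x hU] with u h1 h2
  have hs : ContMDiffAt 𝓘(ℝ, E) 𝓘(ℝ, E) ∞ (extChartAt 𝓘(ℝ, E) x).symm u :=
    (contMDiffOn_extChartAt_symm (n := ∞) x).contMDiffAt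
      ((isOpen_extChartAt_target x).mem_nhds h1)
  -- `α.inChart x` is by definition the pullback of `α` along the inverse chart, a smooth map out of
  -- a vector space. Naturality therefore removes the dependence of `α.d` on the preferred chart of
  -- the nearby point.
  have := d_pullback (E := E) (α := α) (hα _ h2) hs
  rw [d_self] at this
  exact this.symm

lemma SmoothOn.d {α : Form E X k V} {U : Set X} (hα : α.SmoothOn U) (hU : IsOpen U) :
    α.d.SmoothOn U := by
  intro x hx
  refine ContDiffAt.congr_of_eventuallyEq ?_ (inChart_d hα (hU.mem_nhds hx))
  have h1 : ContDiffAt ℝ ∞ (fderiv ℝ (α.inChart x)) (extChartAt 𝓘(ℝ, E) x x) :=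
    (hα x hx).fderiv_right (by simp)
  exact (ContinuousAlternatingMap.alternatizeUncurryFinCLM ℝ E V).contDiff.contDiffAt.comp _ h1

/-- By `inChart_d` both derivatives may be taken in the one chart around `x`, where `extDeriv`
squares to zero. -/
lemma d_d {α : Form E X k V} {U : Set X} (hα : α.SmoothOn U) {x : X} (hU : U ∈ 𝓝 x) :
    α.d.d x = 0 := by
  have h := (inChart_d hα hU).extDeriv_eq
  rw [extDeriv_extDeriv_apply (hα x (mem_of_mem_nhds hU))
    two_le_minSmoothness] at h
  have h2 : α.d.d x = (extDeriv (α.d.inChart x) (extChartAt 𝓘(ℝ, E) x x)).compContinuousLinearMap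
    (mfderiv 𝓘(ℝ, E) 𝓘(ℝ, E) (extChartAt 𝓘(ℝ, E) x) x) := rfl
  rw [h2, h]
  rfl

end charts

end Form

/-! ### Wedge products, Leibniz rule and logarithmic derivatives -/

namespace Form

variable {E : Type*} [NormedAddCommGroup E] [NormedSpace ℝ E]
  {X : Type*} [TopologicalSpace X] [ChartedSpace E X]
  {E' : Type*} [NormedAddCommGroup E'] [NormedSpace ℝ E']
  {X' : Type*} [TopologicalSpace X'] [ChartedSpace E' X']
  {V : Type*} [NormedAddCommGroup V] [NormedSpace ℝ V]
  {W : Type*} [NormedAddCommGroup W] [NormedSpace ℝ W] {k : ℕ}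

lemma wedgeAlt_apply (a : E [⋀^Fin 1]→L[ℝ] ℂ) (b : E [⋀^Fin k]→L[ℝ] ℂ) (v : Fin (k + 1) → E) :
    wedgeAlt a b v = ∑ i : Fin (k + 1), (-1 : ℤ) ^ (i : ℕ) • (a (fun _ => v i) * b (i.removeNth v)) := by
  simp only [wedgeAlt, ContinuousAlternatingMap.alternatizeUncurryFin_apply]
  rfl

lemma wedgeAlt_comp (a : E' [⋀^Fin 1]→L[ℝ] ℂ) (b : E' [⋀^Fin k]→L[ℝ] ℂ) (A : E →L[ℝ] E') :
    (wedgeAlt a b).compContinuousLinearMap A =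
      wedgeAlt (a.compContinuousLinearMap A) (b.compContinuousLinearMap A) := by
  ext v
  simp only [wedgeAlt_apply, ContinuousAlternatingMap.compContinuousLinearMap_apply]
  rfl

lemma wedgeAlt_smul_left (c : ℂ) (a : E [⋀^Fin 1]→L[ℝ] ℂ) (b : E [⋀^Fin k]→L[ℝ] ℂ) :
    wedgeAlt (c • a) b = c • wedgeAlt a b := by
  ext v
  rw [ContinuousAlternatingMap.smul_apply, wedgeAlt_apply, wedgeAlt_apply, Finset.smul_sum]
  simp only [ContinuousAlternatingMap.smul_apply, smul_eq_mul, zsmul_eq_mul]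
  exact Finset.sum_congr rfl fun i _ => by ring

lemma wedge_smul_left (c : ℂ) (a : Form E X 1 ℂ) (b : Form E X k ℂ) :
    wedge (c • a) b = c • wedge a b := by
  funext x
  exact wedgeAlt_smul_left (E := E) c (a x) (b x)

lemma pullback_wedge (f : X → X') (a : Form E' X' 1 ℂ) (b : Form E' X' k ℂ) :
    pullback (E := E) f (wedge a b) = wedge (pullback f a) (pullback f b) := by
  funext x
  exact wedgeAlt_comp (E := E) (E' := E') (a (f x)) (b (f x)) (mfderiv 𝓘(ℝ, E) 𝓘(ℝ, E') f x)

/-- Pointwise the wedge is a fixed continuous bilinear operation: one-forms are identified with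
linear functionals, and the product with `b` is alternatized. As it commutes with precomposition by
the tangent map of the chart, the same formula holds in coordinates. -/
lemma SmoothAt.wedge {a : Form E X 1 ℂ} {b : Form E X k ℂ} {x : X} (ha : a.SmoothAt x)
    (hb : b.SmoothAt x) : (Form.wedge a b).SmoothAt x := by
  have h1 := ((ContinuousAlternatingMap.ofSubsingletonLIE
    (𝕜 := ℝ) (E := E) (F := ℂ) (0 : Fin 1)).symm.contDiff (n := ∞)).contDiffAt.comp _ ha
  have h2 : ContDiffAt ℝ ∞ (fun u => (ContinuousLinearMap.lsmul ℝ ℂ).flip (b.inChart x u))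
      (extChartAt 𝓘(ℝ, E) x x) :=
    ContDiffAt.comp (g := ((ContinuousLinearMap.lsmul ℝ ℂ).flip :
      (E [⋀^Fin k]→L[ℝ] ℂ) →L[ℝ] ℂ →L[ℝ] (E [⋀^Fin k]→L[ℝ] ℂ))) _
      (ContinuousLinearMap.contDiff _).contDiffAt hb
  have h3 := (ContinuousAlternatingMap.alternatizeUncurryFinCLM ℝ E ℂ (n := k)).contDiff.contDiffAt.comp
    _ (h2.clm_comp h1)
  refine h3.congr_of_eventuallyEq (Filter.Eventually.of_forall fun u => ?_)
  exact wedgeAlt_comp (E := E) (E' := E) _ _ _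

lemma SmoothAt.const_smul {a : Form E X k ℂ} {x : X} (ha : a.SmoothAt x) (c : ℂ) :
    SmoothAt (c • a) x := ContDiffAt.const_smul c ha

lemma SmoothAt.sum {ι : Type*} {s : Finset ι} {α : ι → Form E X k V} {x : X}
    (hα : ∀ i ∈ s, (α i).SmoothAt x) : SmoothAt (∑ i ∈ s, α i) x :=
  -- `SmoothOn` is a pointwise condition and asks for no openness, so on the singleton `{x}` it is
  -- smoothness at `x`.
  SmoothOn.sum (U := {x}) (fun i hi z hz => by rw [mem_singleton_iff.1 hz]; exact hα i hi) x rfl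

lemma SmoothAt.add {α β : Form E X k V} {x : X} (hα : α.SmoothAt x) (hβ : β.SmoothAt x) :
    SmoothAt (α + β) x := ContDiffAt.add hα hβ

lemma d_add {α β : Form E X k V} {x : X} (hα : α.SmoothAt x) (hβ : β.SmoothAt x) :
    (α + β).d x = α.d x + β.d x := by
  have h : (α + β).inChart x = α.inChart x + β.inChart x := rfl
  simp only [d]
  rw [h, extDeriv_add hα.differentiableAt hβ.differentiableAt]
  rfl

lemma d_zero (x : X) : (0 : Form E X k V).d x = 0 := by
  have h : inChart (0 : Form E X k V) x = fun _ => 0 := by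
    funext u; ext v; rfl
  simp only [d]
  rw [h]
  have h2 : extDeriv (fun _ : E => (0 : E [⋀^Fin k]→L[ℝ] V)) (extChartAt 𝓘(ℝ, E) x x) = 0 := by
    ext v
    rw [extDeriv_apply (differentiableAt_const _)]
    simp
  rw [h2]
  rfl

lemma d_sum {ι : Type*} {s : Finset ι} {α : ι → Form E X k V} {x : X}
    (hα : ∀ i ∈ s, (α i).SmoothAt x) : (∑ i ∈ s, α i).d x = ∑ i ∈ s, (α i).d x := by
  classical
  induction s using Finset.induction_on with
  | empty => exact d_zero x
  | insert a s ha ih =>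
    rw [Finset.sum_insert ha, Finset.sum_insert ha, d_add (hα a (by simp))
      (SmoothAt.sum fun i hi => hα i (by simp [hi])), ih fun i hi => hα i (by simp [hi])]

/-- A form multiplied by a real function. -/
def fsmul (φ : X → ℝ) (α : Form E X k V) : Form E X k V := fun x => φ x • α x

/-- Apply a continuous linear map to the values of a form. -/
def map (A : V →L[ℝ] W) (α : Form E X k V) : Form E X k W := fun x =>
  A.compContinuousAlternatingMap (α x)

lemma pullback_map (A : V →L[ℝ] W) (f : X → X') (α : Form E' X' k V) :
    pullback (E := E) f (α.map A) = (pullback f α).map A := rfl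

lemma SmoothAt.map {α : Form E X k V} {x : X} (hα : α.SmoothAt x) (A : V →L[ℝ] W) :
    (α.map A).SmoothAt x :=
  (ContinuousLinearMap.compContinuousAlternatingMapCLM ℝ E (ι := Fin k) V W A).contDiff.contDiffAt.comp _ hα

lemma alternatizeUncurryFin_comp (A : V →L[ℝ] W) (B : E →L[ℝ] E [⋀^Fin k]→L[ℝ] V) :
    ContinuousAlternatingMap.alternatizeUncurryFin
      ((ContinuousLinearMap.compContinuousAlternatingMapCLM ℝ E (ι := Fin k) V W A).comp B) =
    A.compContinuousAlternatingMap (ContinuousAlternatingMap.alternatizeUncurryFin B) := by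
  ext v
  simp only [ContinuousLinearMap.compContinuousAlternatingMap_coe, comp_apply,
    ContinuousAlternatingMap.alternatizeUncurryFin_apply, map_sum, map_zsmul]
  rfl

/-- When `φ • α` is differentiated in a chart, the term falling on `φ` is `p.smulRight b`, with `p`
the derivative of `φ` and `b` the value of the form. Its alternatization is the wedge term of the
Leibniz rule. -/
lemma alternatizeUncurryFin_smulRight (p : E →L[ℝ] ℝ) (b : E [⋀^Fin k]→L[ℝ] ℂ) :
    ContinuousAlternatingMap.alternatizeUncurryFin (p.smulRight b) =
      wedgeAlt (ContinuousAlternatingMap.ofSubsingleton ℝ E ℂ (0 : Fin 1)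
        (Complex.ofRealCLM.comp p)) b := by
  ext v
  rw [wedgeAlt_apply, ContinuousAlternatingMap.alternatizeUncurryFin_apply]
  rfl

/-- A constant linear map on the values commutes with differentiation and with alternatization. It
is used for the real part and for `imDivTwoPi`, to pass between complex and real forms. -/
lemma d_map {α : Form E X k V} {x : X} (hα : α.SmoothAt x) (A : V →L[ℝ] W) :
    (α.map A).d x = α.d.map A x := by
  have h : fderiv ℝ ((α.map A).inChart x) (extChartAt 𝓘(ℝ, E) x x) =
      (ContinuousLinearMap.compContinuousAlternatingMapCLM ℝ E (ι := Fin k) V W A).comp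
        (fderiv ℝ (α.inChart x) (extChartAt 𝓘(ℝ, E) x x)) :=
    ((ContinuousLinearMap.compContinuousAlternatingMapCLM ℝ E (ι := Fin k) V W A).hasFDerivAt.comp
      _ hα.differentiableAt.hasFDerivAt).fderiv
  simp only [d, extDeriv]
  rw [h, alternatizeUncurryFin_comp]
  rfl

section functions

variable [IsManifold 𝓘(ℝ, E) ∞ X]

lemma mfderiv_extChartAt_symm_comp (x : X) (v : TangentSpace 𝓘(ℝ, E) x) :
    mfderiv 𝓘(ℝ, E) 𝓘(ℝ, E) (extChartAt 𝓘(ℝ, E) x).symm (extChartAt 𝓘(ℝ, E) x x)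
      (mfderiv 𝓘(ℝ, E) 𝓘(ℝ, E) (extChartAt 𝓘(ℝ, E) x) x v) = v := by
  have : IsManifold 𝓘(ℝ, E) 1 X := IsManifold.of_le (n := ∞) (by exact_mod_cast le_top)
  have h := mfderivWithin_extChartAt_symm_comp_mfderiv_extChartAt' (I := 𝓘(ℝ, E))
    (mem_extChartAt_source (I := 𝓘(ℝ, E)) x)
  rw [modelWithCornersSelf_coe, range_id, mfderivWithin_univ] at h
  exact DFunLike.congr_fun h v

lemma mfderiv_eq_fderiv_chart {f : X → V} {x : X} (hf : ContMDiffAt 𝓘(ℝ, E) 𝓘(ℝ, V) ∞ f x)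
    (v : TangentSpace 𝓘(ℝ, E) x) :
    fderiv ℝ (f ∘ (extChartAt 𝓘(ℝ, E) x).symm) (extChartAt 𝓘(ℝ, E) x x)
      (mfderiv 𝓘(ℝ, E) 𝓘(ℝ, E) (extChartAt 𝓘(ℝ, E) x) x v) = mfderiv 𝓘(ℝ, E) 𝓘(ℝ, V) f x v := by
  have hF : ContDiffAt ℝ ∞ (f ∘ (extChartAt 𝓘(ℝ, E) x).symm) (extChartAt 𝓘(ℝ, E) x x) :=
    contDiffAt_writtenInExtChartAt hf
  have hs : MDifferentiableAt 𝓘(ℝ, E) 𝓘(ℝ, V) (f ∘ (extChartAt 𝓘(ℝ, E) x).symm)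
      (extChartAt 𝓘(ℝ, E) x x) := (hF.differentiableAt (by simp)).mdifferentiableAt
  have he : MDifferentiableAt 𝓘(ℝ, E) 𝓘(ℝ, E) (extChartAt 𝓘(ℝ, E) x) x :=
    (contMDiffAt_extChartAt (n := ∞)).mdifferentiableAt (by simp)
  have hev : (f ∘ (extChartAt 𝓘(ℝ, E) x).symm) ∘ extChartAt 𝓘(ℝ, E) x =ᶠ[𝓝 x] f := by
    filter_upwards [extChartAt_source_mem_nhds (I := 𝓘(ℝ, E)) x] with z hz
    simp only [comp_apply]
    rw [(extChartAt 𝓘(ℝ, E) x).left_inv hz]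
  have hd := hev.mfderiv_eq (I := 𝓘(ℝ, E)) (I' := 𝓘(ℝ, V))
  rw [mfderiv_comp x hs he, mfderiv_eq_fderiv] at hd
  exact DFunLike.congr_fun hd v

lemma inChart_fsmul (φ : X → ℝ) (α : Form E X k V) (x : X) : (fsmul φ α).inChart x =
    fun u => (φ ∘ (extChartAt 𝓘(ℝ, E) x).symm) u • α.inChart x u := rfl

lemma SmoothAt.fsmul {φ : X → ℝ} {α : Form E X k V} {x : X}
    (hφ : ContMDiffAt 𝓘(ℝ, E) 𝓘(ℝ, ℝ) ∞ φ x) (hα : α.SmoothAt x) : (Form.fsmul φ α).SmoothAt x :=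
  (contDiffAt_writtenInExtChartAt hφ).smul hα

/-- The Leibniz rule for the product of a function and a form. -/
lemma d_fsmul {φ : X → ℝ} {α : Form E X k ℂ} {x : X}
    (hφ : ContMDiffAt 𝓘(ℝ, E) 𝓘(ℝ, ℝ) ∞ φ x) (hα : α.SmoothAt x) :
    (fsmul φ α).d x = wedge (map Complex.ofRealCLM (dFun φ)) α x + φ x • α.d x := by
  have hF : ContDiffAt ℝ ∞ (φ ∘ (extChartAt 𝓘(ℝ, E) x).symm) (extChartAt 𝓘(ℝ, E) x x) :=
    contDiffAt_writtenInExtChartAt hφ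
  have h1 := fderiv_fun_smul (hF.differentiableAt (by simp)) hα.differentiableAt
  set A : E →L[ℝ] E := mfderiv 𝓘(ℝ, E) 𝓘(ℝ, E) (extChartAt 𝓘(ℝ, E) x) x with hA
  set p : E →L[ℝ] ℝ := fderiv ℝ (φ ∘ (extChartAt 𝓘(ℝ, E) x).symm) (extChartAt 𝓘(ℝ, E) x x) with hp
  set D : E →L[ℝ] E [⋀^Fin k]→L[ℝ] ℂ := fderiv ℝ (α.inChart x) (extChartAt 𝓘(ℝ, E) x x) with hD
  set b : E [⋀^Fin k]→L[ℝ] ℂ := α.inChart x (extChartAt 𝓘(ℝ, E) x x) with hb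
  -- Carried back to the tangent space by `A`, the coordinate differential of `φ` becomes `dφ`
  -- (`e1`) and the coordinate form becomes `α x` (`e2`); `e3` is the alternatized product rule.
  have e1 : (ContinuousAlternatingMap.ofSubsingleton ℝ E ℂ (0 : Fin 1)
      (Complex.ofRealCLM.comp p)).compContinuousLinearMap A =
      map Complex.ofRealCLM (dFun (E := E) φ) x := by
    ext v
    exact congrArg Complex.ofReal (mfderiv_eq_fderiv_chart hφ (v 0))
  have e2 : b.compContinuousLinearMap A = α x := by
    ext v
    simp only [hb, inChart, ContinuousAlternatingMap.compContinuousLinearMap_apply]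
    rw [extChartAt_to_inv]
    exact congrArg (α x) (funext fun j => mfderiv_extChartAt_symm_comp x _)
  have e3 : (ContinuousAlternatingMap.alternatizeUncurryFin
      (φ x • D + p.smulRight b)).compContinuousLinearMap A =
      wedgeAlt ((ContinuousAlternatingMap.ofSubsingleton ℝ E ℂ (0 : Fin 1)
        (Complex.ofRealCLM.comp p)).compContinuousLinearMap A) (b.compContinuousLinearMap A) +
      φ x • (ContinuousAlternatingMap.alternatizeUncurryFin D).compContinuousLinearMap A := by
    rw [ContinuousAlternatingMap.alternatizeUncurryFin_add,
      ContinuousAlternatingMap.alternatizeUncurryFin_smul, alternatizeUncurryFin_smulRight,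
      ← wedgeAlt_comp]
    refine Eq.trans ?_ (add_comm _ _)
    rfl
  simp only [d, extDeriv]
  rw [inChart_fsmul, h1, comp_apply, extChartAt_to_inv]
  refine e3.trans ?_
  rw [e2]
  exact congrArg (fun a => wedgeAlt (E := E) a (α x) + φ x •
    (ContinuousAlternatingMap.alternatizeUncurryFin D).compContinuousLinearMap A) e1

/-- A function as a form of degree zero. -/
def ofFun (f : X → V) : Form E X 0 V := fun x =>
  (ContinuousAlternatingMap.constOfIsEmpty ℝ E (Fin 0) (f x) : E [⋀^Fin 0]→L[ℝ] V)

lemma inChart_ofFun (f : X → V) (x : X) : (ofFun f).inChart x = fun u =>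
    ContinuousAlternatingMap.constOfIsEmpty ℝ E (Fin 0) ((f ∘ (extChartAt 𝓘(ℝ, E) x).symm) u) := rfl

lemma SmoothAt.ofFun {f : X → V} {x : X} (hf : ContMDiffAt 𝓘(ℝ, E) 𝓘(ℝ, V) ∞ f x) :
    (Form.ofFun (E := E) f).SmoothAt x :=
  (ContinuousAlternatingMap.constOfIsEmptyLIE ℝ E V (Fin 0)).contDiff.contDiffAt.comp _
    (contDiffAt_writtenInExtChartAt hf)

/-- Exhibits `dFun f` as the exterior derivative of a form of degree zero, so that its smoothness
and closedness are instances of the general facts on `d`. -/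
lemma d_ofFun {f : X → V} {x : X} (hf : ContMDiffAt 𝓘(ℝ, E) 𝓘(ℝ, V) ∞ f x) :
    (ofFun (E := E) f).d x = dFun f x := by
  simp only [d]
  rw [inChart_ofFun, extDeriv_constOfIsEmpty]
  ext v
  exact mfderiv_eq_fderiv_chart hf (v 0)

lemma smoothOn_dFun {f : X → V} {U : Set X} (hU : IsOpen U)
    (hf : ContMDiffOn 𝓘(ℝ, E) 𝓘(ℝ, V) ∞ f U) : (dFun (E := E) f).SmoothOn U := by
  have h : (ofFun (E := E) f).SmoothOn U := fun x hx =>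
    SmoothAt.ofFun (hf.contMDiffAt (hU.mem_nhds hx))
  intro x hx
  refine SmoothAt.congr (h.d hU x hx) ?_
  filter_upwards [hU.mem_nhds hx] with z hz
  exact (d_ofFun (hf.contMDiffAt (hU.mem_nhds hz))).symm

lemma d_dFun {f : X → V} {U : Set X} (hU : IsOpen U)
    (hf : ContMDiffOn 𝓘(ℝ, E) 𝓘(ℝ, V) ∞ f U) {x : X} (hx : x ∈ U) : (dFun (E := E) f).d x = 0 := by
  have h : (ofFun (E := E) f).SmoothOn U := fun x hx =>
    SmoothAt.ofFun (hf.contMDiffAt (hU.mem_nhds hx))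
  rw [← d_d h (hU.mem_nhds hx)]
  refine d_congr ?_
  filter_upwards [hU.mem_nhds hx] with z hz
  exact (d_ofFun (hf.contMDiffAt (hU.mem_nhds hz))).symm

lemma dLog_exp {l : X → ℂ} {x : X} (hl : MDifferentiableAt 𝓘(ℝ, E) 𝓘(ℝ, ℂ) l x) :
    dLog (E := E) (fun z => Complex.exp (l z)) x = dFun l x := by
  have h1 : HasFDerivAt Complex.exp (Complex.exp (l x) • (1 : ℂ →L[ℝ] ℂ)) (l x) :=
    ((Complex.hasStrictFDerivAt_exp_real (l x)).hasFDerivAt)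
  have h2 := (h1.hasMFDerivAt.comp x hl.hasMFDerivAt).mfderiv
  ext v
  have h3 : mfderiv 𝓘(ℝ, E) 𝓘(ℝ, ℂ) (fun z => Complex.exp (l z)) x (v 0) =
    Complex.exp (l x) * (show ℂ from mfderiv 𝓘(ℝ, E) 𝓘(ℝ, ℂ) l x (v 0)) := DFunLike.congr_fun h2 (v 0)
  change (Complex.exp (l x))⁻¹ * (show ℂ from mfderiv 𝓘(ℝ, E) 𝓘(ℝ, ℂ) (fun z => Complex.exp (l z)) x (v 0)) =
    (show ℂ from mfderiv 𝓘(ℝ, E) 𝓘(ℝ, ℂ) l x (v 0))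
  rw [h3, ← mul_assoc, inv_mul_cancel₀ (Complex.exp_ne_zero _), one_mul]

/-- A nowhere vanishing function has local logarithms. -/
lemma exists_local_log {t : X → ℂ} {U : Set X} (hU : IsOpen U)
    (ht : ContMDiffOn 𝓘(ℝ, E) 𝓘(ℝ, ℂ) ∞ t U) (h0 : ∀ x ∈ U, t x ≠ 0) {x : X} (hx : x ∈ U) :
    ∃ (N : Set X) (l : X → ℂ), IsOpen N ∧ x ∈ N ∧ N ⊆ U ∧ ContMDiffOn 𝓘(ℝ, E) 𝓘(ℝ, ℂ) ∞ l N ∧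
      ∀ z ∈ N, Complex.exp (l z) = t z := by
  have hc : ContMDiffOn 𝓘(ℝ, E) 𝓘(ℝ, ℂ) ∞ (fun z => (t x)⁻¹ * t z) U :=
    (contDiff_const.mul contDiff_id : ContDiff ℝ ∞ fun w : ℂ => (t x)⁻¹ * w).contMDiff.comp_contMDiffOn ht
  -- Division by `t x` moves the value at `x` to `1`, away from the branch cut, so the principal
  -- logarithm is smooth near `x`; adding `log (t x)` undoes the division.
  refine ⟨U ∩ (fun z => (t x)⁻¹ * t z) ⁻¹' Complex.slitPlane,
    fun z => Complex.log (t x) + Complex.log ((t x)⁻¹ * t z),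
    hc.continuousOn.isOpen_inter_preimage hU Complex.isOpen_slitPlane,
    ⟨hx, by simp [inv_mul_cancel₀ (h0 x hx)]⟩, inter_subset_left, ?_, ?_⟩
  · intro z hz
    have h1 : ContDiffAt ℝ ∞ (fun w => Complex.log (t x) + Complex.log w) ((t x)⁻¹ * t z) :=
      contDiffAt_const.add ((Complex.contDiffAt_log hz.2).restrict_scalars ℝ)
    exact ContMDiffAt.comp_contMDiffWithinAt (g := fun w => Complex.log (t x) + Complex.log w) z
      h1.contMDiffAt ((hc z hz.1).mono inter_subset_left)
  · intro z hz
    rw [Complex.exp_add, Complex.exp_log (h0 x hx), Complex.exp_log (Complex.slitPlane_ne_zero hz.2),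
      mul_inv_cancel_left₀ (h0 x hx)]

/-- If `t = exp l` locally then `t⁻¹ dt = dl`. Smoothness and closedness of logarithmic derivatives
are local, so they reduce to those of differentials even where `t` has no global logarithm. -/
lemma dLog_eventuallyEq_dFun {t : X → ℂ} {U : Set X} (hU : IsOpen U)
    (ht : ContMDiffOn 𝓘(ℝ, E) 𝓘(ℝ, ℂ) ∞ t U) (h0 : ∀ x ∈ U, t x ≠ 0) {x : X} (hx : x ∈ U) :
    ∃ (N : Set X) (l : X → ℂ), IsOpen N ∧ x ∈ N ∧ ContMDiffOn 𝓘(ℝ, E) 𝓘(ℝ, ℂ) ∞ l N ∧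
      ∀ z ∈ N, dLog (E := E) t z = dFun l z := by
  obtain ⟨N, l, hN, hxN, -, hl, he⟩ := exists_local_log hU ht h0 hx
  refine ⟨N, l, hN, hxN, hl, fun z hz => ?_⟩
  rw [← dLog_exp ((hl.contMDiffAt (hN.mem_nhds hz)).mdifferentiableAt (by simp))]
  refine dLog_congr ?_
  filter_upwards [hN.mem_nhds hz] with w hw
  exact (he w hw).symm

lemma smoothOn_dLog {t : X → ℂ} {U : Set X} (hU : IsOpen U)
    (ht : ContMDiffOn 𝓘(ℝ, E) 𝓘(ℝ, ℂ) ∞ t U) (h0 : ∀ x ∈ U, t x ≠ 0) :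
    (dLog (E := E) t).SmoothOn U := by
  intro x hx
  obtain ⟨N, l, hN, hxN, hl, he⟩ := dLog_eventuallyEq_dFun hU ht h0 hx
  exact SmoothAt.congr (smoothOn_dFun hN hl x hxN) (Filter.eventually_of_mem (hN.mem_nhds hxN) he)

lemma d_dLog {t : X → ℂ} {U : Set X} (hU : IsOpen U)
    (ht : ContMDiffOn 𝓘(ℝ, E) 𝓘(ℝ, ℂ) ∞ t U) (h0 : ∀ x ∈ U, t x ≠ 0) {x : X} (hx : x ∈ U) :
    (dLog (E := E) t).d x = 0 := by
  obtain ⟨N, l, hN, hxN, hl, he⟩ := dLog_eventuallyEq_dFun hU ht h0 hx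
  rw [← d_dFun hN hl hxN]
  exact d_congr (Filter.eventually_of_mem (hN.mem_nhds hxN) he)

end functions

end Form

/-! ### Locally constant factors, imaginary values, locality of pullback -/

namespace Form

variable {E : Type*} [NormedAddCommGroup E] [NormedSpace ℝ E]
  {X : Type*} [TopologicalSpace X] [ChartedSpace E X]
  {E' : Type*} [NormedAddCommGroup E'] [NormedSpace ℝ E']
  {X' : Type*} [TopologicalSpace X'] [ChartedSpace E' X']
  {V : Type*} [NormedAddCommGroup V] [NormedSpace ℝ V] {k : ℕ}

lemma d_const_smul (c : ℝ) (α : Form E X k V) (x : X) : (c • α).d x = c • α.d x := by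
  have h : (c • α).inChart x = c • α.inChart x := rfl
  simp only [d]
  rw [h, extDeriv_smul]
  rfl

lemma d_locallyConstant_smul {h : X → ℤ} (hh : IsLocallyConstant h) (α : Form E X k V) (x : X) :
    Form.d (fun z => (h z : ℝ) • α z) x = (h x : ℝ) • α.d x := by
  rw [← d_const_smul]
  refine d_congr ?_
  filter_upwards [(hh.isOpen_fiber (h x)).mem_nhds rfl] with z hz
  have hz' : h z = h x := hz
  rw [hz']
  rfl

lemma imaginary_iff_map_re {α : Form E X k ℂ} {x : X} :
    (∀ v, (α x v).re = 0) ↔ α.map Complex.reCLM x = 0 := by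
  constructor
  · intro h
    ext v
    exact h v
  · intro h v
    exact DFunLike.congr_fun h v

/-- The real part is a real linear map on the values, so it commutes with `d`, and the real part of
`α` vanishes near `x`. -/
lemma imaginary_d {α : Form E X k ℂ} {x : X} (hs : α.SmoothAt x)
    (h : ∀ᶠ z in 𝓝 x, ∀ v, (α z v).re = 0) (v : Fin (k + 1) → TangentSpace 𝓘(ℝ, E) x) :
    (α.d x v).re = 0 := by
  revert v
  rw [imaginary_iff_map_re, ← d_map hs, ← d_zero (E := E) (k := k) (V := ℝ) x]
  refine d_congr ?_
  filter_upwards [h] with z hz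
  exact imaginary_iff_map_re.1 hz

lemma pullback_sum {ι : Type*} (s : Finset ι) (f : X → X') (α : ι → Form E' X' k V) (x : X) :
    pullback (E := E) f (∑ i ∈ s, α i) x = ∑ i ∈ s, pullback f (α i) x := by
  ext v
  simp only [pullback, Finset.sum_apply, ContinuousAlternatingMap.sum_apply,
    ContinuousAlternatingMap.compContinuousLinearMap_apply]

lemma pullback_congr {f g : X → X'} (α : Form E' X' k V) {x : X} (h : f =ᶠ[𝓝 x] g) :
    pullback (E := E) f α x = pullback g α x := by
  have h1 := h.eq_of_nhds
  have h2 := h.mfderiv_eq (I := 𝓘(ℝ, E)) (I' := 𝓘(ℝ, E'))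
  ext v
  simp only [pullback, ContinuousAlternatingMap.compContinuousLinearMap_apply]
  rw [h2, h1]

lemma pullback_eq_self {f : X → X} {x : X} (α : Form E X k V) (h : f =ᶠ[𝓝 x] id) :
    pullback (E := E) f α x = α x := by
  rw [pullback_congr α h]
  ext v
  simp only [pullback, ContinuousAlternatingMap.compContinuousLinearMap_apply, id, mfderiv_id]
  rfl

end Form

/-! ### Curvature of Hermitian connections -/

namespace HermLineBundle.Connection

variable {E : Type*} [NormedAddCommGroup E] [NormedSpace ℝ E]
  {X : Type*} [TopologicalSpace X] [ChartedSpace E X] [IsManifold 𝓘(ℝ, E) ∞ X]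
  {E' : Type*} [NormedAddCommGroup E'] [NormedSpace ℝ E']
  {X' : Type*} [TopologicalSpace X'] [ChartedSpace E' X'] [IsManifold 𝓘(ℝ, E') ∞ X']
  {L : HermLineBundle.{v} E X}

lemma mem_idxAt (L : HermLineBundle.{v} E X) (x : X) : x ∈ L.dom (L.idxAt x) :=
  (L.exists_mem_dom x).choose_spec

/-- The curvature is `dA_k` in any frame around the point. -/
lemma curvature_eq (nabla : L.Connection) {k : L.Idx} {x : X} (hx : x ∈ L.dom k) :
    nabla.curvature x = (nabla.form k).d x := by
  set l := L.idxAt x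
  have hxl : x ∈ L.dom l := mem_idxAt L x
  have h0 : ∀ z ∈ L.dom l ∩ L.dom k, L.trans l k z ≠ 0 := fun z hz => L.trans_ne_zero hz
  have hO := L.isOpen_inter l k
  -- The connection forms of two frames differ by the logarithmic derivative of the transition
  -- function, which is closed.
  have h : (nabla.form k).d x = (nabla.form l + Form.dLog (L.trans l k)).d x := by
    refine Form.d_congr ?_
    filter_upwards [hO.mem_nhds ⟨hxl, hx⟩] with z hz
    exact nabla.compat l k z hz
  rw [h, Form.d_add (nabla.smooth l x hxl)
    (Form.smoothOn_dLog hO (L.trans_smooth l k) h0 x ⟨hxl, hx⟩),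
    Form.d_dLog hO (L.trans_smooth l k) h0 ⟨hxl, hx⟩, add_zero]
  rfl

/-- The definition of the curvature selects a frame anew at every point. By `curvature_eq` the frame
selected at `x` may be kept near `x`, which exhibits the curvature there as one exterior derivative.
-/
lemma curvature_smooth (nabla : L.Connection) : nabla.curvature.Smooth := by
  intro x _
  have hx := mem_idxAt L x
  have hO := L.isOpen_dom (L.idxAt x)
  refine Form.SmoothAt.congr ((nabla.smooth (L.idxAt x)).d hO x hx) ?_
  filter_upwards [hO.mem_nhds hx] with z hz
  exact nabla.curvature_eq hz

lemma d_curvature (nabla : L.Connection) : nabla.curvature.d = 0 := by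
  funext x
  have hx := mem_idxAt L x
  have hO := L.isOpen_dom (L.idxAt x)
  have h : nabla.curvature.d x = (nabla.form (L.idxAt x)).d.d x := by
    refine Form.d_congr ?_
    filter_upwards [hO.mem_nhds hx] with z hz
    exact nabla.curvature_eq hz
  exact h.trans (Form.d_d (nabla.smooth (L.idxAt x)) (hO.mem_nhds hx))

lemma curvature_imaginary (nabla : L.Connection) : nabla.curvature.ImaginaryOn univ := by
  intro x _ v
  have hx := mem_idxAt L x
  exact Form.imaginary_d (nabla.smooth (L.idxAt x) x hx)
    (Filter.eventually_of_mem ((L.isOpen_dom (L.idxAt x)).mem_nhds hx)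
      fun z hz => nabla.imaginary _ z hz) v

lemma curvature_pullback {L : HermLineBundle.{v} E' X'} (nabla : L.Connection) (f : X → X')
    (hf : ContMDiff 𝓘(ℝ, E) 𝓘(ℝ, E') ∞ f) :
    (nabla.pullback f hf).curvature = Form.pullback f nabla.curvature := by
  funext x
  have hx := mem_idxAt L (f x)
  have h1 : (nabla.pullback f hf).curvature x =
      (Form.pullback (E := E) f (nabla.form (L.idxAt (f x)))).d x :=
    curvature_eq (nabla.pullback f hf) (k := L.idxAt (f x)) hx
  have h2 : Form.pullback (E := E) f nabla.curvature x =
      Form.pullback f (nabla.form (L.idxAt (f x))).d x := by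
    simp only [Form.pullback]
    rw [nabla.curvature_eq hx]
  rw [h1, h2]
  exact Form.d_pullback (nabla.smooth _ _ hx) (hf x)

lemma curvature_zpow (nabla : L.Connection) (h : X → ℤ) (hh : IsLocallyConstant h) (x : X) :
    (nabla.zpow h hh).curvature x = (h x : ℝ) • nabla.curvature x := by
  have hx := mem_idxAt L x
  rw [curvature_eq (nabla.zpow h hh) (k := L.idxAt x) hx, nabla.curvature_eq hx]
  exact Form.d_locallyConstant_smul hh _ x

lemma curvature_tensor {n : ℕ} {K : Fin n → HermLineBundle.{v} E X}
    (nabla : ∀ i, (K i).Connection) :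
    (HermLineBundle.Connection.tensor nabla).curvature = ∑ i, (nabla i).curvature := by
  funext x
  have hx : ∀ i, x ∈ (K i).dom ((K i).idxAt x) := fun i => mem_idxAt (K i) x
  rw [curvature_eq (HermLineBundle.Connection.tensor nabla) (k := fun i => (K i).idxAt x)
    (mem_iInter.2 hx), Finset.sum_apply]
  exact Form.d_sum fun i _ => (nabla i).smooth _ x (hx i)

end HermLineBundle.Connection

/-! ### Local sections of submersions and maps into fibre products -/

section Submersions

variable {EY : Type*} [NormedAddCommGroup EY] [NormedSpace ℝ EY]
  {Y : Type*} [TopologicalSpace Y] [ChartedSpace EY Y]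
  {EM : Type*} [NormedAddCommGroup EM] [NormedSpace ℝ EM]
  {M : Type u} [TopologicalSpace M] [ChartedSpace EM M]

/-- Smooth local sections of a submersion through every point. -/
lemma SurjSubmersion.exists_local_section (π : SurjSubmersion EY Y EM M) (y : Y) :
    ∃ (U : Set M) (s : M → Y), IsOpen U ∧ π y ∈ U ∧ ContMDiffOn 𝓘(ℝ, EM) 𝓘(ℝ, EY) ∞ s U ∧
      (∀ x ∈ U, π (s x) = x) ∧ s (π y) = y := by
  -- In adapted coordinates the submersion is a projection; the section keeps the vertical
  -- coordinate frozen at that of `y`.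
  set c : M → EY := fun m => (π.split y).symm (π.ψ y m, (π.split y (π.φ y y)).2) with hc
  have hcs : ContMDiffOn 𝓘(ℝ, EM) 𝓘(ℝ, EY) ∞ c (π.ψ y).source := by
    have h : ContDiff ℝ ∞ fun e : EM => (π.split y).symm (e, (π.split y (π.φ y y)).2) :=
      (π.split y).symm.contDiff.comp (contDiff_id.prodMk contDiff_const)
    exact h.contMDiff.comp_contMDiffOn (π.ψ_smooth y)
  have hcy : c (π y) = π.φ y y := by
    simp only [hc]
    rw [π.ψ_π y (π.mem_φ y), ContinuousLinearEquiv.symm_apply_eq]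
  refine ⟨(π.ψ y).source ∩ c ⁻¹' (π.φ y).target, fun m => (π.φ y).symm (c m),
    hcs.continuousOn.isOpen_inter_preimage (π.ψ y).open_source (π.φ y).open_target,
    ⟨π.maps_φ y (π.mem_φ y), ?_⟩, ?_, ?_, ?_⟩
  · change c (π y) ∈ (π.φ y).target
    rw [hcy]
    exact (π.φ y).map_source (π.mem_φ y)
  · exact (π.φ_symm_smooth y).comp (hcs.mono inter_subset_left) fun _ hx => hx.2
  · rintro x ⟨h1, h2⟩
    have hm := (π.φ y).map_target h2
    refine (π.ψ y).injOn (π.maps_φ y hm) h1 ?_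
    rw [π.ψ_π y hm, (π.φ y).right_inv h2]
    simp [hc]
  · simp only [hcy]
    exact (π.φ y).left_inv (π.mem_φ y)

lemma SurjSubmersion.exists_section_nhds (π : SurjSubmersion EY Y EM M) (x : M) :
    ∃ (U : Set M) (s : M → Y), IsOpen U ∧ x ∈ U ∧ ContMDiffOn 𝓘(ℝ, EM) 𝓘(ℝ, EY) ∞ s U ∧
      ∀ x ∈ U, π (s x) = x := by
  obtain ⟨y, rfl⟩ := π.surjective x
  obtain ⟨U, s, h1, h2, h3, h4, -⟩ := π.exists_local_section y
  exact ⟨U, s, h1, h2, h3, h4⟩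

section pullback

variable {V : Type*} [NormedAddCommGroup V] [NormedSpace ℝ V] {k : ℕ}

/-- Pulling back along a local section undoes the pullback along the submersion. -/
lemma pullback_section (π : SurjSubmersion EY Y EM M) {U : Set M} {s : M → Y} (hU : IsOpen U)
    (hs : ContMDiffOn 𝓘(ℝ, EM) 𝓘(ℝ, EY) ∞ s U) (hπ : ∀ x ∈ U, π (s x) = x)
    (w : Form EM M k V) {x : M} (hx : x ∈ U) :
    Form.pullback (E := EM) s (Form.pullback (E := EY) π w) x = w x := by
  rw [Form.pullback_comp w ((π.contMDiff _).mdifferentiableAt (by simp))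
    ((hs.contMDiffAt (hU.mem_nhds hx)).mdifferentiableAt (by simp))]
  refine Form.pullback_eq_self w ?_
  filter_upwards [hU.mem_nhds hx] with z hz
  exact hπ z hz

/-- A local section recovers `w` from its pullback near every point of `M`. This yields uniqueness
of the three-curvature and lets identities between forms descend from `Y` to `M`. -/
lemma pullback_injective (π : SurjSubmersion EY Y EM M) {w w' : Form EM M k V}
    (h : Form.pullback (E := EY) π w = Form.pullback π w') : w = w' := by
  funext x
  obtain ⟨U, s, h1, h2, h3, h4⟩ := π.exists_section_nhds x
  rw [← pullback_section π h1 h3 h4 w h2, ← pullback_section π h1 h3 h4 w' h2, h]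

end pullback

namespace FibrePow

variable {π : SurjSubmersion EY Y EM M} {p : ℕ} {E : Type*} [NormedAddCommGroup E]
  [NormedSpace ℝ E] {X : Type*} [TopologicalSpace X] [ChartedSpace E X]

lemma continuousAt_of_entry {X : Type*} [TopologicalSpace X] {f : X → FibrePow π p} {x : X}
    (hf : ∀ i, ContinuousAt (fun x => entry i (f x)) x) : ContinuousAt f x := by
  have h : Topology.IsInducing (fun z : FibrePow π p => z.1) := Topology.IsInducing.subtypeVal
  exact h.continuousAt_iff.2 (continuousAt_pi.2 hf)

/-- A map into `Y^{[p+1]}` is smooth at a point as soon as all its entries are. -/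
lemma contMDiffAt_of_entry {f : X → FibrePow π p} {x : X}
    (hf : ∀ i, ContMDiffAt 𝓘(ℝ, E) 𝓘(ℝ, EY) ∞ (fun x => entry i (f x)) x) :
    ContMDiffAt 𝓘(ℝ, E) 𝓘(ℝ, Model π p) ∞ f x := by
  have hc : ContinuousAt f x := by
    exact continuousAt_of_entry fun i => (hf i).continuousAt
  set y := f x with hy
  have hx : f x ∈ (chart y).source := mem_chart_source (Model π p) (f x)
  have hsrc : ∀ᶠ z in 𝓝 x, f z ∈ (chart y).source :=
    hc.preimage_mem_nhds ((chart y).open_source.mem_nhds hx)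
  have hG : ContMDiffAt 𝓘(ℝ, E) 𝓘(ℝ, Model π p) ∞ (fun x => chart y (f x)) x := by
    apply ContMDiffAt.prodMk_space
    · exact ((π.ψ_smooth (y.1 0)).contMDiffAt ((π.ψ (y.1 0)).open_source.mem_nhds
        (π.maps_φ _ (hx 0)))).comp x ((π.contMDiff _).comp x (hf 0))
    · rw [contMDiffAt_pi_space]
      intro i
      have := ContMDiffAt.comp (g := π.φ (y.1 i)) x ((π.φ_smooth (y.1 i)).contMDiffAt
        ((π.φ (y.1 i)).open_source.mem_nhds (hx i))) (hf i)
      exact (contDiff_snd.comp (π.split (y.1 i)).contDiff).contMDiff.contMDiffAt.comp x this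
  have h1 : ContMDiffAt 𝓘(ℝ, Model π p) 𝓘(ℝ, Model π p) ∞ (chart y).symm (chart y (f x)) :=
    (contMDiffOn_symm_of_mem_maximalAtlas
      (IsManifold.chart_mem_maximalAtlas (x := y))).contMDiffAt
      ((chart y).open_target.mem_nhds ((chart y).map_source hx))
  refine (h1.comp x hG).congr_of_eventuallyEq ?_
  filter_upwards [hsrc] with z hz
  exact ((chart y).left_inv hz).symm

end FibrePow

end Submersions

/-! ### Solving `δ(φ) = g`, the maps `q`, and the curving -/

section CupProducts

variable {EY : Type*} [NormedAddCommGroup EY] [NormedSpace ℝ EY]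
  {Y : Type*} [TopologicalSpace Y] [ChartedSpace EY Y]
  {EM : Type*} [NormedAddCommGroup EM] [NormedSpace ℝ EM]
  {M : Type u} [TopologicalSpace M] [ChartedSpace EM M]
  {π : SurjSubmersion EY Y EM M}

namespace FibrePow

open Classical in
/-- The map `x ↦ (s x, t x)` to `Y^{[2]}` (with a default value where `π (s x) ≠ π (t x)`). -/
def pairMap {X : Type*} (π : SurjSubmersion EY Y EM M) (s t : X → Y) (x : X) : FibrePow π 1 :=
  if h : π (s x) = π (t x) then pair h else pair (rfl : π (s x) = π (s x))

lemma pairMap_apply {X : Type*} {s t : X → Y} {x : X} (h : π (s x) = π (t x)) :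
    pairMap π s t x = pair h := dif_pos h

lemma entry_zero_pairMap {X : Type*} (s t : X → Y) (x : X) : entry 0 (pairMap π s t x) = s x := by
  by_cases h : π (s x) = π (t x)
  · rw [pairMap_apply h]; rfl
  · rw [pairMap, dif_neg h]; rfl

lemma entry_one_pairMap {X : Type*} {s t : X → Y} {x : X} (h : π (s x) = π (t x)) :
    entry 1 (pairMap π s t x) = t x := by
  rw [pairMap_apply h]; rfl

lemma pair_entry (z : FibrePow π 1) (h : π (entry 0 z) = π (entry 1 z)) : pair h = z := by
  apply ext'; intro i; fin_cases i <;> rfl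

lemma π_entry_eq (z : FibrePow π 1) : π (entry 0 z) = π (entry 1 z) :=
  (π_entry 0 z).trans (π_entry 1 z).symm

lemma continuousAt_pairMap {X : Type*} [TopologicalSpace X] {s t : X → Y} {x : X}
    (hs : ContinuousAt s x) (ht : ContinuousAt t x) (h : ∀ᶠ z in 𝓝 x, π (s z) = π (t z)) :
    ContinuousAt (pairMap π s t) x := by
  refine continuousAt_of_entry fun i => ?_
  fin_cases i
  · exact hs.congr (Filter.Eventually.of_forall fun z => (entry_zero_pairMap s t z).symm)
  · exact ht.congr (h.mono fun z hz => (entry_one_pairMap hz).symm)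

lemma contMDiffAt_pairMap {E : Type*} [NormedAddCommGroup E] [NormedSpace ℝ E] {X : Type*}
    [TopologicalSpace X] [ChartedSpace E X] {s t : X → Y} {x : X}
    (hs : ContMDiffAt 𝓘(ℝ, E) 𝓘(ℝ, EY) ∞ s x) (ht : ContMDiffAt 𝓘(ℝ, E) 𝓘(ℝ, EY) ∞ t x)
    (h : ∀ᶠ z in 𝓝 x, π (s z) = π (t z)) :
    ContMDiffAt 𝓘(ℝ, E) 𝓘(ℝ, Model π 1) ∞ (pairMap π s t) x := by
  refine contMDiffAt_of_entry fun i => ?_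
  fin_cases i
  · exact hs.congr_of_eventuallyEq (Filter.Eventually.of_forall fun z => entry_zero_pairMap s t z)
  · exact ht.congr_of_eventuallyEq (h.mono fun z hz => entry_one_pairMap hz)

/-- Since `y₁` and `y₂` lie over one point `m`, this is the cocycle identity for the triple `(s m,
y₁, y₂)`. It makes `y ↦ g(s(π y), y)` a solution of `δ(φ) = g` over the domain of the section. -/
lemma cocycle_pairMap {g : FibrePow π 1 → ℤ} (hg : delta g = 0) {s : M → Y} {y₁ y₂ : Y}
    (h : π y₁ = π y₂) (hs : π (s (π y₁)) = π y₁) :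
    g (pairMap π (s ∘ π) id y₂) = g (pairMap π (s ∘ π) id y₁) + g (pair h) := by
  have h2 : π ((s ∘ π) y₂) = π (id y₂) := by
    simp only [comp_apply, id]
    rw [← h, hs]
  rw [pairMap_apply h2, pairMap_apply (s := s ∘ π) (t := id) (x := y₁) hs, ← cocycle_pair hg]
  congr 1
  apply ext'; intro i; fin_cases i
  · change s (π y₂) = s (π y₁)
    rw [h]
  · rfl

/-- The local solutions `y ↦ g (s (π y), y)` of `δ(φ) = g` are locally constant. -/
lemma contMDiffAt_cocycle_pairMap {g : FibrePow π 1 → ℤ} (hg : IsLocallyConstant g) {U : Set M}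
    {s : M → Y} (hU : IsOpen U) (hs : ContMDiffOn 𝓘(ℝ, EM) 𝓘(ℝ, EY) ∞ s U)
    (hπ : ∀ x ∈ U, π (s x) = x) {y : Y} (hy : π y ∈ U) :
    ContMDiffAt 𝓘(ℝ, EY) 𝓘(ℝ, ℝ) ∞ (fun y => (g (pairMap π (s ∘ π) id y) : ℝ)) y := by
  have hc : ContinuousAt (pairMap π (s ∘ π) id) y := by
    refine continuousAt_pairMap ((hs.continuousOn.continuousAt (hU.mem_nhds hy)).comp
      π.contMDiff.continuous.continuousAt) continuousAt_id ?_
    filter_upwards [(hU.preimage π.contMDiff.continuous).mem_nhds hy] with z hz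
    exact hπ _ hz
  have h : ∀ᶠ z in 𝓝 y, g (pairMap π (s ∘ π) id z) = g (pairMap π (s ∘ π) id y) :=
    hc.preimage_mem_nhds ((hg.isOpen_fiber _).mem_nhds rfl)
  refine (contMDiffAt_const (c := (g (pairMap π (s ∘ π) id y) : ℝ))).congr_of_eventuallyEq ?_
  filter_upwards [h] with z hz
  rw [hz]

/-- Every integral cocycle on `Y^{[2]}` is the coboundary of a smooth real function on `Y`. -/
lemma exists_deltaFun_eq [FiniteDimensional ℝ EM] [T2Space M] [SecondCountableTopology M]
    [IsManifold 𝓘(ℝ, EM) ∞ M] {g : FibrePow π 1 → ℤ} (hg : IsLocallyConstant g)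
    (hδ : delta g = 0) :
    ∃ φ : Y → ℝ, ContMDiff 𝓘(ℝ, EY) 𝓘(ℝ, ℝ) ∞ φ ∧
      deltaFun φ = fun z : FibrePow π 1 => (g z : ℝ) := by
  choose U s hU hxU hs hπ using π.exists_section_nhds
  have : LocallyCompactSpace M := Manifold.locallyCompact_of_finiteDimensional 𝓘(ℝ, EM)
  obtain ⟨ρ, hρ⟩ := SmoothPartitionOfUnity.exists_isSubordinate 𝓘(ℝ, EM) isClosed_univ U hU
    (fun x _ => mem_iUnion.2 ⟨x, hxU x⟩)
  set c : M → Y → ℝ := fun a y => (g (pairMap π (s a ∘ π) id y) : ℝ) with hc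
  have hfin : ∀ (m : M) (k : M → ℝ), (support fun a => ρ a m • k a).Finite := fun m k =>
    (ρ.locallyFinite.point_finite m).subset fun a ha h => ha (by
      have h' : ρ a m = 0 := h
      simp [h'])
  -- The average of the local solutions `c a`, with weights that depend only on the base point.
  refine ⟨fun y => ∑ᶠ a, ρ a (π y) • c a y, ?_, ?_⟩
  · refine contMDiff_finsum (fun a => ?_) ?_
    · refine contMDiff_of_tsupport fun y hy => ?_
      have hyU : π y ∈ U a := by
        refine hρ a ?_
        have h1 : tsupport (fun y => ρ a (π y) • c a y) ⊆ tsupport (fun y => ρ a (π y)) :=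
          tsupport_smul_subset_left _ _
        exact tsupport_comp_subset_preimage (ρ a) π.contMDiff.continuous (h1 hy)
      have h2 : ContMDiffAt 𝓘(ℝ, EY) 𝓘(ℝ, ℝ) ∞ (fun y => ρ a (π y)) y :=
        ((ρ a).contMDiff _).comp y (π.contMDiff y)
      exact h2.smul (contMDiffAt_cocycle_pairMap hg (hU a) (hs a) (hπ a) hyU)
    · refine (ρ.locallyFinite.preimage_continuous π.contMDiff.continuous).subset fun a y hy h => ?_
      have h' : ρ a (π y) = 0 := h
      exact hy (by simp [h'])
  · funext z
    have hz := π_entry_eq z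
    have hsum : (∑ᶠ a, ρ a (π (entry 1 z))) = 1 := ρ.sum_eq_one (mem_univ _)
    simp only [deltaFun]
    rw [← hz, ← finsum_sub_distrib (hfin _ _) (hfin _ _)]
    -- Each summand has coboundary `ρ a * g`: over `U a` by the cocycle identity, elsewhere because
    -- the weight is zero. The weights sum to one.
    have h : ∀ a, ρ a (π (entry 0 z)) • c a (entry 1 z) - ρ a (π (entry 0 z)) • c a (entry 0 z) =
        ρ a (π (entry 1 z)) * (g z : ℝ) := by
      intro a
      rw [← hz, ← smul_sub]
      by_cases h0 : π (entry 0 z) ∈ U a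
      · have := cocycle_pairMap hδ (s := s a) hz (hπ a _ h0)
        simp only [hc]
        rw [this, pair_entry]
        push_cast
        simp
      · have : ρ a (π (entry 0 z)) = 0 := by
          by_contra hne
          exact h0 (hρ a (subset_tsupport _ hne))
        simp [this]
    rw [finsum_congr h, ← finsum_mul' , hsum, one_mul]
    exact (ρ.locallyFinite.point_finite _)

end FibrePow

open FibrePow

/-- The descent of `exp (2π i φ)` to the base, for `φ` with integral coboundary. -/
lemma exists_circle_descent {φ : Y → ℝ} (hφ : ContMDiff 𝓘(ℝ, EY) 𝓘(ℝ, ℝ) ∞ φ)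
    {g : FibrePow π 1 → ℤ} (h : deltaFun φ = fun z : FibrePow π 1 => (g z : ℝ)) :
    ∃ q : M → Circle, ContMDiff 𝓘(ℝ, EM) (𝓡 1) ∞ q ∧
      ∀ y, (q (π y) : ℂ) = Complex.exp (2 * Real.pi * Complex.I * φ y) := by
  have hd : ∀ y₁ y₂, π y₁ = π y₂ →
      Circle.exp (2 * Real.pi * φ y₁) = Circle.exp (2 * Real.pi * φ y₂) := by
    intro y₁ y₂ e
    have h1 : φ y₂ - φ y₁ = (g (pair e) : ℝ) := congrFun h (pair e)
    have h2 : 2 * Real.pi * φ y₂ = 2 * Real.pi * φ y₁ + g (pair e) * (2 * Real.pi) := by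
      rw [← h1]; ring
    rw [h2, Circle.exp_add, Circle.exp_int_mul_two_pi, mul_one]
  -- The preimage chosen by `surjInv` need not vary continuously, but the circle value does not
  -- depend on it; for smoothness it is replaced by a smooth local section.
  have hq : ∀ y, Circle.exp (2 * Real.pi * φ (surjInv π.surjective (π y))) =
      Circle.exp (2 * Real.pi * φ y) := fun y => hd _ _ (surjInv_eq π.surjective (π y))
  refine ⟨fun m => Circle.exp (2 * Real.pi * φ (surjInv π.surjective m)), ?_, fun y => ?_⟩
  · intro x
    obtain ⟨U, s, hU, hx, hs, hπ⟩ := π.exists_section_nhds x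
    have h1 : ContMDiffAt 𝓘(ℝ, EM) 𝓘(ℝ, ℝ) ∞ (fun m => 2 * Real.pi * φ (s m)) x :=
      (contDiff_const.mul contDiff_id : ContDiff ℝ ∞ fun w : ℝ => 2 * Real.pi * w).contMDiff.contMDiffAt.comp
        x ((hφ _).comp x (hs.contMDiffAt (hU.mem_nhds hx)))
    refine ContMDiffAt.congr_of_eventuallyEq
      ((contMDiff_circleExp (m := ∞)).contMDiffAt.comp x h1) ?_
    filter_upwards [hU.mem_nhds hx] with m hm
    have := hq (s m)
    rwa [hπ m hm] at this
  · have h1 := congrArg (fun c : Circle => (c : ℂ)) (hq y)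
    refine h1.trans ?_
    rw [Circle.coe_exp]
    congr 1
    push_cast
    ring

section forms

variable [IsManifold 𝓘(ℝ, EM) ∞ M] [IsManifold 𝓘(ℝ, EY) ∞ Y]

lemma contMDiff_circle_coe {q : M → Circle} (hq : ContMDiff 𝓘(ℝ, EM) (𝓡 1) ∞ q) :
    ContMDiff 𝓘(ℝ, EM) 𝓘(ℝ, ℂ) ∞ fun m => (q m : ℂ) := by
  have : Fact (Module.finrank ℝ ℂ = 1 + 1) := finrank_real_complex_fact'
  exact contMDiff_coe_sphere.comp hq

/-- The pullback of `q⁻¹ dq` is `2π i dφ`. -/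
lemma pullback_dLog_circle {q : M → Circle} (hq : ContMDiff 𝓘(ℝ, EM) (𝓡 1) ∞ q)
    {φ : Y → ℝ} (hφ : ContMDiff 𝓘(ℝ, EY) 𝓘(ℝ, ℝ) ∞ φ)
    (h : ∀ y, (q (π y) : ℂ) = Complex.exp (2 * Real.pi * Complex.I * φ y)) :
    Form.pullback (E := EY) π (Form.dLog (E := EM) fun m => (q m : ℂ)) =
      (2 * Real.pi * Complex.I : ℂ) • Form.map Complex.ofRealCLM (Form.dFun (E := EY) φ) := by
  funext y
  have hl : ContDiff ℝ ∞ fun r : ℝ => (2 * Real.pi * Complex.I : ℂ) * (r : ℂ) :=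
    contDiff_const.mul Complex.ofRealCLM.contDiff
  have hφy : MDifferentiableAt 𝓘(ℝ, EY) 𝓘(ℝ, ℝ) φ y := (hφ y).mdifferentiableAt (by simp)
  have hly : MDifferentiableAt 𝓘(ℝ, EY) 𝓘(ℝ, ℂ)
      (fun y => (2 * Real.pi * Complex.I : ℂ) * (φ y : ℂ)) y :=
    ((hl.contMDiff.comp hφ) y).mdifferentiableAt (by simp)
  rw [← Form.dLog_comp (((contMDiff_circle_coe hq) _).mdifferentiableAt (by simp))
    ((π.contMDiff y).mdifferentiableAt (by simp))]
  rw [show (fun z => (q (π z) : ℂ)) = fun y => Complex.exp ((2 * Real.pi * Complex.I : ℂ) * (φ y : ℂ))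
    from funext h, Form.dLog_exp hly]
  have h1 : HasFDerivAt (fun r : ℝ => (2 * Real.pi * Complex.I : ℂ) * (r : ℂ))
      ((2 * Real.pi * Complex.I : ℂ) • Complex.ofRealCLM) (φ y) :=
    Complex.ofRealCLM.hasFDerivAt.const_mul _
  have h2 := (h1.hasMFDerivAt.comp y hφy.hasMFDerivAt).mfderiv
  ext v
  exact DFunLike.congr_fun h2 (v 0)

/-- The exterior derivative of `∑ i, φ_i π^* F_i`, for closed forms `F_i`. -/
lemma d_sum_fsmul_pullback {n k : ℕ} {F : Fin n → Form EM M k ℂ}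
    (hF : ∀ i, (F i).Smooth) (hd : ∀ i, (F i).d = 0) {φ : Fin n → Y → ℝ}
    (hφ : ∀ i, ContMDiff 𝓘(ℝ, EY) 𝓘(ℝ, ℝ) ∞ (φ i)) {q : Fin n → M → Circle}
    (hq : ∀ i, ContMDiff 𝓘(ℝ, EM) (𝓡 1) ∞ (q i))
    (h : ∀ i y, (q i (π y) : ℂ) = Complex.exp (2 * Real.pi * Complex.I * φ i y)) :
    Form.d (∑ i, Form.fsmul (φ i) (Form.pullback (E := EY) π (F i))) =
      Form.pullback π (∑ i, Form.wedge
        ((2 * Real.pi * Complex.I : ℂ)⁻¹ • Form.dLog fun m => (q i m : ℂ)) (F i)) := by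
  funext y
  rw [Form.d_sum fun i _ => Form.SmoothAt.fsmul (hφ i y)
    (Form.SmoothAt.pullback (hF i _ (mem_univ _)) (π.contMDiff y)), Form.pullback_sum]
  refine Finset.sum_congr rfl fun i _ => ?_
  -- Closedness of `F i` kills the second term of the Leibniz rule, leaving `dφ_i ∧ π^* F_i`.
  have hdF : (Form.pullback (E := EY) π (F i)).d y = 0 := by
    rw [Form.d_pullback (hF i _ (mem_univ _)) (π.contMDiff y), hd i]
    rfl
  rw [Form.d_fsmul (hφ i y) (Form.SmoothAt.pullback (hF i _ (mem_univ _)) (π.contMDiff y)),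
    hdF, smul_zero, add_zero, Form.wedge_smul_left]
  have e : Form.pullback (E := EY) π ((2 * Real.pi * Complex.I : ℂ)⁻¹ •
      Form.wedge (Form.dLog (E := EM) fun m => (q i m : ℂ)) (F i)) =
      (2 * Real.pi * Complex.I : ℂ)⁻¹ • Form.pullback π
        (Form.wedge (Form.dLog (E := EM) fun m => (q i m : ℂ)) (F i)) := rfl
  have hne : (2 * Real.pi * Complex.I : ℂ) ≠ 0 := Complex.two_pi_I_ne_zero
  rw [e, Form.pullback_wedge, pullback_dLog_circle (hq i) (hφ i) (h i), Form.wedge_smul_left,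
    smul_smul, inv_mul_cancel₀ hne, one_smul]

/-- Either entry followed by `π` is the projection to `M`, so only the scalar `φ` remembers which
entry was used. -/
lemma pullback_entry_fsmul {k : ℕ} (j : Fin 2) (φ : Y → ℝ)
    (F : Form EM M k ℂ) (z : FibrePow π 1) :
    Form.pullback (E := Model π 1) (entry j) (Form.fsmul φ (Form.pullback (E := EY) π F)) z =
      φ (entry j z) • Form.pullback base F z := by
  have h1 := Form.pullback_comp (E := Model π 1) (E' := EY) F (f := (entry j : FibrePow π 1 → Y))
    (g := π) (x := z) ((π.contMDiff _).mdifferentiableAt (by simp))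
    ((contMDiff_entry j z).mdifferentiableAt (by simp))
  have h2 : (π ∘ entry j : FibrePow π 1 → M) = base := funext fun z => π_entry j z
  rw [h2] at h1
  rw [← h1]
  rfl

/-- The two pullbacks of `π^* F i` being equal, `δ` acts on the coefficient alone and turns `φ i`
into `g i`. -/
lemma deltaForm_sum_fsmul {n k : ℕ} {F : Fin n → Form EM M k ℂ}
    {φ : Fin n → Y → ℝ} {g : Fin n → FibrePow π 1 → ℤ}
    (h : ∀ i, deltaFun (φ i) = fun z : FibrePow π 1 => (g i z : ℝ)) (z : FibrePow π 1) :
    deltaForm (∑ i, Form.fsmul (φ i) (Form.pullback (E := EY) π (F i))) z =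
      ∑ i, (g i z : ℝ) • Form.pullback (E := Model π 1) base (F i) z := by
  have e : ∀ α : Form EY Y k ℂ, deltaForm (π := π) α z =
      Form.pullback (E := Model π 1) (entry 1) α z -
        Form.pullback (E := Model π 1) (entry 0) α z := fun _ => rfl
  rw [e, Form.pullback_sum, Form.pullback_sum, ← Finset.sum_sub_distrib]
  refine Finset.sum_congr rfl fun i _ => ?_
  rw [pullback_entry_fsmul, pullback_entry_fsmul, ← sub_smul, ← congrFun (h i) z]
  rfl

lemma cupConnection_curvature {L : HermLineBundle.{v} EM M} (nabla : L.Connection)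
    (g : FibrePow π 1 → ℤ) (hg : IsLocallyConstant g) (hδ : delta g = 0) (z : FibrePow π 1) :
    (BundleGerbe.cupConnection π nabla g hg hδ).nabla.curvature z =
      (g z : ℝ) • Form.pullback (E := Model π 1) base nabla.curvature z := by
  have h := HermLineBundle.Connection.curvature_zpow (nabla.pullback base contMDiff_base) g hg z
  rw [HermLineBundle.Connection.curvature_pullback] at h
  exact h

end forms

end CupProducts

/-! ### The Čech-de Rham zigzag of a connection and a curving -/

section CechDeRhamClass

variable {EY : Type*} [NormedAddCommGroup EY] [NormedSpace ℝ EY]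
  {Y : Type*} [TopologicalSpace Y] [ChartedSpace EY Y]
  {EM : Type*} [NormedAddCommGroup EM] [NormedSpace ℝ EM]
  {M : Type u} [TopologicalSpace M] [ChartedSpace EM M]
  {π : SurjSubmersion EY Y EM M}

open FibrePow

namespace FibrePow

open Classical in
/-- The map `x ↦ (s x, t x, r x)` to `Y^{[3]}` (with a default value where the base points of the
entries differ). -/
def tripleMap {X : Type*} (π : SurjSubmersion EY Y EM M) (s t r : X → Y) (x : X) : FibrePow π 2 :=
  if h : π (s x) = π (t x) ∧ π (t x) = π (r x) then triple h.1 h.2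
  else triple (rfl : π (s x) = π (s x)) (rfl : π (s x) = π (s x))

lemma tripleMap_apply {X : Type*} {s t r : X → Y} {x : X} (h : π (s x) = π (t x))
    (h' : π (t x) = π (r x)) : tripleMap π s t r x = triple h h' := dif_pos ⟨h, h'⟩

lemma contMDiffAt_tripleMap {E : Type*} [NormedAddCommGroup E] [NormedSpace ℝ E] {X : Type*}
    [TopologicalSpace X] [ChartedSpace E X] {s t r : X → Y} {x : X}
    (hs : ContMDiffAt 𝓘(ℝ, E) 𝓘(ℝ, EY) ∞ s x) (ht : ContMDiffAt 𝓘(ℝ, E) 𝓘(ℝ, EY) ∞ t x)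
    (hr : ContMDiffAt 𝓘(ℝ, E) 𝓘(ℝ, EY) ∞ r x)
    (h : ∀ᶠ z in 𝓝 x, π (s z) = π (t z) ∧ π (t z) = π (r z)) :
    ContMDiffAt 𝓘(ℝ, E) 𝓘(ℝ, Model π 2) ∞ (tripleMap π s t r) x := by
  refine contMDiffAt_of_entry fun i => ?_
  fin_cases i
  · refine hs.congr_of_eventuallyEq (h.mono fun z hz => ?_)
    exact congrArg (entry 0) (tripleMap_apply hz.1 hz.2)
  · refine ht.congr_of_eventuallyEq (h.mono fun z hz => ?_)
    exact congrArg (entry 1) (tripleMap_apply hz.1 hz.2)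
  · refine hr.congr_of_eventuallyEq (h.mono fun z hz => ?_)
    exact congrArg (entry 2) (tripleMap_apply hz.1 hz.2)

end FibrePow

namespace BundleGerbe.CechData

variable {G : BundleGerbe.{v} π} (D : G.CechData)

/-- The map `(s_a, s_b)` to `Y^{[2]}`. -/
abbrev sPair (a b : D.ι) : M → FibrePow π 1 := pairMap π (D.s a) (D.s b)

lemma π_s_eq {a b : D.ι} {x : M} (hx : x ∈ D.U a ∩ D.U b) : π (D.s a x) = π (D.s b x) :=
  (D.s_section a x hx.1).trans (D.s_section b x hx.2).symm

lemma eventually_π_s_eq {a b : D.ι} {x : M} (hx : x ∈ D.U a ∩ D.U b) :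
    ∀ᶠ z in 𝓝 x, π (D.s a z) = π (D.s b z) :=
  Filter.eventually_of_mem (((D.isOpen_U a).inter (D.isOpen_U b)).mem_nhds hx) fun _ hz =>
    D.π_s_eq hz

lemma contMDiffAt_s {a : D.ι} {x : M} (hx : x ∈ D.U a) :
    ContMDiffAt 𝓘(ℝ, EM) 𝓘(ℝ, EY) ∞ (D.s a) x :=
  (D.s_smooth a).contMDiffAt ((D.isOpen_U a).mem_nhds hx)

lemma contMDiffAt_sPair {a b : D.ι} {x : M} (hx : x ∈ D.U a ∩ D.U b) :
    ContMDiffAt 𝓘(ℝ, EM) 𝓘(ℝ, Model π 1) ∞ (D.sPair a b) x :=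
  contMDiffAt_pairMap (D.contMDiffAt_s hx.1) (D.contMDiffAt_s hx.2) (D.eventually_π_s_eq hx)

/-- The open set on which `σ_{ab}` is compared with the frame `k`. -/
def frameDom (a b : D.ι) (k : G.P.Idx) : Set M := (D.U a ∩ D.U b) ∩ D.sPair a b ⁻¹' G.P.dom k

lemma isOpen_frameDom (a b : D.ι) (k : G.P.Idx) : IsOpen (D.frameDom a b k) :=
  ContinuousOn.isOpen_inter_preimage
    (fun _ hx => (D.contMDiffAt_sPair hx).continuousAt.continuousWithinAt)
    ((D.isOpen_U a).inter (D.isOpen_U b)) (G.P.isOpen_dom k)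

/-- The coordinate of `σ_{ab}` in the frame `k`. -/
def coeff (a b : D.ι) (k : G.P.Idx) : M → ℂ := (D.σ_smooth a b k).choose

lemma pair_mem_dom {a b : D.ι} {k : G.P.Idx} {x : M} (hx : x ∈ D.frameDom a b k) :
    pair ((D.s_section a x hx.1.1).trans (D.s_section b x hx.1.2).symm) ∈ G.P.dom k := by
  have h := hx.2
  rwa [mem_preimage, sPair, pairMap_apply (D.π_s_eq hx.1)] at h

lemma coeff_smooth (a b : D.ι) (k : G.P.Idx) :
    ContMDiffOn 𝓘(ℝ, EM) 𝓘(ℝ, ℂ) ∞ (D.coeff a b k) (D.frameDom a b k) :=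
  (D.σ_smooth a b k).choose_spec.1.mono fun _ hx => ⟨hx.1.1, hx.1.2, D.pair_mem_dom hx⟩

lemma σ_eq {a b : D.ι} {k : G.P.Idx} {x : M} (hx : x ∈ D.frameDom a b k) :
    D.σ a b x hx.1.1 hx.1.2 = D.coeff a b k x • G.P.frame k _ :=
  ((D.σ_smooth a b k).choose_spec.2 x hx.1.1 hx.1.2 (D.pair_mem_dom hx)).2

lemma coeff_ne_zero {a b : D.ι} {k : G.P.Idx} {x : M} (hx : x ∈ D.frameDom a b k) :
    D.coeff a b k x ≠ 0 := by
  intro h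
  have h1 := ((D.σ_smooth a b k).choose_spec.2 x hx.1.1 hx.1.2 (D.pair_mem_dom hx)).1
  change ‖D.coeff a b k x‖ = 1 at h1
  simp [h] at h1

lemma mdiff_coeff {a b : D.ι} {k : G.P.Idx} {x : M} (hx : x ∈ D.frameDom a b k) :
    MDifferentiableAt 𝓘(ℝ, EM) 𝓘(ℝ, ℂ) (D.coeff a b k) x :=
  ((D.coeff_smooth a b k).contMDiffAt ((D.isOpen_frameDom a b k).mem_nhds hx)).mdifferentiableAt
    (by simp)

lemma coeff_trans {a b : D.ι} {k l : G.P.Idx} {x : M} (hk : x ∈ D.frameDom a b k)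
    (hl : x ∈ D.frameDom a b l) :
    D.coeff a b k x = D.coeff a b l x * G.P.trans k l (D.sPair a b x) := by
  have h1 := (D.σ_eq hk).symm.trans (D.σ_eq hl)
  rw [G.P.frame_eq k l _ ⟨D.pair_mem_dom hk, D.pair_mem_dom hl⟩, smul_smul] at h1
  have h2 := smul_left_injective ℂ (G.P.frame_ne_zero k _ (D.pair_mem_dom hk)) h1
  rw [sPair, pairMap_apply (D.π_s_eq hk.1)]
  exact h2

variable [IsManifold 𝓘(ℝ, EM) ∞ M] [IsManifold 𝓘(ℝ, EY) ∞ Y] (nabla : G.Connection)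

/-- The connection form of the pullback of `∇` along `(s_a, s_b)` with respect to `σ_{ab}`, computed
in the frame `k`. -/
def connFormIn (a b : D.ι) (k : G.P.Idx) : Form EM M 1 ℂ :=
  Form.pullback (D.sPair a b) (nabla.nabla.form k) + Form.dLog (D.coeff a b k)

/-- Passing from the frame `k` to `l` adds the logarithmic derivative of the transition function to
the connection form and removes it from that of the coefficient of `σ_{ab}`. -/
lemma connFormIn_congr {a b : D.ι} {k l : G.P.Idx} {x : M} (hk : x ∈ D.frameDom a b k)
    (hl : x ∈ D.frameDom a b l) : D.connFormIn nabla a b k x = D.connFormIn nabla a b l x := by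
  have hS := (D.contMDiffAt_sPair hk.1).mdifferentiableAt (n := ∞) (by simp)
  have hkl : D.sPair a b x ∈ G.P.dom k ∩ G.P.dom l := ⟨hk.2, hl.2⟩
  have hT : MDifferentiableAt 𝓘(ℝ, EM) 𝓘(ℝ, ℂ) (fun z => G.P.trans k l (D.sPair a b z)) x :=
    (G.P.mdiff_trans hkl).comp x hS
  have h1 : Form.dLog (E := EM) (D.coeff a b k) x =
      Form.dLog (D.coeff a b l) x +
        Form.pullback (D.sPair a b) (Form.dLog (E := Model π 1) (G.P.trans k l)) x := by
    rw [← Form.dLog_comp (G.P.mdiff_trans hkl) hS,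
      ← Form.dLog_mul (D.mdiff_coeff hl) hT (D.coeff_ne_zero hl) (G.P.trans_ne_zero hkl)]
    refine Form.dLog_congr ?_
    filter_upwards [(D.isOpen_frameDom a b k).mem_nhds hk,
      (D.isOpen_frameDom a b l).mem_nhds hl] with z hz hz'
    exact D.coeff_trans hz hz'
  have h2 : Form.pullback (E := EM) (D.sPair a b) (nabla.nabla.form l) x =
      Form.pullback (D.sPair a b) (nabla.nabla.form k) x +
        Form.pullback (D.sPair a b) (Form.dLog (E := Model π 1) (G.P.trans k l)) x := by
    simp only [Form.pullback]
    rw [nabla.nabla.compat k l _ hkl]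
    rfl
  change Form.pullback (E := EM) (D.sPair a b) (nabla.nabla.form k) x + _ =
    Form.pullback (E := EM) (D.sPair a b) (nabla.nabla.form l) x + _
  rw [h1, h2]
  abel

/-- The connection form of the pullback of `∇` along `(s_a, s_b)` with respect to `σ_{ab}`. -/
def connForm (a b : D.ι) : Form EM M 1 ℂ := fun x =>
  D.connFormIn nabla a b (G.P.idxAt (D.sPair a b x)) x

lemma mem_frameDom_idxAt {a b : D.ι} {x : M} (hx : x ∈ D.U a ∩ D.U b) :
    x ∈ D.frameDom a b (G.P.idxAt (D.sPair a b x)) :=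
  ⟨hx, HermLineBundle.Connection.mem_idxAt G.P _⟩

lemma connForm_eq {a b : D.ι} {k : G.P.Idx} {x : M} (hk : x ∈ D.frameDom a b k) :
    D.connForm nabla a b x = D.connFormIn nabla a b k x :=
  D.connFormIn_congr nabla (D.mem_frameDom_idxAt hk.1) hk

lemma eventually_connForm_eq {a b : D.ι} {k : G.P.Idx} {x : M} (hk : x ∈ D.frameDom a b k) :
    ∀ᶠ z in 𝓝 x, D.connForm nabla a b z = D.connFormIn nabla a b k z :=
  Filter.eventually_of_mem ((D.isOpen_frameDom a b k).mem_nhds hk) fun _ hz =>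
    D.connForm_eq nabla hz

lemma smoothAt_dLog_coeff {a b : D.ι} {k : G.P.Idx} {x : M} (hk : x ∈ D.frameDom a b k) :
    (Form.dLog (E := EM) (D.coeff a b k)).SmoothAt x :=
  Form.smoothOn_dLog (D.isOpen_frameDom a b k) (D.coeff_smooth a b k)
    (fun _ hz => D.coeff_ne_zero hz) x hk

lemma smoothAt_pullback_form {a b : D.ι} {k : G.P.Idx} {x : M} (hk : x ∈ D.frameDom a b k) :
    (Form.pullback (E := EM) (D.sPair a b) (nabla.nabla.form k)).SmoothAt x :=
  Form.SmoothAt.pullback (nabla.nabla.smooth k _ hk.2) (D.contMDiffAt_sPair hk.1)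

lemma connForm_smooth (a b : D.ι) : (D.connForm nabla a b).SmoothOn (D.U a ∩ D.U b) := by
  intro x hx
  have hk := D.mem_frameDom_idxAt hx
  exact Form.SmoothAt.congr ((D.smoothAt_pullback_form nabla hk).add (D.smoothAt_dLog_coeff hk))
    (D.eventually_connForm_eq nabla hk)

/-- The curvature of the pullback of `∇` along `(s_a, s_b)`. -/
lemma d_connForm {a b : D.ι} {x : M} (hx : x ∈ D.U a ∩ D.U b) :
    (D.connForm nabla a b).d x =
      Form.pullback (D.sPair a b) nabla.nabla.curvature x := by
  have hk := D.mem_frameDom_idxAt hx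
  rw [Form.d_congr (D.eventually_connForm_eq nabla hk), connFormIn,
    Form.d_add (D.smoothAt_pullback_form nabla hk) (D.smoothAt_dLog_coeff hk),
    Form.d_dLog (D.isOpen_frameDom a b _) (D.coeff_smooth a b _)
      (fun _ hz => D.coeff_ne_zero hz) hk, add_zero,
    Form.d_pullback (nabla.nabla.smooth _ _ hk.2) (D.contMDiffAt_sPair hk.1)]
  simp only [Form.pullback]
  rw [nabla.nabla.curvature_eq hk.2]

/-- Near `x` the entries of `(s_a, s_b)` are the two sections, so `δ` on `Y^{[2]}` becomes the Čech
difference on `M`. -/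
lemma pullback_sPair_deltaForm {a b : D.ι} {x : M} (hx : x ∈ D.U a ∩ D.U b) {k : ℕ}
    (f : Form EY Y k ℂ) :
    Form.pullback (E := EM) (D.sPair a b) (deltaForm f) x =
      Form.pullback (D.s b) f x - Form.pullback (D.s a) f x := by
  have hS := (D.contMDiffAt_sPair hx).mdifferentiableAt (n := ∞) (by simp)
  have h : ∀ (j : Fin 2) (s : M → Y), entry j ∘ D.sPair a b =ᶠ[𝓝 x] s →
      Form.pullback (E := EM) (D.sPair a b) (Form.pullback (E := Model π 1) (entry j) f) x =
        Form.pullback s f x := by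
    intro j s hs
    rw [Form.pullback_comp f ((contMDiff_entry j _).mdifferentiableAt (by simp)) hS]
    exact Form.pullback_congr f hs
  rw [← h 1 (D.s b) ((D.eventually_π_s_eq hx).mono fun z hz => entry_one_pairMap hz),
    ← h 0 (D.s a) (Filter.Eventually.of_forall fun z => entry_zero_pairMap _ _ z)]
  rfl

/-- The map `(s_a, s_b, s_c)` to `Y^{[3]}`. -/
abbrev sTriple (a b c : D.ι) : M → FibrePow π 2 := tripleMap π (D.s a) (D.s b) (D.s c)

/-- The defining relation of `h_{abc}`, expressed in frames: both sides are multiples of one nonzero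
frame vector, whose coefficients must agree. -/
lemma mul_coeff {a b c : D.ι} {k l m : G.P.Idx} {x : M} (hk : x ∈ D.frameDom a b k)
    (hl : x ∈ D.frameDom b c l) (hm : x ∈ D.frameDom a c m) :
    D.coeff a b k x * D.coeff b c l x * G.mulCoeff k l m (D.sTriple a b c x) =
      Complex.exp (2 * Real.pi * Complex.I * D.h a b c x) * D.coeff a c m x := by
  have h1 := D.mul_σ a b c x hk.1.1 hk.1.2 hl.1.2
  rw [D.σ_eq hk, D.σ_eq hl, D.σ_eq hm, map_smul, map_smul, LinearMap.smul_apply,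
    G.mul_frame k l m _ _ (D.pair_mem_dom hk) (D.pair_mem_dom hl) (D.pair_mem_dom hm),
    smul_smul, smul_smul, smul_smul] at h1
  have h2 := smul_left_injective ℂ (G.P.frame_ne_zero m _ (D.pair_mem_dom hm)) h1
  rw [sTriple, tripleMap_apply (D.π_s_eq hk.1) (D.π_s_eq hl.1), ← h2]
  ring

/-- Two identities are added: the parallelism of the multiplication pulled back along `(s_a, s_b,
s_c)`, and the logarithmic derivative of `mul_coeff`. The term from the multiplication coefficient
occurs in both and cancels, leaving the differential of `2π i h_{abc}`. -/
lemma connForm_cocycle {a b c : D.ι} {x : M} (hx : x ∈ D.U a ∩ D.U b ∩ D.U c) :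
    D.connForm nabla b c x - D.connForm nabla a c x + D.connForm nabla a b x =
      Form.dFun (E := EM) (fun z => (2 * Real.pi * Complex.I * D.h a b c z : ℂ)) x := by
  have hk := D.mem_frameDom_idxAt (a := a) (b := b) hx.1
  have hl := D.mem_frameDom_idxAt (a := b) (b := c) ⟨hx.1.2, hx.2⟩
  have hm := D.mem_frameDom_idxAt (a := a) (b := c) ⟨hx.1.1, hx.2⟩
  set k := G.P.idxAt (D.sPair a b x)
  set l := G.P.idxAt (D.sPair b c x)
  set m := G.P.idxAt (D.sPair a c x)
  have hev : ∀ᶠ z in 𝓝 x, π (D.s a z) = π (D.s b z) ∧ π (D.s b z) = π (D.s c z) :=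
    (D.eventually_π_s_eq hk.1).and (D.eventually_π_s_eq hl.1)
  have hT : MDifferentiableAt 𝓘(ℝ, EM) 𝓘(ℝ, Model π 2) (D.sTriple a b c) x :=
    (contMDiffAt_tripleMap (D.contMDiffAt_s hx.1.1) (D.contMDiffAt_s hx.1.2)
      (D.contMDiffAt_s hx.2) hev).mdifferentiableAt (by simp)
  have f2 : face 2 ∘ D.sTriple a b c =ᶠ[𝓝 x] D.sPair a b := by
    filter_upwards [hev] with z hz
    rw [comp_apply, sTriple, sPair, tripleMap_apply hz.1 hz.2, pairMap_apply hz.1, face_two_triple]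
  have f0 : face 0 ∘ D.sTriple a b c =ᶠ[𝓝 x] D.sPair b c := by
    filter_upwards [hev] with z hz
    rw [comp_apply, sTriple, sPair, tripleMap_apply hz.1 hz.2, pairMap_apply hz.2, face_zero_triple]
  have f1 : face 1 ∘ D.sTriple a b c =ᶠ[𝓝 x] D.sPair a c := by
    filter_upwards [hev] with z hz
    rw [comp_apply, sTriple, sPair, tripleMap_apply hz.1 hz.2, pairMap_apply (hz.1.trans hz.2),
      face_one_triple]
  have hmem : D.sTriple a b c x ∈ G.mulDom k l m := by
    refine ⟨⟨?_, ?_⟩, ?_⟩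
    · change (face 2 ∘ D.sTriple a b c) x ∈ G.P.dom k
      rw [f2.eq_of_nhds]; exact hk.2
    · change (face 0 ∘ D.sTriple a b c) x ∈ G.P.dom l
      rw [f0.eq_of_nhds]; exact hl.2
    · change (face 1 ∘ D.sTriple a b c) x ∈ G.P.dom m
      rw [f1.eq_of_nhds]; exact hm.2
  have hp : ∀ (j : Fin 3) (S : M → FibrePow π 1) (A : Form (Model π 1) (FibrePow π 1) 1 ℂ),
      face j ∘ D.sTriple a b c =ᶠ[𝓝 x] S →
      Form.pullback (E := EM) (D.sTriple a b c) (Form.pullback (E := Model π 2) (face j) A) x =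
        Form.pullback S A x := by
    intro j S A hS
    rw [Form.pullback_comp A ((contMDiff_face j _).mdifferentiableAt (by simp)) hT]
    exact Form.pullback_congr A hS
  have hpar := nabla.parallel k l m _ hmem
  have hpull : Form.pullback (E := EM) (D.sPair a b) (nabla.nabla.form k) x +
      Form.pullback (D.sPair b c) (nabla.nabla.form l) x =
      Form.pullback (D.sPair a c) (nabla.nabla.form m) x +
      Form.dLog (fun z => G.mulCoeff k l m (D.sTriple a b c z)) x := by
    rw [Form.dLog_comp (G.mdiff_mulCoeff hmem) hT, ← hp 2 _ _ f2, ← hp 0 _ _ f0, ← hp 1 _ _ f1]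
    exact congrArg (fun A => ContinuousAlternatingMap.compContinuousLinearMap A
      (mfderiv 𝓘(ℝ, EM) 𝓘(ℝ, Model π 2) (D.sTriple a b c) x)) hpar
  have hκ : MDifferentiableAt 𝓘(ℝ, EM) 𝓘(ℝ, ℂ)
      (fun z => G.mulCoeff k l m (D.sTriple a b c z)) x := (G.mdiff_mulCoeff hmem).comp x hT
  have hh : MDifferentiableAt 𝓘(ℝ, EM) 𝓘(ℝ, ℂ)
      (fun z => (2 * Real.pi * Complex.I * D.h a b c z : ℂ)) x := by
    have h1 : ContDiff ℝ ∞ fun r : ℝ => (2 * Real.pi * Complex.I : ℂ) * (r : ℂ) :=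
      contDiff_const.mul Complex.ofRealCLM.contDiff
    have h2 := (D.h_smooth a b c).contMDiffAt
      ((((D.isOpen_U a).inter (D.isOpen_U b)).inter (D.isOpen_U c)).mem_nhds hx)
    exact (h1.contMDiff.contMDiffAt.comp x h2).mdifferentiableAt (by simp)
  have hexp : MDifferentiableAt 𝓘(ℝ, EM) 𝓘(ℝ, ℂ)
      (fun z => Complex.exp (2 * Real.pi * Complex.I * D.h a b c z)) x :=
    (Complex.contDiff_exp (𝕜 := ℝ) (n := 1)).contMDiff.mdifferentiableAt (by simp) |>.comp x hh
  have hlog : Form.dLog (E := EM) (D.coeff a b k) x + Form.dLog (D.coeff b c l) x +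
      Form.dLog (fun z => G.mulCoeff k l m (D.sTriple a b c z)) x =
      Form.dFun (fun z => (2 * Real.pi * Complex.I * D.h a b c z : ℂ)) x +
      Form.dLog (D.coeff a c m) x := by
    rw [← Form.dLog_exp hh, ← Form.dLog_mul (D.mdiff_coeff hk) (D.mdiff_coeff hl)
      (D.coeff_ne_zero hk) (D.coeff_ne_zero hl), ← Form.dLog_mul
      (s := fun z => D.coeff a b k z * D.coeff b c l z)
      ((D.mdiff_coeff hk).mul (D.mdiff_coeff hl)) hκ
      (mul_ne_zero (D.coeff_ne_zero hk) (D.coeff_ne_zero hl)) (G.mulCoeff_ne_zero hmem),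
      ← Form.dLog_mul hexp (D.mdiff_coeff hm) (Complex.exp_ne_zero _) (D.coeff_ne_zero hm)]
    refine Form.dLog_congr ?_
    filter_upwards [(D.isOpen_frameDom a b k).mem_nhds hk, (D.isOpen_frameDom b c l).mem_nhds hl,
      (D.isOpen_frameDom a c m).mem_nhds hm] with z h1 h2 h3
    exact D.mul_coeff h1 h2 h3
  rw [D.connForm_eq nabla hk, D.connForm_eq nabla hl, D.connForm_eq nabla hm]
  change (Form.pullback (E := EM) (D.sPair b c) (nabla.nabla.form l) x +
    Form.dLog (D.coeff b c l) x) - (Form.pullback (E := EM) (D.sPair a c) (nabla.nabla.form m) x +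
    Form.dLog (D.coeff a c m) x) + (Form.pullback (E := EM) (D.sPair a b) (nabla.nabla.form k) x +
    Form.dLog (D.coeff a b k) x) = _
  have h1 := eq_sub_of_add_eq hpull
  have h2 := eq_sub_of_add_eq hlog.symm
  rw [h1, h2]
  abel

end BundleGerbe.CechData

/-- The real linear map `z ↦ Im z / 2π`, which inverts `r ↦ 2π i r`. -/
def imDivTwoPi : ℂ →L[ℝ] ℝ := (2 * Real.pi)⁻¹ • Complex.imCLM

lemma imDivTwoPi_mul (r : ℝ) : imDivTwoPi (2 * Real.pi * Complex.I * r : ℂ) = r := by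
  have : (2 * Real.pi) ≠ 0 := by positivity
  simp [imDivTwoPi]
  field_simp

variable [IsManifold 𝓘(ℝ, EM) ∞ M] [IsManifold 𝓘(ℝ, EY) ∞ Y]

lemma map_imDivTwoPi_dFun {h : M → ℝ} {x : M} (hh : MDifferentiableAt 𝓘(ℝ, EM) 𝓘(ℝ, ℝ) h x) :
    Form.map imDivTwoPi (Form.dFun (E := EM) fun z => (2 * Real.pi * Complex.I * h z : ℂ)) x =
      Form.dFun (E := EM) h x := by
  have h1 : HasFDerivAt (fun r : ℝ => (2 * Real.pi * Complex.I : ℂ) * (r : ℂ))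
      ((2 * Real.pi * Complex.I : ℂ) • Complex.ofRealCLM) (h x) :=
    Complex.ofRealCLM.hasFDerivAt.const_mul _
  have h2 := (h1.hasMFDerivAt.comp x hh.hasMFDerivAt).mfderiv
  ext v
  have h3 := DFunLike.congr_fun h2 (v 0)
  exact (congrArg imDivTwoPi h3).trans (imDivTwoPi_mul _)

/-- The three-curvature of a curving, divided by `2π i`, represents the real Dixmier-Douady class
in the Čech-de Rham complex. -/
theorem BundleGerbe.CechData.cechDeRham {G : BundleGerbe.{v} π} (D : G.CechData)
    {nabla : G.Connection} {f : Form EY Y 2 ℂ} (hf : IsCurving nabla f) {w : Form EM M 3 ℂ}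
    (hw : IsThreeCurvature π f w) : CechDeRham D.U D.n (w.map imDivTwoPi) := by
  have hB : ∀ a, ∀ x ∈ D.U a, (Form.pullback (E := EM) (D.s a) f).SmoothAt x := fun a x hx =>
    Form.SmoothAt.pullback (hf.smooth _ (mem_univ _)) (D.contMDiffAt_s hx)
  -- The zigzag, made real by `imDivTwoPi`. Its relations are `w = d(s_a^* f)`, then `δ(f) = F_∇`
  -- pulled back along `(s_a, s_b)`, then `connForm_cocycle`, and finally the definition of the
  -- integral cocycle.
  refine ⟨fun a => Form.map imDivTwoPi (Form.pullback (D.s a) f),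
    fun a b => Form.map imDivTwoPi (D.connForm nabla a b), D.h, fun a x hx => (hB a x hx).map _,
    fun a b x hx => Form.SmoothAt.map (D.connForm_smooth nabla a b x hx) _, D.h_smooth, ?_, ?_, ?_,
    fun a b c e x hx => (D.n_eq a b c e x hx).symm⟩
  · intro a x hx
    rw [Form.d_map (hB a x hx)]
    simp only [Form.map]
    rw [Form.d_pullback (hf.smooth _ (mem_univ _)) (D.contMDiffAt_s hx), hw.d_eq,
      pullback_section π (D.isOpen_U a) (D.s_smooth a) (D.s_section a) w hx]
  · intro a b x hx
    rw [Form.d_map (D.connForm_smooth nabla a b x hx)]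
    have h : (D.connForm nabla a b).d x = Form.pullback (D.s b) f x - Form.pullback (D.s a) f x := by
      rw [D.d_connForm nabla hx, ← hf.deltaForm_eq]
      exact D.pullback_sPair_deltaForm hx f
    simp only [Form.map]
    rw [h]
    ext v
    exact (map_sub imDivTwoPi _ _).symm
  · intro a b c x hx
    have hh := (((D.h_smooth a b c).contMDiffAt
      ((((D.isOpen_U a).inter (D.isOpen_U b)).inter (D.isOpen_U c)).mem_nhds
        hx)).mdifferentiableAt (by simp))
    rw [← map_imDivTwoPi_dFun hh]
    simp only [Form.map]
    rw [← D.connForm_cocycle nabla hx]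
    ext v
    change imDivTwoPi _ - imDivTwoPi _ + imDivTwoPi _ = imDivTwoPi (_ - _ + _)
    rw [map_add, map_sub]

end CechDeRhamClass

/-! ### Covers on which transition functions have logarithms -/

section Covers

variable {E : Type*} [NormedAddCommGroup E] [NormedSpace ℝ E]
  {X : Type*} [TopologicalSpace X] [ChartedSpace E X]

lemma contMDiffOn_log_add_log {t : X → ℂ} {U : Set X} (ht : ContMDiffOn 𝓘(ℝ, E) 𝓘(ℝ, ℂ) ∞ t U)
    {c : ℂ} (h : ∀ z ∈ U, c⁻¹ * t z ∈ Complex.slitPlane) :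
    ContMDiffOn 𝓘(ℝ, E) 𝓘(ℝ, ℂ) ∞ (fun z => Complex.log c + Complex.log (c⁻¹ * t z)) U := by
  intro z hz
  have h1 : ContDiffAt ℝ ∞ (fun w => Complex.log c + Complex.log (c⁻¹ * w)) (t z) :=
    contDiffAt_const.add (((Complex.contDiffAt_log (h z hz)).restrict_scalars ℝ).comp (t z)
      (contDiffAt_const.mul contDiffAt_id))
  exact ContMDiffAt.comp_contMDiffWithinAt (g := fun w => Complex.log c + Complex.log (c⁻¹ * w)) z
    h1.contMDiffAt (ht z hz)

/-- A smooth function of modulus one which stays close to a value `c` of modulus one has a smooth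
logarithm. -/
lemma exists_real_log {t : X → ℂ} {U : Set X} (ht : ContMDiffOn 𝓘(ℝ, E) 𝓘(ℝ, ℂ) ∞ t U)
    (h1 : ∀ z ∈ U, ‖t z‖ = 1) {c : ℂ} (hc : ‖c‖ = 1) (h : ∀ z ∈ U, ‖t z - c‖ < 1) :
    ∃ l : X → ℝ, ContMDiffOn 𝓘(ℝ, E) 𝓘(ℝ, ℝ) ∞ l U ∧
      ∀ z ∈ U, Complex.exp (2 * Real.pi * Complex.I * l z) = t z := by
  have hc0 : c ≠ 0 := by rintro rfl; simp at hc
  -- As `‖c‖ = 1`, the quotient `t z / c` lies in the open unit disc around `1`, which misses the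
  -- branch cut.
  have hs : ∀ z ∈ U, c⁻¹ * t z ∈ Complex.slitPlane := by
    intro z hz
    have e : c⁻¹ * t z = 1 + c⁻¹ * (t z - c) := by field_simp; ring
    rw [e]
    refine Complex.mem_slitPlane_of_norm_lt_one ?_
    rw [norm_mul, norm_inv, hc, inv_one, one_mul]
    exact h z hz
  refine ⟨fun z => (2 * Real.pi)⁻¹ * (Complex.log c + Complex.log (c⁻¹ * t z)).im, ?_, ?_⟩
  · have hd : ContDiff ℝ ∞ fun w : ℂ => (2 * Real.pi)⁻¹ * w.im :=
      contDiff_const.mul Complex.imCLM.contDiff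
    exact hd.contMDiff.comp_contMDiffOn (contMDiffOn_log_add_log ht hs)
  · intro z hz
    set l := Complex.log c + Complex.log (c⁻¹ * t z) with hl
    have he : Complex.exp l = t z := by
      rw [hl, Complex.exp_add, Complex.exp_log hc0,
        Complex.exp_log (Complex.slitPlane_ne_zero (hs z hz)), mul_inv_cancel_left₀ hc0]
    -- The modulus of `t` is one, so its logarithm is imaginary and the imaginary part alone
    -- recovers `t`.
    have hre : l.re = 0 := by
      have := h1 z hz
      rw [← he, Complex.norm_exp, Real.exp_eq_one_iff] at this
      exact this
    change Complex.exp (2 * Real.pi * Complex.I * (((2 * Real.pi)⁻¹ * l.im : ℝ) : ℂ)) = t z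
    rw [← he]
    congr 1
    have hp : (Real.pi : ℂ) ≠ 0 := Complex.ofReal_ne_zero.2 Real.pi_ne_zero
    apply Complex.ext
    · simp [hre]
    · simp
      field_simp

/-- Arbitrarily fine covers with unitary frames of finitely many line bundles, for which all
transition functions have smooth logarithms. -/
lemma exists_cover_log_trans [T2Space X] [ParacompactSpace X] {n : ℕ}
    (L : Fin n → HermLineBundle.{v} E X) (N : X → Set X) (hN : ∀ x, N x ∈ 𝓝 x) :
    ∃ (j : X → ∀ i, (L i).Idx) (U : X → Set X), (∀ x, IsOpen (U x)) ∧ (∀ x, x ∈ U x) ∧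
      (∀ x, U x ⊆ N x) ∧ (∀ x i, U x ⊆ (L i).dom (j x i)) ∧
      ∀ x y i, ∃ l : X → ℝ, ContMDiffOn 𝓘(ℝ, E) 𝓘(ℝ, ℝ) ∞ l (U x ∩ U y) ∧
        ∀ z ∈ U x ∩ U y, Complex.exp (2 * Real.pi * Complex.I * l z) =
          (L i).trans (j x i) (j y i) z := by
  -- A frame of the tensor product is a tuple of frames, so its frame domains are the common domains
  -- of frames of all `L i`.
  set K := HermLineBundle.tensor L
  obtain ⟨V, hVo, hVc, hVf, hVs⟩ := precise_refinement K.dom K.isOpen_dom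
    (eq_univ_of_forall fun x => mem_iUnion.2 (K.exists_mem_dom x))
  -- Shrinking gives closures still inside the frame domains. A member of the cover that accumulates
  -- at `x` then has its frame defined at `x` itself.
  obtain ⟨W, hWc, hWo, hWV⟩ := exists_iUnion_eq_closure_subset hVo hVf.point_finite hVc
  have hWf : LocallyFinite fun k => closure (W k) := hVf.subset hWV
  have hex : ∀ x, ∃ k, x ∈ W k := fun x => mem_iUnion.1 (hWc ▸ mem_univ x)
  choose j hj using hex
  have hdom : ∀ (k : ∀ i, (L i).Idx) (i : Fin n) (x : X), x ∈ closure (W k) → x ∈ (L i).dom (k i) :=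
    fun k i x hx => mem_iInter.1 (hVs k (hWV k hx)) i
  -- Near `x` only those closures occur that contain `x`. There are finitely many, so one
  -- neighbourhood serves for all of them: there the transition functions from the frame at `x` vary
  -- by less than one.
  have hnear : ∀ x, ∀ᶠ z in 𝓝 x, (∀ k, z ∈ closure (W k) → x ∈ closure (W k)) ∧
      (∀ k ∈ {k | x ∈ closure (W k)}, ∀ i, z ∈ (L i).dom (k i) ∧
        ‖(L i).trans (j x i) (k i) z - (L i).trans (j x i) (k i) x‖ < 1) ∧
      z ∈ W (j x) ∧ z ∈ N x := by
    intro x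
    refine Filter.Eventually.and ?_ (Filter.Eventually.and ?_ (Filter.Eventually.and
      ((hWo _).mem_nhds (hj x)) (hN x)))
    · filter_upwards [hWf.iInter_compl_mem_nhds (fun _ => isClosed_closure) x] with z hz k hk
      by_contra hx
      exact mem_iInter₂.1 hz k hx hk
    · rw [Filter.eventually_all_finite (hWf.point_finite x)]
      intro k hk
      rw [Filter.eventually_all]
      intro i
      have hx : x ∈ (L i).dom (j x i) ∩ (L i).dom (k i) :=
        ⟨hdom _ i x (subset_closure (hj x)), hdom k i x hk⟩
      have hc := (((L i).trans_smooth (j x i) (k i)).contMDiffAt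
        (((L i).isOpen_inter _ _).mem_nhds hx)).continuousAt
      filter_upwards [((L i).isOpen_dom _).mem_nhds hx.2,
        Metric.continuousAt_iff'.1 hc 1 one_pos] with z h1 h2
      rw [dist_eq_norm] at h2
      exact ⟨h1, h2⟩
  have hU : ∀ x, ∃ U : Set X, (∀ z ∈ U, _) ∧ IsOpen U ∧ x ∈ U := fun x =>
    eventually_nhds_iff.1 (hnear x)
  choose U hUp hUo hxU using hU
  have hUd : ∀ x i, U x ⊆ (L i).dom (j x i) := fun x i z hz =>
    hdom _ i z (subset_closure (hUp x z hz).2.2.1)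
  refine ⟨j, U, hUo, hxU, fun x z hz => (hUp x z hz).2.2.2, hUd, fun x y i => ?_⟩
  by_cases hne : (U x ∩ U y).Nonempty
  · obtain ⟨z₀, hz₀⟩ := hne
    -- A common point of `U x` and `U y` lies in `W (j y)`, so the frame of `y` is among the
    -- finitely many controlled near `x`. On the overlap its transition function stays within
    -- distance one of its value at `x`, even if the overlap is disconnected.
    have hxy : x ∈ closure (W (j y)) :=
      (hUp x z₀ hz₀.1).1 (j y) (subset_closure (hUp y z₀ hz₀.2).2.2.1)
    have hsub : U x ∩ U y ⊆ (L i).dom (j x i) ∩ (L i).dom (j y i) := fun z hz =>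
      ⟨hUd x i hz.1, hUd y i hz.2⟩
    exact exists_real_log (((L i).trans_smooth (j x i) (j y i)).mono hsub)
      (fun z hz => (L i).norm_trans _ _ z (hsub hz))
      ((L i).norm_trans (j x i) (j y i) x ⟨hUd x i (hxU x), hdom _ i x hxy⟩)
      fun z hz => ((hUp x z hz.1).2.1 (j y) hxy i).2
  · rw [not_nonempty_iff_eq_empty] at hne
    rw [hne]
    exact ⟨fun _ => 0, fun z hz => hz.elim, fun z hz => hz.elim⟩

lemma HermLineBundle.trans_self (L : HermLineBundle.{v} E X) {a : L.Idx} {x : X}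
    (ha : x ∈ L.dom a) : L.trans a a x = 1 := by
  have h := L.frame_eq a a x ⟨ha, ha⟩
  refine smul_left_injective ℂ (L.frame_ne_zero a x ha) ?_
  simp only
  rw [← h, one_smul]

lemma HermLineBundle.trans_mul_trans (L : HermLineBundle.{v} E X) {a b c : L.Idx} {x : X}
    (ha : x ∈ L.dom a) (hb : x ∈ L.dom b) (hc : x ∈ L.dom c) :
    L.trans b c x * L.trans a b x = L.trans a c x := by
  have h := L.frame_eq b c x ⟨hb, hc⟩
  rw [L.frame_eq a b x ⟨ha, hb⟩, L.frame_eq a c x ⟨ha, hc⟩, smul_smul] at h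
  exact (smul_left_injective ℂ (L.frame_ne_zero a x ha) h).symm

end Covers

/-! ### Čech data for products of cup product bundle gerbes -/

section CupProductCech

variable {EY : Type*} [NormedAddCommGroup EY] [NormedSpace ℝ EY]
  {Y : Type*} [TopologicalSpace Y] [ChartedSpace EY Y]
  {EM : Type*} [NormedAddCommGroup EM] [NormedSpace ℝ EM]
  {M : Type u} [TopologicalSpace M] [ChartedSpace EM M]
  {π : SurjSubmersion EY Y EM M}

open FibrePow

/-- The Dixmier-Douady cocycle of a product of cup product bundle gerbes is defined on a suitable
cover. -/
lemma nonempty_cechData_cupProduct [T2Space M] [ParacompactSpace M] {n : ℕ}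
    (L : Fin n → HermLineBundle.{v} EM M)
    (g : Fin n → FibrePow π 1 → ℤ) (hg : ∀ i, IsLocallyConstant (g i))
    (hδ : ∀ i, delta (g i) = 0) :
    Nonempty (BundleGerbe.reducedProduct fun i =>
      BundleGerbe.cupProduct π (L i) (g i) (hg i) (hδ i)).CechData := by
  choose N s hNo hxN hs hπN using π.exists_section_nhds
  obtain ⟨j, U, hUo, hxU, hUN, hUd, hlog⟩ := exists_cover_log_trans L N
    fun x => (hNo x).mem_nhds (hxN x)
  choose l hl hexp using hlog
  set G := BundleGerbe.reducedProduct fun i =>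
    BundleGerbe.cupProduct π (L i) (g i) (hg i) (hδ i) with hG
  have hπ : ∀ a, ∀ x ∈ U a, π (s a x) = x := fun a x hx => hπN a x (hUN a hx)
  have hsU : ∀ a, ContMDiffOn 𝓘(ℝ, EM) 𝓘(ℝ, EY) ∞ (s a) (U a) := fun a => (hs a).mono (hUN a)
  have hπ2 : ∀ {a b x}, x ∈ U a → x ∈ U b → π (s a x) = π (s b x) := fun {a b x} ha hb =>
    (hπ a x ha).trans (hπ b x hb).symm
  have hpair : ∀ {a b x}, x ∈ U a ∩ U b →
      ContMDiffAt 𝓘(ℝ, EM) 𝓘(ℝ, Model π 1) ∞ (pairMap π (s a) (s b)) x := fun {a b x} hx =>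
    contMDiffAt_pairMap ((hsU a).contMDiffAt ((hUo a).mem_nhds hx.1))
      ((hsU b).contMDiffAt ((hUo b).mem_nhds hx.2))
      (Filter.eventually_of_mem (((hUo a).inter (hUo b)).mem_nhds hx) fun z hz => hπ2 hz.1 hz.2)
  have hdom : ∀ {a b c x} (ha : x ∈ U a) (hb : x ∈ U b) (_ : x ∈ U c),
      pair (hπ2 ha hb) ∈ G.P.dom (j c) := fun {a b c x} ha hb hc =>
    mem_iInter.2 fun i => by
      change π (s a x) ∈ (L i).dom (j c i)
      rw [hπ a x ha]
      exact hUd c i hc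
  -- The Čech coboundary of `h_{abc} = ∑ g_i(s_b, s_c) l_{ab}` is integral. Since `g_i(s_b, s_e) -
  -- g_i(s_b, s_c) = g_i(s_c, s_e)`, it equals `∑ g_i(s_c, s_e) (l_{bc} - l_{ac} + l_{ab})`, and
  -- each bracket is an integer `m i` by the cocycle rule for transition functions.
  have hint : ∀ a b c e x, ∃ m : ℤ, x ∈ U a ∩ U b ∩ U c ∩ U e → (m : ℝ) =
      (∑ i, (g i (pairMap π (s c) (s e) x) : ℝ) * l b c i x) -
      (∑ i, (g i (pairMap π (s c) (s e) x) : ℝ) * l a c i x) +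
      (∑ i, (g i (pairMap π (s b) (s e) x) : ℝ) * l a b i x) -
      (∑ i, (g i (pairMap π (s b) (s c) x) : ℝ) * l a b i x) := by
    intro a b c e x
    by_cases hx : x ∈ U a ∩ U b ∩ U c ∩ U e
    swap
    -- The cocycle is constrained only on fourfold overlaps; elsewhere zero serves as a default.
    · exact ⟨0, fun h => absurd h hx⟩
    obtain ⟨⟨⟨ha, hb⟩, hc⟩, he⟩ := hx
    have hm : ∀ i, ∃ m : ℤ, l b c i x - l a c i x + l a b i x = m := by
      intro i
      have h1 : Complex.exp (2 * Real.pi * Complex.I * l b c i x -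
          2 * Real.pi * Complex.I * l a c i x + 2 * Real.pi * Complex.I * l a b i x) = 1 := by
        rw [Complex.exp_add, Complex.exp_sub, hexp b c i x ⟨hb, hc⟩, hexp a c i x ⟨ha, hc⟩,
          hexp a b i x ⟨ha, hb⟩, div_mul_eq_mul_div,
          (L i).trans_mul_trans (hUd a i ha) (hUd b i hb) (hUd c i hc)]
        exact div_self ((L i).trans_ne_zero ⟨hUd a i ha, hUd c i hc⟩)
      obtain ⟨m, hm⟩ := Complex.exp_eq_one_iff.1 h1
      refine ⟨m, ?_⟩
      have h2 : (2 * Real.pi * Complex.I : ℂ) * ((l b c i x - l a c i x + l a b i x : ℝ) : ℂ) =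
          (2 * Real.pi * Complex.I : ℂ) * ((m : ℝ) : ℂ) := by
        push_cast
        linear_combination hm
      exact Complex.ofReal_injective (mul_left_cancel₀ Complex.two_pi_I_ne_zero h2)
    choose m hm using hm
    refine ⟨∑ i, g i (pairMap π (s c) (s e) x) * m i, fun _ => ?_⟩
    push_cast
    rw [← Finset.sum_sub_distrib, ← Finset.sum_add_distrib, ← Finset.sum_sub_distrib]
    refine Finset.sum_congr rfl fun i _ => ?_
    have hcoc := cocycle_pair (hδ i) (hπ2 hb hc) (hπ2 hc he)
    rw [← hm i, pairMap_apply (hπ2 hb hc), pairMap_apply (hπ2 hc he), pairMap_apply (hπ2 hb he),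
      hcoc]
    push_cast
    ring
  choose m hm using hint
  -- The cover is indexed by the points of `M`, and `σ_{ab}` is the product frame attached to the
  -- first index `a`.
  refine ⟨{
    ι := M
    U := U
    isOpen_U := hUo
    exists_mem_U := fun x => ⟨x, hxU x⟩
    s := s
    s_smooth := hsU
    s_section := hπ
    σ := fun a b x ha hb => G.P.frame (j a) _
    σ_smooth := ?_
    h := fun a b c x => ∑ i, (g i (pairMap π (s b) (s c) x) : ℝ) * l a b i x
    h_smooth := ?_
    mul_σ := ?_
    n := m
    n_eq := fun a b c e x hx => hm a b c e x hx }⟩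
  · intro a b k
    refine ⟨fun x => G.P.trans k (j a) (pairMap π (s a) (s b) x), ?_, ?_⟩
    · rintro x ⟨ha, hb, hk⟩
      have h1 : pairMap π (s a) (s b) x ∈ G.P.dom k ∩ G.P.dom (j a) := by
        rw [pairMap_apply (hπ2 ha hb)]
        exact ⟨hk, hdom ha hb ha⟩
      exact (((G.P.trans_smooth k (j a)).contMDiffAt
        ((G.P.isOpen_inter k (j a)).mem_nhds h1)).comp x (hpair ⟨ha, hb⟩)).contMDiffWithinAt
    · intro x ha hb hk
      beta_reduce
      rw [pairMap_apply (hπ2 ha hb)]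
      exact ⟨G.P.norm_trans k (j a) _ ⟨hk, hdom ha hb ha⟩,
        G.P.frame_eq k (j a) _ ⟨hk, hdom ha hb ha⟩⟩
  · intro a b c x hx
    apply ContMDiffAt.contMDiffWithinAt
    refine contMDiffAt_finsetSum fun i _ => ?_
    have h1 : ∀ᶠ z in 𝓝 x, g i (pairMap π (s b) (s c) z) = g i (pairMap π (s b) (s c) x) :=
      (hpair ⟨hx.1.2, hx.2⟩).continuousAt.preimage_mem_nhds
        (((hg i).isOpen_fiber _).mem_nhds rfl)
    have h2 : ContMDiffAt 𝓘(ℝ, EM) 𝓘(ℝ, ℝ) ∞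
        (fun z => (g i (pairMap π (s b) (s c) x) : ℝ) * l a b i z) x :=
      (contDiff_const.mul contDiff_id : ContDiff ℝ ∞
        fun w : ℝ => (g i (pairMap π (s b) (s c) x) : ℝ) * w).contMDiff.contMDiffAt.comp x
        ((hl a b i).contMDiffAt (((hUo a).inter (hUo b)).mem_nhds hx.1))
    refine h2.congr_of_eventuallyEq ?_
    filter_upwards [h1] with z hz
    rw [hz]
  · intro a b c x ha hb hc
    refine (G.mul_frame (j a) (j b) (j a) (hπ2 ha hb) (hπ2 hb hc) (hdom ha hb ha) (hdom hb hc hb)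
      (hdom ha hc ha)).trans ?_
    congr 1
    -- Because `σ_{ab}` and `σ_{ac}` use the same frame `j a`, the first transition factor is `1`.
    -- What remains is the product of the `(j a, j b)` transition functions to the powers `g_i(s_b,
    -- s_c)`, which accounts for the formula for `h`.
    have h1 : G.mulCoeff (j a) (j b) (j a) (triple (hπ2 ha hb) (hπ2 hb hc)) =
        ∏ i, ((L i).trans (j a i) (j a i) (π (s a x)) ^
            g i (face 2 (triple (hπ2 ha hb) (hπ2 hb hc))) *
          (L i).trans (j a i) (j b i) (π (s a x)) ^
            g i (face 0 (triple (hπ2 ha hb) (hπ2 hb hc)))) := rfl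
    rw [h1]
    push_cast
    rw [Finset.mul_sum, Complex.exp_sum]
    refine Finset.prod_congr rfl fun i _ => ?_
    rw [hπ a x ha, (L i).trans_self (hUd a i ha), one_zpow, one_mul, face_zero_triple,
      pairMap_apply (hπ2 hb hc), ← hexp a b i x ⟨ha, hb⟩, ← Complex.exp_int_mul]
    congr 1
    ring

end CupProductCech

/-! ### From the three-curvature to a real de Rham representative -/

section Represented

variable {EY : Type*} [NormedAddCommGroup EY] [NormedSpace ℝ EY]
  {Y : Type*} [TopologicalSpace Y] [ChartedSpace EY Y] [IsManifold 𝓘(ℝ, EY) ∞ Y]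
  {EM : Type*} [NormedAddCommGroup EM] [NormedSpace ℝ EM]
  {M : Type u} [TopologicalSpace M] [ChartedSpace EM M] [IsManifold 𝓘(ℝ, EM) ∞ M]
  {π : SurjSubmersion EY Y EM M}

/-- The real part of `w` pulls back to the real part of `df`, which is zero, and pullback along `π`
is injective. -/
lemma imaginary_of_pullback_eq_d {f : Form EY Y 2 ℂ} (hf : f.Smooth) (hi : f.ImaginaryOn univ)
    {w : Form EM M 3 ℂ} (hw : f.d = Form.pullback π w) : w.ImaginaryOn univ := by
  have h : w.map Complex.reCLM = 0 := by
    refine pullback_injective π ?_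
    rw [Form.pullback_map, ← hw]
    funext y
    exact Form.imaginary_iff_map_re.1 fun v => Form.imaginary_d (hf y (mem_univ _))
      (Filter.Eventually.of_forall fun z => hi z (mem_univ _)) v
  exact fun x _ => Form.imaginary_iff_map_re.2 (congrFun h x)

/-- The pullback of `dw` is `d(df) = 0`, and pullback along `π` is injective. -/
lemma closed_of_pullback_eq_d {f : Form EY Y 2 ℂ} (hf : f.Smooth)
    {w : Form EM M 3 ℂ} (hws : w.Smooth) (hw : f.d = Form.pullback π w) : w.d = 0 := by
  refine pullback_injective π ?_
  funext y
  rw [← Form.d_pullback (hws _ (mem_univ _)) (π.contMDiff y), ← hw]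
  exact Form.d_d hf Filter.univ_mem

/-- If a Dixmier-Douady cocycle exists, then the real Dixmier-Douady class is represented by the
three-curvature divided by `2π i`. -/
theorem BundleGerbe.realDDRepresentedBy_of_curving {G : BundleGerbe.{v} π} {nabla : G.Connection}
    {f : Form EY Y 2 ℂ} (hf : IsCurving nabla f) {w : Form EM M 3 ℂ}
    (hw : IsThreeCurvature π f w) (hG : Nonempty G.CechData) :
    G.RealDDRepresentedBy (w.map imDivTwoPi) where
  smooth := fun x hx => Form.SmoothAt.map (hw.smooth x hx) _
  closed := by
    funext x
    rw [Form.d_map (hw.smooth x (mem_univ _))]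
    simp only [Form.map]
    rw [closed_of_pullback_eq_d hf.smooth hw.smooth hw.d_eq]
    ext v
    exact map_zero imDivTwoPi
  exists_cechData := hG
  cechDeRham := fun D => D.cechDeRham hf hw

/-- On imaginary values `Im / 2π` is division by `2π i`. This connects the real representative in
the definition of the class with the complex formula for it. -/
lemma toComplex_map_imDivTwoPi {w : Form EM M 3 ℂ} (hw : w.ImaginaryOn univ) :
    (w.map imDivTwoPi).toComplex = (2 * Real.pi * Complex.I : ℂ)⁻¹ • w := by
  funext x
  ext v
  change ((imDivTwoPi (w x v) : ℝ) : ℂ) = (2 * Real.pi * Complex.I : ℂ)⁻¹ * w x v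
  have h : w x v = 2 * Real.pi * Complex.I * ((imDivTwoPi (w x v) : ℝ) : ℂ) := by
    have hp : (Real.pi : ℂ) ≠ 0 := Complex.ofReal_ne_zero.2 Real.pi_ne_zero
    have e : ((imDivTwoPi (w x v) : ℝ) : ℂ) = (2 * Real.pi : ℂ)⁻¹ * ((w x v).im : ℂ) := by
      simp [imDivTwoPi]
    rw [e]
    apply Complex.ext
    · have := hw x (mem_univ _) v
      field_simp
      simp [this]
    · field_simp
      simp
  rw [h, ← mul_assoc, inv_mul_cancel₀ Complex.two_pi_I_ne_zero, one_mul, ← h]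

end Represented

end

/-! ### The four assertions assembled -/

theorem proposition3p7
    {EM : Type*} [NormedAddCommGroup EM] [NormedSpace ℝ EM] [FiniteDimensional ℝ EM]
    {M : Type*} [TopologicalSpace M] [T2Space M] [SecondCountableTopology M]
    [ChartedSpace EM M] [IsManifold 𝓘(ℝ, EM) ∞ M]
    {EY : Type*} [NormedAddCommGroup EY] [NormedSpace ℝ EY] [FiniteDimensional ℝ EY]
    {Y : Type*} [TopologicalSpace Y] [T2Space Y] [SecondCountableTopology Y]
    [ChartedSpace EY Y] [IsManifold 𝓘(ℝ, EY) ∞ Y]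
    (π : SurjSubmersion EY Y EM M) {n : ℕ}
    (L : Fin n → HermLineBundle EM M) (nabla : ∀ i, (L i).Connection)
    (g : Fin n → FibrePow π 1 → ℤ) (hg : ∀ i, IsLocallyConstant (g i))
    (hδ : ∀ i, FibrePow.delta (g i) = 0) :
    (∃ φ : Fin n → Y → ℝ, ∀ i, ContMDiff 𝓘(ℝ, EY) 𝓘(ℝ, ℝ) ∞ (φ i) ∧
      FibrePow.deltaFun (φ i) = fun z : FibrePow π 1 => (g i z : ℝ)) ∧
    ∀ φ : Fin n → Y → ℝ, (∀ i, ContMDiff 𝓘(ℝ, EY) 𝓘(ℝ, ℝ) ∞ (φ i)) →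
      (∀ i, FibrePow.deltaFun (φ i) = fun z : FibrePow π 1 => (g i z : ℝ)) →
      let f : Form EY Y 2 ℂ := fun y => ∑ i, φ i y • Form.pullback π (nabla i).curvature y
      FibrePow.deltaForm f =
        ∑ i, (BundleGerbe.cupConnection π (nabla i) (g i) (hg i) (hδ i)).nabla.curvature ∧
      BundleGerbe.IsCurving (BundleGerbe.productConnection fun i =>
        BundleGerbe.cupConnection π (nabla i) (g i) (hg i) (hδ i)) f ∧
      ∃ q : Fin n → M → Circle,
        (∀ i, ContMDiff 𝓘(ℝ, EM) (𝓡 1) ∞ (q i)) ∧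
        (∀ i y, (q i (π y) : ℂ) = Complex.exp (2 * Real.pi * Complex.I * φ i y)) ∧
        (∀ w : Form EM M 3 ℂ, BundleGerbe.IsThreeCurvature π f w ↔
          w = ∑ i, Form.wedge
            ((2 * Real.pi * Complex.I : ℂ)⁻¹ • Form.dLog fun m => (q i m : ℂ))
            (nabla i).curvature) ∧
        ∃ η : Form EM M 3 ℝ,
          η.toComplex = (-(1 / (4 * (Real.pi : ℂ) ^ 2))) •
            ∑ i, Form.wedge (Form.dLog fun m => (q i m : ℂ)) (nabla i).curvature ∧
          (BundleGerbe.reducedProduct fun i =>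
            BundleGerbe.cupProduct π (L i) (g i) (hg i) (hδ i)).RealDDRepresentedBy η := by
  -- With the Hausdorff and second countability assumptions this makes `M` paracompact, as the
  -- construction of the Čech data requires.
  have : LocallyCompactSpace M := Manifold.locallyCompact_of_finiteDimensional 𝓘(ℝ, EM)
  refine ⟨?_, ?_⟩
  · choose φ hφ using fun i => FibrePow.exists_deltaFun_eq (hg i) (hδ i)
    exact ⟨φ, hφ⟩
  intro φ hφ hφg f
  have hf : f = ∑ i, Form.fsmul (φ i) (Form.pullback (E := EY) π (nabla i).curvature) := by
    funext y
    rw [Finset.sum_apply]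
    rfl
  have hdelta : FibrePow.deltaForm f =
      ∑ i, (BundleGerbe.cupConnection π (nabla i) (g i) (hg i) (hδ i)).nabla.curvature := by
    funext z
    rw [hf, deltaForm_sum_fsmul hφg, Finset.sum_apply]
    exact Finset.sum_congr rfl fun i _ =>
      (cupConnection_curvature (nabla i) (g i) (hg i) (hδ i) z).symm
  have hcurv : BundleGerbe.IsCurving (BundleGerbe.productConnection fun i =>
      BundleGerbe.cupConnection π (nabla i) (g i) (hg i) (hδ i)) f := by
    refine ⟨?_, ?_, ?_⟩
    · rw [hf]
      exact fun y _ => Form.SmoothAt.sum fun i _ => Form.SmoothAt.fsmul (hφ i y)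
        (Form.SmoothAt.pullback ((nabla i).curvature_smooth _ (mem_univ _)) (π.contMDiff y))
    · intro y _ v
      rw [hf, Finset.sum_apply, ContinuousAlternatingMap.sum_apply, Complex.re_sum]
      refine Finset.sum_eq_zero fun i _ => ?_
      have h := (nabla i).curvature_imaginary (π y) (mem_univ _)
        (mfderiv 𝓘(ℝ, EY) 𝓘(ℝ, EM) π y ∘ v)
      change (φ i y • (nabla i).curvature (π y) (mfderiv 𝓘(ℝ, EY) 𝓘(ℝ, EM) π y ∘ v)).re = 0
      rw [Complex.real_smul, Complex.re_ofReal_mul, h, mul_zero]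
    · rw [hdelta]
      exact (HermLineBundle.Connection.curvature_tensor fun i =>
        (BundleGerbe.cupConnection π (nabla i) (g i) (hg i) (hδ i)).nabla).symm
  refine ⟨hdelta, hcurv, ?_⟩
  choose q hq hqφ using fun i => exists_circle_descent (hφ i) (hφg i)
  set w : Form EM M 3 ℂ := ∑ i, Form.wedge
    ((2 * Real.pi * Complex.I : ℂ)⁻¹ • Form.dLog fun m => (q i m : ℂ)) (nabla i).curvature with hw
  have hdf : f.d = Form.pullback π w := by
    rw [hf]
    exact d_sum_fsmul_pullback (fun i => (nabla i).curvature_smooth)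
      (fun i => (nabla i).d_curvature) hφ hq hqφ
  have hwthree : BundleGerbe.IsThreeCurvature π f w := by
    refine ⟨fun x _ => Form.SmoothAt.sum fun i _ => Form.SmoothAt.wedge ?_
      ((nabla i).curvature_smooth _ (mem_univ _)), hdf⟩
    exact Form.SmoothAt.const_smul (Form.smoothOn_dLog isOpen_univ
      (contMDiff_circle_coe (hq i)).contMDiffOn
      (fun m _ => Circle.coe_ne_zero (q i m)) x (mem_univ _)) _
  -- The real representative is `ω / 2π i`, realized as `w.map imDivTwoPi`.
  refine ⟨q, hq, hqφ, fun w' => ⟨fun h => ?_, fun h => h ▸ hwthree⟩, w.map imDivTwoPi, ?_,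
    BundleGerbe.realDDRepresentedBy_of_curving hcurv hwthree
      (nonempty_cechData_cupProduct L g hg hδ)⟩
  · exact pullback_injective π (h.d_eq.symm.trans hdf)
  · rw [toComplex_map_imDivTwoPi (imaginary_of_pullback_eq_d hcurv.smooth hcurv.imaginary hdf), hw]
    simp only [Form.wedge_smul_left]
    -- One factor `(2π i)⁻¹` comes from the formula for `ω` and the other from the normalization of
    -- the class; their product is `-1/(4π²)`.
    rw [← Finset.smul_sum, smul_smul]
    congr 1
    have hp : (Real.pi : ℂ) ≠ 0 := Complex.ofReal_ne_zero.2 Real.pi_ne_zero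
    have hI : Complex.I ^ 2 = -1 := Complex.I_sq
    field_simp
    rw [hI]
    ring
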